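/- Let $n\ge 1$, $\Omega\subset\mathbb R^n$ open, $s\in(0,1)$, $p\in(1,\infty)$, $m\in[p,\infty)$, and let $W:[-1,1]\to[0,\infty)$ be lower semicontinuous and such that, for some $\lambda\in(0,1]$, $\Lambda\in[1,\infty)$, $\theta\in(-1,1)$, $q\in(0,1)$, $c_1\in(0,\infty)$, $$\lambda\,\chi_{(-\infty,\theta]}(x)\,|1+x|^m\le W(x)\le\Lambda|1+x|^m\quad\text{for all }x\in[-1,1],$$ $$W(t)-W(r)\ge c_1(t-r)|1+r|^{m-1}+c_1(t-r)^{k}\quad\text{whenever }-1\le r\le t\le-1+q,$$ where $k=\lceil m\rceil$ is the smallest integer $\geq m$. For measurable $u:\mathbb R^n\to\mathbb R$ set $$\mathcal K_s^p(u,\Omega)=\frac12\int_\Omega\int_\Omega\frac{|u(x)-u(y)|^p}{|x-y|^{n+sp}}\,dx\,dy+\int_\Omega\int_{\mathbb R^n\setminus\Omega}\frac{|u(x)-u(y)|^p}{|x-y|^{n+sp}}\,dx\,dy,$$ $$\mathcal E_s^p(u,\Omega)=(1-s)\mathcal K_s^p(u,\Omega)+\int_\Omega W(u)\,dx .$$ Let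 $X^{s,p}(\Omega)$ be the set of measurable $u:\mathbb R^n\to\mathbb R$ with $\mathcal K_s^p(u,\Omega)<\infty$ and $\|u\|_{L^\infty(\mathbb R^n)}\le1$. For $\epsilon\ge0$ and $\Omega$ bounded, $u\in X^{s,p}(\Omega)$ is called an $\epsilon$-minimizer for $\mathcal E_s^p$ in $\Omega$ if $\mathcal E_s^p(u,\Omega)\le\epsilon+\mathcal E_s^p(v,\Omega)$ for every $v\in X^{s,p}(\Omega)$ with $v=u$ a.e. in $\mathbb R^n\setminus\Omega$; for $\Omega$ unbounded, $u\in X^{s,p}(\Omega)$ is called an $\epsilon$-minimizer in $\Omega$ if it is an $\epsilon$-minimizer in every open $\Omega'\subset\subset\Omega$. Write $B_r$ for the open ball of radius $r$ centred at $0$ and $\mathcal L^n$ for the Lebesgue measure. **Theorem (density estimates for $\epsilon$-minimizers).** Let $\theta_1,\theta_2\in(-1,\theta]$, $\theta_*=\min\{\theta_1,\theta_2,-1+q\}$ and $\theta^*=\max\{\theta_1,\theta_2,-1+q\}$. Let $u\in X^{s,p}(\Omega)$ and $c_0,r_0\in(0,\infty)$ be such that $B_{r_0}\subset\Omega$ and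 $$\mathcal L^n(B_{r_0}\cap\{u>\theta_1\})>c_0.$$ Then there exists $\delta\in(0,\infty)$, depending only on $s,n,p,m,c_1,\theta_*,c_0$, such that, if $\epsilon\in[0,\delta)$ and $u$ is an $\epsilon$-minimizer for $\mathcal E_s^p$ in $\Omega$, the following holds: there exist $R^*\in[r_0,\infty)$, depending only on $s,n,p,m,c_1,\theta_*,r_0$; $\tilde c\in(0,1)$, depending only on $s,n,p,m,\Lambda,c_1,\theta_*,r_0,c_0$; and $c\in(0,\infty)$, depending only on $m,\theta_*$, such that, for every $r\in[R^*,\infty)$ with $B_{3r}\subset\Omega$, $$c\int_{B_r\cap\{\theta_*<u\le\theta^*\}}|1+u(x)|^m\,dx+\mathcal L^n(B_r\cap\{u>\theta_2\})>\tilde c\,r^n.$$ -/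

import Mathlib

open MeasureTheory Set
open scoped ENNReal

noncomputable section

namespace NonlocalPhase

/-- The structural assumptions on the potential. `W` is a function on `[-1,1]`: only its values on
`Icc (-1) 1` are constrained (and only these matter below). Nonnegativity of `W` on `[-1,1]`
is part of `bounds`. The exponent `⌈m⌉₊` is `m` if `m` is an integer, and `[m] + 1` otherwise. -/
structure IsDegeneratePotential (W : ℝ → ℝ) (m lam Lam θ q c₁ : ℝ) : Prop where
  lam_mem : lam ∈ Ioc (0 : ℝ) 1
  Lam_mem : Lam ∈ Ici (1 : ℝ)
  theta_mem : θ ∈ Ioo (-1 : ℝ) 1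
  q_mem : q ∈ Ioo (0 : ℝ) 1
  c₁_pos : 0 < c₁
  lsc : LowerSemicontinuousOn W (Icc (-1) 1)
  bounds : ∀ x ∈ Icc (-1 : ℝ) 1,
    lam * (Iic θ).indicator (fun _ => (1 : ℝ)) x * |1 + x| ^ m ≤ W x ∧ W x ≤ Lam * |1 + x| ^ m
  growth : ∀ r t : ℝ, -1 ≤ r → r ≤ t → t ≤ -1 + q →
    c₁ * (t - r) * |1 + r| ^ (m - 1) + c₁ * (t - r) ^ ⌈m⌉₊ ≤ W t - W r

variable {n : ℕ}

/-- The integrand `|u(x) - u(y)|^p / |x - y|^(n + s p)`. -/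
def gagliardo (s p : ℝ) (u : EuclideanSpace ℝ (Fin n) → ℝ) (x y : EuclideanSpace ℝ (Fin n)) :
    ℝ≥0∞ :=
  ENNReal.ofReal (|u x - u y| ^ p / ‖x - y‖ ^ ((n : ℝ) + s * p))

/-- The kinetic energy `K_s^p(u, Ω)`. -/
def kinetic (s p : ℝ) (u : EuclideanSpace ℝ (Fin n) → ℝ) (Ω : Set (EuclideanSpace ℝ (Fin n))) :
    ℝ≥0∞ :=
  (1 / 2) * (∫⁻ x in Ω, ∫⁻ y in Ω, gagliardo s p u x y)
    + ∫⁻ x in Ω, ∫⁻ y in Ωᶜ, gagliardo s p u x y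

/-- The renormalized energy `E_s^p(u, Ω) = (1 - s) K_s^p(u, Ω) + ∫_Ω W(u)`. -/
def energy (W : ℝ → ℝ) (s p : ℝ) (u : EuclideanSpace ℝ (Fin n) → ℝ)
    (Ω : Set (EuclideanSpace ℝ (Fin n))) : ℝ≥0∞ :=
  ENNReal.ofReal (1 - s) * kinetic s p u Ω + ∫⁻ x in Ω, ENNReal.ofReal (W (u x))

/-- The space `X^{s,p}(Ω)`: (Lebesgue) measurable `u : ℝⁿ → ℝ` with finite kinetic energy in `Ω`
and `‖u‖_{L^∞(ℝⁿ)} ≤ 1`. -/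
def X (s p : ℝ) (Ω : Set (EuclideanSpace ℝ (Fin n))) : Set (EuclideanSpace ℝ (Fin n) → ℝ) :=
  {u | AEMeasurable u volume ∧ kinetic s p u Ω < ∞ ∧ ∀ᵐ x, |u x| ≤ 1}

/-- The space `X_f^{s,p}(Ω)` of functions of `X^{s,p}(Ω)` which equal `f` a.e. outside `Ω`. -/
def XTrace (s p : ℝ) (f : EuclideanSpace ℝ (Fin n) → ℝ) (Ω : Set (EuclideanSpace ℝ (Fin n))) :
    Set (EuclideanSpace ℝ (Fin n) → ℝ) :=
  {u | u ∈ X s p Ω ∧ ∀ᵐ x, x ∉ Ω → u x = f x}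

/-- The `ε`-minimality inequality in `Ω`, among all competitors with the same exterior values. -/
def EpsMinimizes (W : ℝ → ℝ) (s p ε : ℝ) (u : EuclideanSpace ℝ (Fin n) → ℝ)
    (Ω : Set (EuclideanSpace ℝ (Fin n))) : Prop :=
  u ∈ X s p Ω ∧ ∀ v ∈ XTrace s p u Ω, energy W s p u Ω ≤ ENNReal.ofReal ε + energy W s p v Ω

/-- `u ∈ X^{s,p}(Ω)` is an `ε`-minimizer: if `Ω` is bounded, the inequality holds in `Ω`; if `Ω` is
unbounded, it holds in every open `Ω'` compactly contained in `Ω`. -/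
def IsEpsMinimizer (W : ℝ → ℝ) (s p ε : ℝ) (u : EuclideanSpace ℝ (Fin n) → ℝ)
    (Ω : Set (EuclideanSpace ℝ (Fin n))) : Prop :=
  u ∈ X s p Ω ∧
    (Bornology.IsBounded Ω → EpsMinimizes W s p ε u Ω) ∧
    (¬ Bornology.IsBounded Ω → ∀ Ω' : Set (EuclideanSpace ℝ (Fin n)), IsOpen Ω' →
      IsCompact (closure Ω') → closure Ω' ⊆ Ω → EpsMinimizes W s p ε u Ω')

end NonlocalPhase

end

open MeasureTheory Set
open scoped ENNReal

noncomputable section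

namespace NonlocalPhase

/-! ### The odd power `t ↦ |t| ^ (r - 1) * t` -/

/-! Write `σ = s * p` and compare `u` with `min u w`, where `w` is a barrier: `w = 1` outside `B_R`,
`w` is close to `-1` in `B_{R-K}`, and the truncated nonlocal operator of `w` is at most `τ (1 +
w)^(m-1)`, uniformly in the truncation (`exists_barrier`). By convexity of `|·|^p`, passing from `u`
to `min u w` raises the kinetic energy by at most `p τ ∫ (u - w)₊ (1 + w)^(m-1)`, less a
quantitative gap coming from pairs on which the excess `(u - w)₊` varies by a fixed amount
(`kinetic_min_add_interaction_le`). With `τ = c₁ / p` this first-order term is exactly what the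
linear part of the growth condition on `W` pays for.

Two gains survive: the interaction, at distances at least `1`, between a high and a low superlevel
of the excess, and, from the term `(t - r)^k` of the growth condition, the measure of the layer
between them. As the kernel cut at distance `1` is integrable, the layer also controls its own
interaction, so together they bound the nonlocal perimeter of a set `S` containing `{u > θs} ∩
B_{R-K}`. The growth condition fails to help only where `u > -1 + q`, hence inside `{u > θs}`; the
error there is at most `C (1 + w)^(m-1)`, which decays like `(1 + R - |x|)^(-σ)`. This is
`exists_energy_estimate`: perimeter of `S` at most `ε + C` times a weighted measure of `{u > θs} ∩
B_R`.

The perimeter is bounded below by an isoperimetric inequality (`exists_isoperimetric`), of size `(v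
/ 2^N) ∑_{j ≤ N} 2^(j(1-σ))` for volume `v` at scale `2^N`. Keeping the dyadic sum unevaluated
treats `σ < 1`, `σ = 1` and `σ > 1` together. Summing the energy estimate over `2^(N+i₀)`
consecutive integer-spaced radii turns the weight into a dyadic sum at scale `N + i₀`. That sum
exceeds the one at scale `N` by a factor of at most `(i₀+1) Q^(i₀)` with `Q < 2`, while the number
of radii gains `2^(i₀)`. A large `i₀` therefore forces the measure of `{u > θs}` to multiply by
`2^n` each time the scale doubles (`exists_growth_step`); iterating gives `r^n` growth
(`exists_density_estimate`).

Only `i₀` depends on `Λ`; the smallness of `ε` does not. Finally `{u > θs}` is split at `θ₂`, and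
the lower part is estimated by Chebyshev's inequality. -/

/-- The odd extension of `t ↦ t ^ r` to the real line. -/
def spow (r t : ℝ) : ℝ := (max t 0) ^ r - (max (-t) 0) ^ r

lemma spow_of_nonneg {r t : ℝ} (hr : 0 < r) (ht : 0 ≤ t) : spow r t = t ^ r := by
  simp [spow, ht, Real.zero_rpow hr.ne']

lemma spow_neg (r t : ℝ) : spow r (-t) = -spow r t := by
  simp [spow]

lemma spow_of_nonpos {r t : ℝ} (hr : 0 < r) (ht : t ≤ 0) : spow r t = -(-t) ^ r := by
  rw [← spow_of_nonneg hr (neg_nonneg.2 ht), spow_neg, neg_neg]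

lemma spow_mono {r : ℝ} (hr : 0 < r) : Monotone (spow r) := by
  intro a b hab
  have h1 : (max a 0) ^ r ≤ (max b 0) ^ r :=
    Real.rpow_le_rpow (le_max_right _ _) (max_le_max_right _ hab) hr.le
  have h2 : (max (-b) 0) ^ r ≤ (max (-a) 0) ^ r :=
    Real.rpow_le_rpow (le_max_right _ _) (max_le_max_right _ (neg_le_neg hab)) hr.le
  unfold spow
  linarith

lemma continuous_spow {r : ℝ} (hr : 0 < r) : Continuous (spow r) := by
  unfold spow
  exact ((continuous_id.max continuous_const).rpow_const fun _ => Or.inr hr.le).sub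
    ((continuous_neg.max continuous_const).rpow_const fun _ => Or.inr hr.le)

lemma abs_spow {r : ℝ} (hr : 0 < r) (t : ℝ) : |spow r t| = |t| ^ r := by
  rcases le_total 0 t with h | h
  · rw [spow_of_nonneg hr h, abs_of_nonneg h, abs_of_nonneg (Real.rpow_nonneg h _)]
  · rw [spow_of_nonpos hr h, abs_neg, abs_of_nonpos h,
      abs_of_nonneg (Real.rpow_nonneg (neg_nonneg.2 h) _)]

lemma spow_mul {r : ℝ} (hr : 0 < r) (a b : ℝ) : spow r (a * b) = spow r a * spow r b := by
  have key : ∀ a b : ℝ, 0 ≤ a → 0 ≤ b → spow r (a * b) = spow r a * spow r b := by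
    intro a b ha hb
    rw [spow_of_nonneg hr ha, spow_of_nonneg hr hb, spow_of_nonneg hr (mul_nonneg ha hb),
      Real.mul_rpow ha hb]
  rcases le_total 0 a with ha | ha <;> rcases le_total 0 b with hb | hb
  · exact key a b ha hb
  · have := key a (-b) ha (neg_nonneg.2 hb)
    rw [mul_neg, spow_neg, spow_neg] at this
    linarith
  · have := key (-a) b (neg_nonneg.2 ha) hb
    rw [neg_mul, spow_neg, spow_neg] at this
    linarith
  · have := key (-a) (-b) (neg_nonneg.2 ha) (neg_nonneg.2 hb)
    rw [neg_mul_neg, spow_neg, spow_neg] at this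
    linarith

lemma spow_strictMono {r : ℝ} (hr : 0 < r) : StrictMono (spow r) := by
  refine (spow_mono hr).strictMono_of_injective fun a b hab => ?_
  have h1 : |a| = |b| := by
    have := congrArg abs hab
    rw [abs_spow hr, abs_spow hr] at this
    exact (Real.rpow_left_inj (abs_nonneg _) (abs_nonneg _) hr.ne').1 this
  rcases le_total 0 a with ha | ha <;> rcases le_total 0 b with hb | hb
  · rwa [abs_of_nonneg ha, abs_of_nonneg hb] at h1
  · rw [spow_of_nonneg hr ha, spow_of_nonpos hr hb] at hab
    have h2 : a ^ r = 0 := le_antisymm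
      (hab.trans_le (neg_nonpos.2 (Real.rpow_nonneg (neg_nonneg.2 hb) _))) (Real.rpow_nonneg ha _)
    have h3 := (Real.rpow_eq_zero ha hr.ne').1 h2
    rw [h3, abs_zero] at h1
    rw [h3, abs_eq_zero.1 h1.symm]
  · rw [spow_of_nonneg hr hb, spow_of_nonpos hr ha] at hab
    have h2 : b ^ r = 0 := le_antisymm
      (hab.symm.trans_le (neg_nonpos.2 (Real.rpow_nonneg (neg_nonneg.2 ha) _)))
      (Real.rpow_nonneg hb _)
    have h3 := (Real.rpow_eq_zero hb hr.ne').1 h2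
    rw [h3, abs_zero] at h1
    rw [h3, abs_eq_zero.1 h1]
  · rw [abs_of_nonpos ha, abs_of_nonpos hb] at h1
    linarith

/-! ### Strict convexity of `|t| ^ p`. -/

/-- The form `|x|^(p-2) x` hides continuity and monotonicity when `p < 2`; in terms of `spow` the
derivative is visibly continuous and strictly increasing, for every `p > 1`. -/
lemma hasDerivAt_abs_rpow_spow {p : ℝ} (hp : 1 < p) (x : ℝ) :
    HasDerivAt (fun t : ℝ => |t| ^ p) (p * spow (p - 1) x) x := by
  have h := hasDerivAt_abs_rpow x hp
  convert h using 1
  have hr : 0 < p - 1 := by linarith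
  rcases lt_trichotomy x 0 with hx | hx | hx
  · rw [spow_of_nonpos hr hx.le, abs_of_neg hx, mul_assoc,
      show p - 1 = (p - 2) + 1 by ring, Real.rpow_add (neg_pos.2 hx), Real.rpow_one]
    ring
  · subst hx
    rw [spow_of_nonneg hr le_rfl, Real.zero_rpow hr.ne']
    ring
  · rw [spow_of_nonneg hr hx.le, abs_of_pos hx, mul_assoc,
      show p - 1 = (p - 2) + 1 by ring, Real.rpow_add hx, Real.rpow_one]

lemma strictConvexOn_abs_rpow {p : ℝ} (hp : 1 < p) :
    StrictConvexOn ℝ univ fun t : ℝ => |t| ^ p := by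
  refine StrictMono.strictConvexOn_univ_of_deriv
    (continuous_abs.rpow_const fun _ => Or.inr (by linarith)) ?_
  have : deriv (fun t : ℝ => |t| ^ p) = fun x => p * spow (p - 1) x :=
    funext fun x => (hasDerivAt_abs_rpow_spow hp x).deriv
  rw [this]
  exact (spow_strictMono (by linarith)).const_mul (by linarith)

lemma abs_rpow_tangent_lt {p : ℝ} (hp : 1 < p) {a b : ℝ} (hab : a ≠ b) :
    |b| ^ p + p * spow (p - 1) b * (a - b) < |a| ^ p := by
  have hd := hasDerivAt_abs_rpow_spow hp b
  rcases lt_or_gt_of_ne hab with h | h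
  · have := (strictConvexOn_abs_rpow hp).slope_lt_of_hasDerivAt (mem_univ a) (mem_univ b) h hd
    rw [slope_def_field, div_lt_iff₀ (by linarith)] at this
    linarith
  · have := (strictConvexOn_abs_rpow hp).lt_slope_of_hasDerivAt (mem_univ b) (mem_univ a) h hd
    rw [slope_def_field, lt_div_iff₀ (by linarith)] at this
    linarith

lemma abs_rpow_tangent_le {p : ℝ} (hp : 1 < p) (a b : ℝ) :
    |b| ^ p + p * spow (p - 1) b * (a - b) ≤ |a| ^ p := by
  rcases eq_or_ne a b with h | h
  · simp [h]
  · exact (abs_rpow_tangent_lt hp h).le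

/-- Quantitative strict convexity of `|·| ^ p` on bounded sets. -/
lemma exists_convexity_gap {p β : ℝ} (hp : 1 < p) (hβ : 0 < β) :
    ∃ c : ℝ, 0 < c ∧ ∀ a b : ℝ, |a| ≤ 2 → |b| ≤ 2 → β ≤ |a - b| →
      |b| ^ p + p * spow (p - 1) b * (a - b) + c ≤ |a| ^ p := by
  -- The tangent-line gap is continuous and positive off the diagonal, so its minimum over the
  -- compact set `K` is the required constant; if `K` is empty any constant serves.
  set f : ℝ × ℝ → ℝ := fun z => |z.1| ^ p - (|z.2| ^ p + p * spow (p - 1) z.2 * (z.1 - z.2))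
  set K : Set (ℝ × ℝ) := (Icc (-2) 2 ×ˢ Icc (-2) 2) ∩ {z | β ≤ |z.1 - z.2|}
  have hr : 0 < p - 1 := by linarith
  have hf : Continuous f := by
    have h1 : Continuous fun t : ℝ => |t| ^ p :=
      continuous_abs.rpow_const fun _ => Or.inr (by linarith)
    have h2 := continuous_spow hr
    exact (h1.comp continuous_fst).sub ((h1.comp continuous_snd).add
      ((continuous_const.mul (h2.comp continuous_snd)).mul (continuous_fst.sub continuous_snd)))
  have hK : IsCompact K := by
    refine (isCompact_Icc.prod isCompact_Icc).inter_right ?_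
    exact isClosed_le continuous_const (by fun_prop)
  rcases K.eq_empty_or_nonempty with h | h
  · refine ⟨1, one_pos, fun a b ha hb hab => ?_⟩
    have : (a, b) ∈ K := ⟨⟨abs_le.1 ha, abs_le.1 hb⟩, hab⟩
    rw [h] at this
    exact this.elim
  · obtain ⟨z, hz, hmin⟩ := hK.exists_isMinOn h hf.continuousOn
    refine ⟨f z, ?_, fun a b ha hb hab => ?_⟩
    · have hne : z.1 ≠ z.2 := by
        intro h
        have := hz.2
        simp only [mem_ofPred_eq, h, sub_self, abs_zero] at this
        linarith
      have := abs_rpow_tangent_lt hp hne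
      simp only [f]
      linarith
    · have : f z ≤ f (a, b) := hmin (show (a, b) ∈ K from ⟨⟨abs_le.1 ha, abs_le.1 hb⟩, hab⟩)
      have h2 : f (a, b) = |a| ^ p - (|b| ^ p + p * spow (p - 1) b * (a - b)) := rfl
      linarith

/-! ### Increments of the odd power -/

lemma abs_spow_one_add_sub_one_le_of_le_one {r : ℝ} (hr : 0 < r) (hr1 : r ≤ 1) (t : ℝ) :
    |spow r (1 + t) - 1| ≤ 2 * |t| := by
  rcases le_or_gt 0 (1 + t) with h | h
  · rw [spow_of_nonneg hr h]
    have h1 : (1 + t) ^ r ≤ 1 + r * t := rpow_one_add_le_one_add_mul_self (by linarith) hr.le hr1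
    rcases le_total 0 t with ht | ht
    · have h2 : 1 ≤ (1 + t) ^ r := Real.one_le_rpow (by linarith) hr.le
      rw [abs_of_nonneg (by linarith), abs_of_nonneg ht]
      nlinarith
    · have h2 : 1 + t ≤ (1 + t) ^ r := by
        rcases eq_or_lt_of_le h with h0 | h0
        · rw [← h0, Real.zero_rpow hr.ne']
        · simpa using Real.rpow_le_rpow_of_exponent_ge h0 (by linarith) hr1
      have h3 : (1 + t) ^ r ≤ 1 := Real.rpow_le_one h (by linarith) hr.le
      rw [abs_of_nonpos (by linarith), abs_of_nonpos ht]
      linarith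
  · rw [spow_of_nonpos hr h.le]
    have h2 : (-(1 + t)) ^ r ≤ 1 + |t| := by
      rw [abs_of_nonpos (by linarith)]
      have : (-(1 + t)) ^ r ≤ (1 + -t) ^ r :=
        Real.rpow_le_rpow (by linarith) (by linarith) hr.le
      have h3 : (1 + -t) ^ r ≤ (1 + -t) ^ (1 : ℝ) :=
        Real.rpow_le_rpow_of_exponent_le (by linarith) hr1
      rw [Real.rpow_one] at h3
      linarith
    have h3 : 0 ≤ (-(1 + t)) ^ r := Real.rpow_nonneg (by linarith) _
    have h4 : (-(1 + t)) ^ r ≤ -t := by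
      rcases le_total (-(1 + t)) 1 with h5 | h5
      · have := Real.rpow_le_one (by linarith : 0 ≤ -(1 + t)) h5 hr.le
        linarith
      · have := Real.rpow_le_rpow_of_exponent_le h5 hr1
        rw [Real.rpow_one] at this
        linarith
    have h6 : |t| = -t := abs_of_nonpos (by linarith)
    rw [abs_le, h6]
    constructor <;> linarith

/-- Bernoulli's inequality at `(1 + t)⁻¹ = 1 - t / (1 + t)`, multiplied by `(1 + t)^r`. -/
lemma rpow_one_add_sub_one_le {r t : ℝ} (hr : 1 ≤ r) (ht : 0 ≤ t) :
    (1 + t) ^ r - 1 ≤ r * t * (1 + t) ^ (r - 1) := by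
  have h1 : (0 : ℝ) < 1 + t := by linarith
  have h2 := one_add_mul_self_le_rpow_one_add (s := -(t / (1 + t))) (by
    rw [neg_le_neg_iff, div_le_one h1]; linarith) hr
  have h3 : 1 + -(t / (1 + t)) = (1 + t)⁻¹ := by field_simp; ring
  rw [h3, Real.inv_rpow h1.le] at h2
  have h4 : 0 < (1 + t) ^ r := Real.rpow_pos_of_pos h1 _
  have h5 : (1 + t) ^ r = (1 + t) ^ (r - 1) * (1 + t) := by
    rw [← Real.rpow_add_one h1.ne']; ring_nf
  have h6 := mul_le_mul_of_nonneg_left h2 h4.le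
  rw [mul_inv_cancel₀ h4.ne'] at h6
  have h7 : (1 + t) ^ r * (1 + r * -(t / (1 + t))) = (1 + t) ^ r - r * t * (1 + t) ^ (r - 1) := by
    rw [h5]; field_simp; ring
  linarith

lemma abs_spow_one_add_sub_one_le_of_one_le {r : ℝ} (hr1 : 1 ≤ r) (t : ℝ) :
    |spow r (1 + t) - 1| ≤ (r + 2) * |t| * (1 + |t|) ^ (r - 1) := by
  have hr : 0 < r := by linarith
  have hp1 : 1 ≤ (1 + |t|) ^ (r - 1) :=
    Real.one_le_rpow (by linarith [abs_nonneg t]) (by linarith)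
  have h0 := abs_nonneg t
  rcases le_total 0 t with ht | ht
  · rw [spow_of_nonneg hr (by linarith)]
    have h2 : 1 ≤ (1 + t) ^ r := Real.one_le_rpow (by linarith) hr.le
    have h3 := rpow_one_add_sub_one_le hr1 ht
    rw [abs_of_nonneg ht] at hp1 ⊢
    rw [abs_of_nonneg (by linarith)]
    nlinarith [mul_nonneg ht (by linarith : 0 ≤ (1 + t) ^ (r - 1))]
  · rw [abs_of_nonpos ht] at hp1 h0 ⊢
    have hB : -t ≤ -t * (1 + -t) ^ (r - 1) := le_mul_of_one_le_right h0 hp1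
    rcases le_or_gt 0 (1 + t) with h | h
    · rw [spow_of_nonneg hr h]
      have h1 := one_add_mul_self_le_rpow_one_add (s := t) (by linarith) hr1
      have h3 : (1 + t) ^ r ≤ 1 := Real.rpow_le_one h (by linarith) hr.le
      rw [abs_of_nonpos (by linarith)]
      nlinarith
    · rw [spow_of_nonpos hr h.le]
      have h3 : 0 ≤ (-(1 + t)) ^ r := Real.rpow_nonneg (by linarith) _
      have h4 : (-(1 + t)) ^ r ≤ (-t) * (1 + -t) ^ (r - 1) := by
        have h5 : (-(1 + t)) ^ r ≤ (-t) ^ r :=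
          Real.rpow_le_rpow (by linarith) (by linarith) hr.le
        have h6 : (-t) ^ r = (-t) * (-t) ^ (r - 1) := by
          rw [mul_comm, ← Real.rpow_add_one (by linarith)]; ring_nf
        have h7 : (-t) ^ (r - 1) ≤ (1 + -t) ^ (r - 1) :=
          Real.rpow_le_rpow h0 (by linarith) (by linarith)
        rw [h6] at h5
        exact h5.trans (mul_le_mul_of_nonneg_left h7 h0)
      rw [abs_le]
      constructor <;> nlinarith

/-- Increment of the odd power of order `p - 1` along a perturbation which is quadratically small
with respect to the size `t` of the point. -/
lemma exists_abs_spow_add_sub_le {p : ℝ} (hp : 1 < p) {C : ℝ} (hC : 0 ≤ C) :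
    ∃ C' : ℝ, 0 ≤ C' ∧ ∀ x e t : ℝ, x ≠ 0 → |x| ≤ t → t ≤ 1 → 0 ≤ e → e ≤ C * t ^ 2 →
      |spow (p - 1) (x + e) - spow (p - 1) x| ≤
        C' * (t ^ (p - min (p - 2) 0) * |x| ^ min (p - 2) 0) := by
  have hr : 0 < p - 1 := by linarith
  -- Homogeneity moves the base point to `1`. For `p ≤ 2` the increment is then controlled by
  -- `|x|^(p-2) e`, for `p ≥ 2` by `(|x| + e)^(p-2) e`; the exponent `min (p - 2) 0` records both
  -- cases.
  have main : ∀ x e : ℝ, x ≠ 0 → |spow (p - 1) (x + e) - spow (p - 1) x| =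
      |x| ^ (p - 1) * |spow (p - 1) (1 + e / x) - 1| := by
    intro x e hx
    have : x + e = x * (1 + e / x) := by field_simp
    rw [this, spow_mul hr, ← mul_sub_one, abs_mul, abs_spow hr]
  rcases le_total p 2 with hp2 | hp2
  · refine ⟨2 * C, by positivity, fun x e t hx hxt ht he heC => ?_⟩
    have hx0 : 0 < |x| := abs_pos.2 hx
    rw [main x e hx, min_eq_left (by linarith), show p - (p - 2) = 2 by ring]
    have h1 := abs_spow_one_add_sub_one_le_of_le_one hr (by linarith) (e / x)
    rw [abs_div, abs_of_nonneg he] at h1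
    have h2 : |x| ^ (p - 1) = |x| ^ (p - 2) * |x| := by
      rw [← Real.rpow_add_one hx0.ne']; ring_nf
    have h3 : 0 < |x| ^ (p - 2) := Real.rpow_pos_of_pos hx0 _
    calc |x| ^ (p - 1) * |spow (p - 1) (1 + e / x) - 1|
        ≤ |x| ^ (p - 1) * (2 * (e / |x|)) :=
          mul_le_mul_of_nonneg_left h1 (Real.rpow_nonneg hx0.le _)
      _ = 2 * |x| ^ (p - 2) * e := by rw [h2]; field_simp
      _ ≤ 2 * |x| ^ (p - 2) * (C * t ^ 2) := by gcongr
      _ = _ := by rw [← Real.rpow_natCast t 2]; push_cast; ring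
  · refine ⟨(p + 1) * C * (1 + C) ^ (p - 2), by positivity, fun x e t hx hxt ht he heC => ?_⟩
    have hx0 : 0 < |x| := abs_pos.2 hx
    have ht0 : 0 < t := hx0.trans_le hxt
    rw [main x e hx, min_eq_right (by linarith), sub_zero, Real.rpow_zero, mul_one]
    have h1 := abs_spow_one_add_sub_one_le_of_one_le (r := p - 1) (by linarith) (e / x)
    rw [abs_div, abs_of_nonneg he] at h1
    have h2 : |x| ^ (p - 1) = |x| ^ (p - 2) * |x| := by
      rw [← Real.rpow_add_one hx0.ne']; ring_nf
    have h4 : |x| ^ (p - 2) * (1 + e / |x|) ^ (p - 2) = (|x| + e) ^ (p - 2) := by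
      rw [← Real.mul_rpow hx0.le (by positivity)]
      congr 1
      field_simp
    have h5 : |x| + e ≤ (1 + C) * t := by nlinarith
    calc |x| ^ (p - 1) * |spow (p - 1) (1 + e / x) - 1|
        ≤ |x| ^ (p - 1) * ((p - 1 + 2) * (e / |x|) * (1 + e / |x|) ^ (p - 1 - 1)) :=
          mul_le_mul_of_nonneg_left h1 (Real.rpow_nonneg hx0.le _)
      _ = (p + 1) * e * (|x| ^ (p - 2) * (1 + e / |x|) ^ (p - 2)) := by
          rw [h2, show p - 1 - 1 = p - 2 by ring]; field_simp; ring_nf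
      _ = (p + 1) * e * (|x| + e) ^ (p - 2) := by rw [h4]
      _ ≤ (p + 1) * (C * t ^ 2) * ((1 + C) * t) ^ (p - 2) := by
          gcongr
      _ = _ := by
          rw [Real.mul_rpow (by linarith) ht0.le]
          have : t ^ p = t ^ 2 * t ^ (p - 2) := by
            rw [← Real.rpow_natCast t 2, ← Real.rpow_add ht0]; norm_num
          rw [this]; ring

/-! ### Elementary bounds for negative powers -/

lemma one_sub_mul_le_rpow_neg {x γ : ℝ} (hx : 0 < x) (hγ : 0 ≤ γ) :
    1 - γ * (x - 1) ≤ x ^ (-γ) := by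
  rw [Real.rpow_def_of_pos hx]
  have h1 := Real.log_le_sub_one_of_pos hx
  have h2 := Real.add_one_le_exp (Real.log x * -γ)
  nlinarith

/-- The preceding lower bound at `x⁻¹`, multiplied by `x ^ (-γ)`. -/
lemma rpow_neg_le_one_add {x γ : ℝ} (hx : 0 < x) (hγ : 0 ≤ γ) :
    x ^ (-γ) ≤ 1 + γ * x ^ (-(γ + 1)) * (1 - x) := by
  have h := one_sub_mul_le_rpow_neg (inv_pos.2 hx) hγ
  have h2 : 0 < x ^ (-γ) := Real.rpow_pos_of_pos hx _
  have h3 : x⁻¹ ^ (-γ) * x ^ (-γ) = 1 := by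
    rw [← Real.mul_rpow (inv_pos.2 hx).le hx.le, inv_mul_cancel₀ hx.ne', Real.one_rpow]
  have h4 : x ^ (-(γ + 1)) = x ^ (-γ) * x⁻¹ := by
    rw [neg_add, Real.rpow_add hx, Real.rpow_neg_one]
  have h5 := mul_le_mul_of_nonneg_right h h2.le
  rw [h3] at h5
  have h6 : (1 - γ * (x⁻¹ - 1)) * x ^ (-γ) =
      x ^ (-γ) - γ * x ^ (-(γ + 1)) * (1 - x) := by
    rw [h4]; field_simp
  linarith

/-- A one-sided second-order Taylor bound, used to expand the barrier from above. The first-order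
bound carries a factor `(1 - q)^(-(β+1))`; replacing it by `1` costs `O(q²)`, by a further
first-order bound chosen according to the sign of `q`. -/
lemma exists_one_sub_rpow_neg_le {β : ℝ} (hβ : 0 ≤ β) :
    ∃ C : ℝ, 0 ≤ C ∧ ∀ q : ℝ, |q| ≤ 1 / 2 → (1 - q) ^ (-β) ≤ 1 + β * q + C * q ^ 2 := by
  refine ⟨β * ((β + 1) * 2 ^ (β + 2)), by positivity, fun q hq => ?_⟩
  obtain ⟨hq1, hq2⟩ := abs_le.1 hq
  have hx : 0 < 1 - q := by linarith
  have h1 := rpow_neg_le_one_add hx hβ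
  have h2 : q * ((1 - q) ^ (-(β + 1)) - 1) ≤ (β + 1) * 2 ^ (β + 2) * q ^ 2 := by
    rcases le_total 0 q with h | h
    · have h3 := rpow_neg_le_one_add hx (by linarith : 0 ≤ β + 1)
      have h4 : (1 - q) ^ (-(β + 1 + 1)) ≤ 2 ^ (β + 2) := by
        have : (1 - q) ^ (-(β + 1 + 1)) ≤ (1 / 2 : ℝ) ^ (-(β + 1 + 1)) :=
          Real.rpow_le_rpow_of_nonpos (by norm_num) (by linarith) (by linarith)
        refine this.trans_eq ?_
        rw [one_div, Real.inv_rpow (by norm_num), Real.rpow_neg (by norm_num), inv_inv]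
        ring_nf
      have h5 : (1 - q) ^ (-(β + 1)) - 1 ≤ (β + 1) * 2 ^ (β + 2) * q := by
        have : (β + 1) * (1 - q) ^ (-(β + 1 + 1)) * (1 - (1 - q)) ≤
            (β + 1) * 2 ^ (β + 2) * q := by
          rw [sub_sub_cancel]
          gcongr
        linarith
      nlinarith
    · have h3 := one_sub_mul_le_rpow_neg hx (by linarith : 0 ≤ β + 1)
      have h4 : (1 : ℝ) ≤ 2 ^ (β + 2) := Real.one_le_rpow (by norm_num) (by linarith)
      have h5 : q * ((1 - q) ^ (-(β + 1)) - 1) ≤ (β + 1) * q ^ 2 := by nlinarith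
      have h6 : (β + 1) * q ^ 2 * 1 ≤ (β + 1) * q ^ 2 * 2 ^ (β + 2) :=
        mul_le_mul_of_nonneg_left h4 (by positivity)
      linarith
  nlinarith [mul_le_mul_of_nonneg_left h2 hβ]

/-! ### Integrals of homogeneous functions -/

/-- The Euclidean space of dimension `n`. -/
abbrev Eu (n : ℕ) := EuclideanSpace ℝ (Fin n)

variable {n : ℕ}

lemma lintegral_comp_smul_eu (f : Eu n → ℝ≥0∞) {r : ℝ} (hr : 0 < r) :
    ∫⁻ x, f (r • x) = ENNReal.ofReal (r ^ (-(n : ℝ))) * ∫⁻ x, f x := by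
  have h := lintegral_map_equiv (μ := (volume : Measure (Eu n))) f
    (Homeomorph.smulOfNeZero r hr.ne').toMeasurableEquiv
  have h2 : Measure.map (⇑(Homeomorph.smulOfNeZero r hr.ne').toMeasurableEquiv)
      (volume : Measure (Eu n)) = ENNReal.ofReal (r ^ (-(n : ℝ))) • volume := by
    have := Measure.map_addHaar_smul (volume : Measure (Eu n)) hr.ne'
    rw [finrank_euclideanSpace_fin, abs_of_pos (by positivity)] at this
    rw [Real.rpow_neg hr.le, Real.rpow_natCast]
    exact this
  rw [h2, lintegral_smul_measure] at h
  exact h.symm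

/-- Scaling of the integral of a function against the kernel `|h| ^ (-(n + σ))`. -/
lemma lintegral_scale_kernel (f : Eu n → ℝ≥0∞) (σ : ℝ) {r : ℝ} (hr : 0 < r) :
    ∫⁻ h, f h * ENNReal.ofReal (‖h‖ ^ (-(n + σ))) =
      ENNReal.ofReal (r ^ (-σ)) * ∫⁻ k, f (r • k) * ENNReal.ofReal (‖k‖ ^ (-(n + σ))) := by
  have h1 := lintegral_comp_smul_eu (fun h : Eu n => f h * ENNReal.ofReal (‖h‖ ^ (-(n + σ)))) hr
  have h2 : ∀ k : Eu n, f (r • k) * ENNReal.ofReal (‖r • k‖ ^ (-(n + σ))) =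
      ENNReal.ofReal (r ^ (-(n + σ))) * (f (r • k) * ENNReal.ofReal (‖k‖ ^ (-(n + σ)))) := by
    intro k
    rw [norm_smul, Real.norm_of_nonneg hr.le, Real.mul_rpow hr.le (norm_nonneg _),
      ENNReal.ofReal_mul (by positivity)]
    ring
  simp_rw [h2] at h1
  rw [lintegral_const_mul' _ _ ENNReal.ofReal_ne_top] at h1
  have h3 : ENNReal.ofReal (r ^ (n : ℝ)) * ENNReal.ofReal (r ^ (-(n : ℝ))) = 1 := by
    rw [← ENNReal.ofReal_mul (by positivity), ← Real.rpow_add hr]; simp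
  have h4 : ENNReal.ofReal (r ^ (n : ℝ)) * ENNReal.ofReal (r ^ (-(n + σ))) =
      ENNReal.ofReal (r ^ (-σ)) := by
    rw [← ENNReal.ofReal_mul (by positivity), ← Real.rpow_add hr]; congr 2; ring
  calc _ = ENNReal.ofReal (r ^ (n : ℝ)) * (ENNReal.ofReal (r ^ (-(n : ℝ))) *
        ∫⁻ h, f h * ENNReal.ofReal (‖h‖ ^ (-(n + σ)))) := by rw [← mul_assoc, h3, one_mul]
    _ = _ := by rw [← h1, ← mul_assoc, h4]

lemma integrable_indicator_abs_rpow {α : ℝ} (hα : -1 < α) :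
    Integrable ((Icc (-1) 1).indicator fun t : ℝ => |t| ^ α) := by
  rw [integrable_indicator_iff measurableSet_Icc, ← Icc_union_Icc_eq_Icc (b := (0 : ℝ))
    (by norm_num) (by norm_num)]
  have h1 : IntegrableOn (fun t : ℝ => |t| ^ α) (Icc 0 1) := by
    have := (intervalIntegral.intervalIntegrable_rpow' (a := 0) (b := 1) hα)
    rw [intervalIntegrable_iff_integrableOn_Icc_of_le (by norm_num)] at this
    refine this.congr_fun (fun t ht => ?_) measurableSet_Icc
    simp only [abs_of_nonneg ht.1]
  refine IntegrableOn.union ?_ h1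
  have h2 := (intervalIntegrable_iff_integrableOn_Icc_of_le (μ := volume)
    (zero_le_one (α := ℝ))).2 h1
  have h3 := (IntervalIntegrable.iff_comp_neg (f := fun t : ℝ => |t| ^ α) (a := 0) (b := 1)).1 h2
  simp only [abs_neg, neg_zero] at h3
  exact (intervalIntegrable_iff_integrableOn_Icc_of_le (by norm_num)).1 h3.symm

/-- The unit ball lies in the cube `[-1,1]^n`, on which the integrand is a product of integrable
functions of one variable. -/
lemma lintegral_coord_rpow_lt_top {α : ℝ} (hα : -1 < α) (i₀ : Fin n) :
    ∫⁻ k in Metric.closedBall (0 : Eu n) 1, ENNReal.ofReal (|k i₀| ^ α) < ∞ := by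
  classical
  set f : Fin n → ℝ → ℝ := fun i => (Icc (-1) 1).indicator fun t : ℝ =>
    |t| ^ (if i = i₀ then α else 0) with hf
  have hint : Integrable fun x : Fin n → ℝ => ∏ i, f i (x i) := by
    refine Integrable.fintype_prod (f := f) fun i => integrable_indicator_abs_rpow ?_
    split_ifs <;> linarith
  have hint2 : Integrable fun x : Eu n => ∏ i, f i (x i) :=
    (PiLp.volume_preserving_ofLp (Fin n)).integrable_comp_of_integrable hint
  refine lt_of_le_of_lt ?_ hint2.lintegral_lt_top
  rw [← lintegral_indicator Metric.isClosed_closedBall.measurableSet]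
  refine lintegral_mono fun k => ?_
  by_cases hk : k ∈ Metric.closedBall (0 : Eu n) 1
  · rw [indicator_of_mem hk]
    refine ENNReal.ofReal_le_ofReal (le_of_eq ?_)
    have hmem : ∀ i, k i ∈ Icc (-1 : ℝ) 1 := fun i =>
      abs_le.1 ((PiLp.norm_apply_le k i).trans (mem_closedBall_zero_iff.1 hk))
    simp only [hf, indicator_of_mem (hmem _)]
    rw [Finset.prod_eq_single i₀]
    · simp
    · intro i _ hi
      simp [hi]
    · simp
  · rw [indicator_of_notMem hk]
    exact zero_le

/-- The reflection in the hyperplane orthogonal to `e₀ - e` sends the first basis vector to `e` and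
preserves both the ball and the measure. Hence the later bounds are uniform in the direction. -/
lemma lintegral_inner_rpow_eq {α : ℝ} (hn : 0 < n) {e : Eu n} (he : ‖e‖ = 1) :
    ∫⁻ k in Metric.closedBall (0 : Eu n) 1, ENNReal.ofReal (|inner ℝ e k| ^ α) =
      ∫⁻ k in Metric.closedBall (0 : Eu n) 1, ENNReal.ofReal (|k ⟨0, hn⟩| ^ α) := by
  set e₀ : Eu n := EuclideanSpace.single ⟨0, hn⟩ 1
  have he₀ : ‖e₀‖ = 1 := by simp [e₀]
  set T := Submodule.reflection (Submodule.span ℝ {e₀ - e})ᗮ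
  have hT : T e₀ = e := Submodule.reflection_sub (he₀.trans he.symm)
  have hT' := MeasurePreserving.lintegral_map_equiv
    ((Metric.closedBall (0 : Eu n) 1).indicator fun k => ENNReal.ofReal (|inner ℝ e k| ^ α))
    T.toMeasurableEquiv T.measurePreserving
  rw [← lintegral_indicator Metric.isClosed_closedBall.measurableSet,
    ← lintegral_indicator Metric.isClosed_closedBall.measurableSet, hT']
  refine lintegral_congr fun k => ?_
  have h1 : inner ℝ e (T k) = k ⟨0, hn⟩ := by
    rw [← hT, T.inner_map_map]
    simp [e₀, EuclideanSpace.inner_single_left]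
  simp only [LinearIsometryEquiv.coe_toMeasurableEquiv, indicator, mem_closedBall_zero_iff,
    T.norm_map, h1]

/-- Integrability of homogeneous functions near the origin, by decomposition into dyadic shells. -/
lemma exists_lintegral_ball_le_shell {d : ℝ} (hd : -(n : ℝ) < d) (hn : 0 < n) :
    ∃ C : ℝ≥0∞, C ≠ ∞ ∧ ∀ f : Eu n → ℝ≥0∞,
      (∀ k : Eu n, ∀ r : ℝ, 0 < r → f (r • k) = ENNReal.ofReal (r ^ d) * f k) →
      ∫⁻ k in Metric.ball (0 : Eu n) 1, f k ≤
      C * ∫⁻ k in {k : Eu n | 1 / 2 < ‖k‖ ∧ ‖k‖ ≤ 1}, f k := by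
  set Sh : Set (Eu n) := {k : Eu n | 1 / 2 < ‖k‖ ∧ ‖k‖ ≤ 1}
  have h0 : MeasurableSet Sh := (measurableSet_lt measurable_const measurable_norm).inter
    (measurableSet_le measurable_norm measurable_const)
  set A : ℕ → Set (Eu n) := fun j => (fun k => (2 : ℝ) ^ j • k) ⁻¹' Sh
  -- Halving the scale multiplies the integral over a shell by `q`; the series is geometric because
  -- `d > -n`.
  set q : ℝ := 2 ^ (-(d + n))
  have hq0 : 0 < q := by positivity
  have hq1 : q < 1 := Real.rpow_lt_one_of_one_lt_of_neg (by norm_num) (by linarith)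
  refine ⟨∑' j : ℕ, ENNReal.ofReal (q ^ j), ?_, ?_⟩
  · rw [← ENNReal.ofReal_tsum_of_nonneg (fun j => by positivity)
      (summable_geometric_of_lt_one hq0.le hq1)]
    exact ENNReal.ofReal_ne_top
  intro f hf
  have hA : ∀ j, MeasurableSet (A j) := fun j => measurableSet_preimage (by fun_prop) h0
  have hshell : ∀ j, ∫⁻ k in A j, f k =
      ENNReal.ofReal (q ^ j) * ∫⁻ k in Sh, f k := by
    intro j
    have h2 : (0 : ℝ) < 2 ^ j := by positivity
    have h3 := lintegral_comp_smul_eu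
      (Sh.indicator f) h2
    have h4 : ∀ k : Eu n, Sh.indicator f ((2 : ℝ) ^ j • k) =
        ENNReal.ofReal (((2 : ℝ) ^ j) ^ d) * (A j).indicator f k := by
      intro k
      by_cases hk : k ∈ A j
      · have hk' : (2 : ℝ) ^ j • k ∈ Sh := hk
        rw [indicator_of_mem hk, indicator_of_mem hk', hf _ _ h2]
      · have hk' : (2 : ℝ) ^ j • k ∉ Sh := hk
        rw [indicator_of_notMem hk, indicator_of_notMem hk', mul_zero]
    simp_rw [h4] at h3
    rw [lintegral_const_mul' _ _ ENNReal.ofReal_ne_top, lintegral_indicator (hA j),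
      lintegral_indicator h0] at h3
    have h5 : ENNReal.ofReal (((2 : ℝ) ^ j) ^ (-d)) * ENNReal.ofReal (((2 : ℝ) ^ j) ^ d) = 1 := by
      rw [← ENNReal.ofReal_mul (by positivity), ← Real.rpow_add h2]; simp
    have h6 : ENNReal.ofReal (((2 : ℝ) ^ j) ^ (-d)) * ENNReal.ofReal (((2 : ℝ) ^ j) ^ (-(n : ℝ))) =
        ENNReal.ofReal (q ^ j) := by
      rw [← ENNReal.ofReal_mul (by positivity), ← Real.rpow_add h2, ← Real.rpow_natCast,
        ← Real.rpow_natCast, ← Real.rpow_mul (by norm_num), ← Real.rpow_mul (by norm_num)]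
      congr 2; ring
    calc _ = ENNReal.ofReal (((2 : ℝ) ^ j) ^ (-d)) * (ENNReal.ofReal (((2 : ℝ) ^ j) ^ d) *
          ∫⁻ k in A j, f k) := by rw [← mul_assoc, h5, one_mul]
      _ = _ := by rw [h3, ← mul_assoc, h6]
  have hsub : Metric.ball (0 : Eu n) 1 ⊆ {0} ∪ ⋃ j, A j := by
    intro k hk
    rcases eq_or_ne k 0 with h0 | h0
    · exact Or.inl h0
    · right
      have hk0 : 0 < ‖k‖ := norm_pos_iff.2 h0
      have hk1 : ‖k‖ < 1 := mem_ball_zero_iff.1 hk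
      obtain ⟨j, hj1, hj2⟩ := exists_nat_pow_near_of_lt_one hk0 hk1.le
        (by norm_num : (0 : ℝ) < 1 / 2) (by norm_num)
      rw [mem_iUnion]
      have h2 : (0 : ℝ) < 2 ^ j := by positivity
      have hnorm : ‖(2 : ℝ) ^ j • k‖ = 2 ^ j * ‖k‖ := by
        rw [norm_smul, Real.norm_of_nonneg h2.le]
      have hinv : (2 : ℝ) ^ j * (1 / 2) ^ j = 1 := by
        rw [← mul_pow]; norm_num
      refine ⟨j, ?_, ?_⟩
      · rw [hnorm]
        have := mul_lt_mul_of_pos_left hj1 h2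
        rw [pow_succ, ← mul_assoc, hinv] at this
        linarith
      · rw [hnorm]
        have := mul_le_mul_of_nonneg_left hj2 h2.le
        linarith
  have hne : Nontrivial (Eu n) := by
    have : Nonempty (Fin n) := ⟨⟨0, hn⟩⟩
    infer_instance
  calc ∫⁻ k in Metric.ball (0 : Eu n) 1, f k ≤ ∫⁻ k in {0} ∪ ⋃ j, A j, f k :=
        lintegral_mono_set hsub
    _ ≤ (∫⁻ k in {0}, f k) + ∫⁻ k in ⋃ j, A j, f k := lintegral_union_le _ _ _
    _ ≤ 0 + ∑' j, ∫⁻ k in A j, f k := by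
        gcongr
        · rw [Measure.restrict_singleton]; simp
        · exact lintegral_iUnion_le _ _
    _ = _ := by
        rw [zero_add, ← ENNReal.tsum_mul_right]
        exact tsum_congr hshell

lemma rpow_le_two_rpow_abs {x : ℝ} (hx : 1 / 2 < x) (hx1 : x ≤ 1) (t : ℝ) :
    x ^ t ≤ 2 ^ |t| := by
  have hx0 : 0 < x := by linarith
  calc x ^ t ≤ x ^ (-|t|) := Real.rpow_le_rpow_of_exponent_ge hx0 hx1 (neg_abs_le t)
    _ = x⁻¹ ^ |t| := by rw [Real.rpow_neg hx0.le, Real.inv_rpow hx0.le]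
    _ ≤ 2 ^ |t| := by
        apply Real.rpow_le_rpow (inv_pos.2 hx0).le _ (abs_nonneg t)
        rw [inv_le_comm₀ hx0 (by norm_num)]
        linarith

/-- Uniform integrability near the origin of `|k| ^ b |⟨e, k⟩| ^ α`, over all unit vectors `e`. -/
lemma exists_lintegral_inner_rpow_le {α b : ℝ} (hn : 0 < n) (hα : -1 < α)
    (hb : -(n : ℝ) < b + α) :
    ∃ C : ℝ≥0∞, C ≠ ∞ ∧ ∀ e : Eu n, ‖e‖ = 1 →
      ∫⁻ k in Metric.ball (0 : Eu n) 1, ENNReal.ofReal (‖k‖ ^ b * |inner ℝ e k| ^ α) ≤ C := by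
  obtain ⟨C, hC, h⟩ := exists_lintegral_ball_le_shell hb hn
  refine ⟨C * (ENNReal.ofReal (2 ^ |b|) *
    ∫⁻ k in Metric.closedBall (0 : Eu n) 1, ENNReal.ofReal (|k ⟨0, hn⟩| ^ α)), ?_, ?_⟩
  · exact ENNReal.mul_ne_top hC (ENNReal.mul_ne_top ENNReal.ofReal_ne_top
      (lintegral_coord_rpow_lt_top hα _).ne)
  intro e he
  refine (h _ fun k r hr => ?_).trans ?_
  · rw [← ENNReal.ofReal_mul (by positivity), norm_smul, Real.norm_of_nonneg hr.le,
      inner_smul_right, abs_mul, abs_of_pos hr, Real.mul_rpow hr.le (norm_nonneg _),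
      Real.mul_rpow hr.le (abs_nonneg _), Real.rpow_add hr]
    congr 1; ring
  · rw [← lintegral_inner_rpow_eq hn he, ← lintegral_const_mul' _ _ ENNReal.ofReal_ne_top]
    gcongr C * ?_
    have hSh : MeasurableSet {k : Eu n | 1 / 2 < ‖k‖ ∧ ‖k‖ ≤ 1} :=
      (measurableSet_lt measurable_const measurable_norm).inter
        (measurableSet_le measurable_norm measurable_const)
    -- On the shell `‖k‖ ^ b` is bounded by a constant, so only the power of the linear form has to
    -- be integrated.
    calc _ ≤ ∫⁻ k in {k : Eu n | 1 / 2 < ‖k‖ ∧ ‖k‖ ≤ 1},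
          ENNReal.ofReal (2 ^ |b|) * ENNReal.ofReal (|inner ℝ e k| ^ α) := by
          refine setLIntegral_mono' hSh fun k hk => ?_
          rw [← ENNReal.ofReal_mul (by positivity)]
          gcongr
          exact rpow_le_two_rpow_abs hk.1 hk.2 b
      _ ≤ _ := lintegral_mono_set fun k hk => mem_closedBall_zero_iff.2 hk.2

lemma lintegral_ball_norm_rpow_lt_top {b : ℝ} (hn : 0 < n) (hb : -(n : ℝ) < b) :
    ∫⁻ k in Metric.ball (0 : Eu n) 1, ENNReal.ofReal (‖k‖ ^ b) < ∞ := by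
  obtain ⟨C, hC, h⟩ := exists_lintegral_inner_rpow_le (α := 0) (b := b) hn (by norm_num)
    (by linarith)
  have h1 := h (EuclideanSpace.single ⟨0, hn⟩ 1) (by simp)
  simp only [Real.rpow_zero, mul_one] at h1
  exact h1.trans_lt hC.lt_top

/-- The tails of the kernel `|h| ^ (-(n + σ))`. -/
lemma exists_lintegral_tail_le {σ : ℝ} (hσ : 0 < σ) :
    ∃ C : ℝ, 0 < C ∧ ∀ r : ℝ, 0 < r →
      ∫⁻ h in {h : Eu n | r ≤ ‖h‖}, ENNReal.ofReal (‖h‖ ^ (-(n + σ))) ≤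
        ENNReal.ofReal (C * r ^ (-σ)) := by
  have hmeas : ∀ r : ℝ, MeasurableSet {h : Eu n | r ≤ ‖h‖} := fun r =>
    measurableSet_le measurable_const measurable_norm
  have hfin : ∫⁻ h in {h : Eu n | 1 ≤ ‖h‖}, ENNReal.ofReal (‖h‖ ^ (-(n + σ))) < ∞ := by
    have hint : Integrable (fun x : Eu n => (2 : ℝ) ^ (n + σ) * (1 + ‖x‖) ^ (-(n + σ))) :=
      (integrable_one_add_norm (by rw [finrank_euclideanSpace_fin]; linarith)).const_mul _
    refine lt_of_le_of_lt ?_ hint.lintegral_lt_top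
    refine (setLIntegral_mono' (hmeas 1) fun h hh => ?_).trans (setLIntegral_le_lintegral _ _)
    have hh1 : 1 ≤ ‖h‖ := hh
    apply ENNReal.ofReal_le_ofReal
    rw [Real.rpow_neg (by positivity), Real.rpow_neg (by positivity), ← div_eq_mul_inv,
      ← Real.div_rpow (by positivity) (by positivity), ← Real.inv_rpow (by positivity)]
    apply Real.rpow_le_rpow (by positivity) _ (by positivity)
    rw [inv_eq_one_div, div_le_div_iff₀ (by linarith) (by linarith)]
    linarith
  -- Scaling reduces to `r = 1`; the added `1` only serves to make the constant positive.
  refine ⟨(∫⁻ h in {h : Eu n | 1 ≤ ‖h‖}, ENNReal.ofReal (‖h‖ ^ (-(n + σ)))).toReal + 1,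
    by positivity, fun r hr => ?_⟩
  have h1 := lintegral_scale_kernel ({h : Eu n | r ≤ ‖h‖}.indicator 1) σ hr
  have h2 : ∀ (r : ℝ) (f : Eu n → ℝ≥0∞), ∫⁻ h in {h : Eu n | r ≤ ‖h‖}, f h =
      ∫⁻ h, {h : Eu n | r ≤ ‖h‖}.indicator 1 h * f h := by
    intro r f
    rw [← lintegral_indicator (hmeas r)]
    refine lintegral_congr fun h => ?_
    by_cases hh : h ∈ {h : Eu n | r ≤ ‖h‖} <;> simp [hh]
  have h3 : ∀ k : Eu n, {h : Eu n | r ≤ ‖h‖}.indicator (1 : Eu n → ℝ≥0∞) (r • k) =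
      {h : Eu n | 1 ≤ ‖h‖}.indicator 1 k := by
    intro k
    have : r ≤ ‖r • k‖ ↔ 1 ≤ ‖k‖ := by
      rw [norm_smul, Real.norm_of_nonneg hr.le]
      exact le_mul_iff_one_le_right hr
    by_cases hk : 1 ≤ ‖k‖
    · have hk' := this.2 hk
      simp [hk, hk']
    · have hk' : ‖r • k‖ < r := not_le.1 fun h => hk (this.1 h)
      simp [hk, hk']
  rw [h2, h1]
  simp_rw [h3]
  rw [← h2, mul_comm (_ + 1 : ℝ), ENNReal.ofReal_mul (by positivity)]
  gcongr
  refine (ENNReal.ofReal_toReal hfin.ne).symm.le.trans (ENNReal.ofReal_le_ofReal (by linarith))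

/-- Near the origin the power `b (p - 1) > σ` beats the singularity of the kernel; at infinity the
cap `2` leaves an integrable tail. -/
lemma lintegral_min_rpow_kernel_lt_top {σ p b C : ℝ} (hn : 0 < n) (hσ : 0 < σ) (hp : 1 < p)
    (hC : 0 ≤ C) (hb : σ < b * (p - 1)) :
    ∫⁻ h : Eu n, ENNReal.ofReal ((min 2 (C * ‖h‖ ^ b)) ^ (p - 1) * ‖h‖ ^ (-(n + σ))) < ∞ := by
  have hr : 0 < p - 1 := by linarith
  have hB : MeasurableSet (Metric.ball (0 : Eu n) 1) := Metric.isOpen_ball.measurableSet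
  have hpos : ∀ h : Eu n, 0 ≤ min 2 (C * ‖h‖ ^ b) := fun h =>
    le_min (by norm_num) (by positivity)
  rw [← lintegral_add_compl _ hB]
  refine ENNReal.add_lt_top.2 ⟨?_, ?_⟩
  · have h1 := lintegral_ball_norm_rpow_lt_top (n := n) (b := b * (p - 1) - (n + σ)) hn
      (by linarith)
    refine lt_of_le_of_lt ?_ (ENNReal.mul_lt_top (ENNReal.ofReal_lt_top (r := C ^ (p - 1))) h1)
    rw [← lintegral_const_mul' _ _ ENNReal.ofReal_ne_top]
    have hae : ∀ᵐ k : Eu n, k ≠ 0 := by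
      have : Nonempty (Fin n) := ⟨⟨0, hn⟩⟩
      exact Measure.ae_ne _ _
    refine lintegral_mono_ae (ae_restrict_of_ae (hae.mono fun h hh => ?_))
    rw [← ENNReal.ofReal_mul (by positivity)]
    apply ENNReal.ofReal_le_ofReal
    have hh0 : 0 < ‖h‖ := norm_pos_iff.2 hh
    calc (min 2 (C * ‖h‖ ^ b)) ^ (p - 1) * ‖h‖ ^ (-(n + σ))
        ≤ (C * ‖h‖ ^ b) ^ (p - 1) * ‖h‖ ^ (-(n + σ)) := by
          gcongr
          exact min_le_right _ _
      _ = _ := by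
          rw [Real.mul_rpow hC (by positivity), ← Real.rpow_mul hh0.le, mul_assoc,
            ← Real.rpow_add hh0]
          rfl
  · obtain ⟨D, hD, h⟩ := exists_lintegral_tail_le (n := n) hσ
    have h1 := (h 1 one_pos).trans_lt ENNReal.ofReal_lt_top
    refine lt_of_le_of_lt ?_
      (ENNReal.mul_lt_top (ENNReal.ofReal_lt_top (r := 2 ^ (p - 1))) h1)
    rw [← lintegral_const_mul' _ _ ENNReal.ofReal_ne_top]
    have hset : (Metric.ball (0 : Eu n) 1)ᶜ = {h : Eu n | 1 ≤ ‖h‖} := by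
      ext h; simp
    rw [hset]
    refine lintegral_mono fun h => ?_
    rw [← ENNReal.ofReal_mul (by positivity)]
    apply ENNReal.ofReal_le_ofReal
    gcongr
    exact min_le_left _ _

/-! ### The truncated operator near a point -/

lemma measurableSet_shell (ε ρ : ℝ) : MeasurableSet {h : Eu n | ε < ‖h‖ ∧ ‖h‖ < ρ} :=
  (measurableSet_lt measurable_const measurable_norm).inter
    (measurableSet_lt measurable_norm measurable_const)

lemma measurable_kernel (σ : ℝ) : Measurable fun h : Eu n => ‖h‖ ^ (-(n + σ)) :=
  measurable_norm.pow_const _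

lemma kernel_le {σ ε : ℝ} (hσ : 0 < σ) (hε : 0 < ε) {h : Eu n} (hh : ε < ‖h‖) :
    ‖h‖ ^ (-(n + σ)) ≤ ε ^ (-(n + σ)) :=
  Real.rpow_le_rpow_of_nonpos hε hh.le (by have : (0 : ℝ) ≤ n := n.cast_nonneg; linarith)

lemma integrableOn_shell_mul_kernel {σ ε ρ M : ℝ} (hσ : 0 < σ) (hε : 0 < ε) {f : Eu n → ℝ}
    (hf : Measurable f) (hM : ∀ h, ‖h‖ < ρ → |f h| ≤ M) :
    IntegrableOn (fun h => f h * ‖h‖ ^ (-(n + σ))) {h : Eu n | ε < ‖h‖ ∧ ‖h‖ < ρ} := by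
  refine Measure.integrableOn_of_bounded (M := M * ε ^ (-(n + σ))) ?_
    (hf.mul (measurable_kernel σ)).aestronglyMeasurable ?_
  · refine ((measure_mono fun h hh => ?_).trans_lt
      (measure_ball_lt_top (x := (0 : Eu n)) (r := ρ))).ne
    exact mem_ball_zero_iff.2 hh.2
  · refine (ae_restrict_iff' (measurableSet_shell ε ρ)).2 (Filter.Eventually.of_forall fun h hh => ?_)
    rw [norm_mul, Real.norm_eq_abs, Real.norm_of_nonneg (Real.rpow_nonneg (norm_nonneg _) _)]
    exact mul_le_mul (hM h hh.2) (kernel_le hσ hε hh.1) (Real.rpow_nonneg (norm_nonneg _) _)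
      ((abs_nonneg _).trans (hM h hh.2))

/-- This cancellation removes the linear part of a touching function, which need not be absolutely
integrable near the origin, and so makes the later bounds uniform in `ε`. -/
lemma setIntegral_shell_odd {σ ε ρ : ℝ} {f : Eu n → ℝ} (hf : ∀ h, f (-h) = -f h) :
    ∫ h in {h : Eu n | ε < ‖h‖ ∧ ‖h‖ < ρ}, f h * ‖h‖ ^ (-(n + σ)) = 0 := by
  rw [← integral_indicator (measurableSet_shell ε ρ)]
  set F := {h : Eu n | ε < ‖h‖ ∧ ‖h‖ < ρ}.indicator fun h => f h * ‖h‖ ^ (-(n + σ))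
  have h1 : ∀ h, F (-h) = -F h := by
    intro h
    simp only [F, indicator, mem_ofPred_eq, norm_neg, hf]
    split_ifs <;> simp
  have h2 := integral_neg_eq_self F (volume : Measure (Eu n))
  simp_rw [h1] at h2
  rw [integral_neg] at h2
  linarith

/-- Scaled to `ρ = 1`, the integrand is homogeneous of degree `p - n - σ`, with a power greater than
`-1` of a linear form. The two integrability conditions are `σ < p` and `p > 1`. -/
lemma exists_lintegral_increment_le {p σ : ℝ} (hn : 0 < n) (hp : 1 < p) (hσp : σ < p) :
    ∃ C : ℝ, 0 ≤ C ∧ ∀ e : Eu n, ‖e‖ = 1 → ∀ ρ : ℝ, 0 < ρ →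
      ∫⁻ h in Metric.ball (0 : Eu n) ρ, ENNReal.ofReal
        (‖ρ⁻¹ • h‖ ^ (p - min (p - 2) 0) * |inner ℝ e (ρ⁻¹ • h)| ^ min (p - 2) 0
          * ‖h‖ ^ (-(n + σ))) ≤ ENNReal.ofReal (C * ρ ^ (-σ)) := by
  set α := min (p - 2) 0 with hα
  have hα1 : -1 < α := lt_min (by linarith) (by norm_num)
  have hα0 : α ≤ 0 := min_le_right _ _
  obtain ⟨C, hC, h⟩ := exists_lintegral_inner_rpow_le (n := n) (α := α)
    (b := p - α - (n + σ)) hn hα1 (by linarith)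
  refine ⟨C.toReal, ENNReal.toReal_nonneg, fun e he ρ hρ => ?_⟩
  have h1 := lintegral_scale_kernel ((Metric.ball (0 : Eu n) ρ).indicator fun h => ENNReal.ofReal
    (‖ρ⁻¹ • h‖ ^ (p - α) * |inner ℝ e (ρ⁻¹ • h)| ^ α)) σ hρ
  rw [mul_comm, ENNReal.ofReal_mul (by positivity), ENNReal.ofReal_toReal hC,
    ← lintegral_indicator Metric.isOpen_ball.measurableSet]
  calc _ = _ := lintegral_congr fun k => ?_
    _ = _ := h1
    _ ≤ _ := by
      gcongr
      refine le_trans ?_ (h e he)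
      rw [← lintegral_indicator Metric.isOpen_ball.measurableSet]
      refine lintegral_mono fun k => ?_
      by_cases hk : k ∈ Metric.ball (0 : Eu n) 1
      · have hk' : ρ • k ∈ Metric.ball (0 : Eu n) ρ := by
          rw [mem_ball_zero_iff] at hk ⊢
          rw [norm_smul, Real.norm_of_nonneg hρ.le]
          nlinarith
        rw [indicator_of_mem hk, indicator_of_mem hk', inv_smul_smul₀ hρ.ne',
          ← ENNReal.ofReal_mul (by positivity)]
        apply ENNReal.ofReal_le_ofReal
        rcases eq_or_ne k 0 with h0 | h0
        · have : (0 : ℝ) ^ (p - α) = 0 := Real.zero_rpow (by linarith)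
          simp only [h0, norm_zero, this, zero_mul]
          positivity
        · rw [sub_eq_add_neg (p - α), Real.rpow_add (norm_pos_iff.2 h0)]
          exact le_of_eq (by ring)
      · have hk' : ρ • k ∉ Metric.ball (0 : Eu n) ρ := by
          rw [mem_ball_zero_iff, not_lt] at hk ⊢
          rw [norm_smul, Real.norm_of_nonneg hρ.le]
          nlinarith
        rw [indicator_of_notMem hk, indicator_of_notMem hk', zero_mul]
  by_cases hk : k ∈ Metric.ball (0 : Eu n) ρ
  · rw [indicator_of_mem hk, indicator_of_mem hk, ← ENNReal.ofReal_mul (by positivity)]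
  · rw [indicator_of_notMem hk, indicator_of_notMem hk, zero_mul]

lemma ae_inner_ne_zero {e : Eu n} (he : ‖e‖ = 1) : ∀ᵐ h : Eu n, inner ℝ e h ≠ 0 := by
  have h1 : (Submodule.span ℝ {e})ᗮ ≠ ⊤ := by
    intro h
    have : e ∈ (Submodule.span ℝ {e})ᗮ := by rw [h]; trivial
    rw [Submodule.mem_orthogonal_singleton_iff_inner_right, real_inner_self_eq_norm_sq, he] at this
    norm_num at this
  have h2 := Measure.addHaar_submodule (volume : Measure (Eu n)) _ h1
  rw [ae_iff]
  convert h2 using 2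
  ext h
  simp [Submodule.mem_orthogonal_singleton_iff_inner_right]

/-- If `f` is touched from above at the origin by a function with gradient of size `g` and Hessian
of size `g / ρ` in the ball of radius `ρ`, then the truncated nonlinear integral of `f` near the
origin is bounded from above, uniformly in the truncation. -/
lemma exists_integral_shell_le {p σ C : ℝ} (hn : 0 < n) (hp : 1 < p) (hσ : 0 < σ) (hσp : σ < p)
    (hC : 0 ≤ C) :
    ∃ C₀ : ℝ, 0 ≤ C₀ ∧ ∀ f : Eu n → ℝ, Measurable f → (∀ h, |f h| ≤ 2) →
      ∀ e : Eu n, ‖e‖ = 1 → ∀ g ρ : ℝ, 0 ≤ g → 0 < ρ →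
      (∀ h, ‖h‖ < ρ → f h ≤ g * (inner ℝ e h + C * ‖h‖ ^ 2 / ρ)) → ∀ ε : ℝ, 0 < ε →
      ∫ h in {h : Eu n | ε < ‖h‖ ∧ ‖h‖ < ρ}, spow (p - 1) (f h) * ‖h‖ ^ (-(n + σ)) ≤
        C₀ * ((g * ρ) ^ (p - 1) * ρ ^ (-σ)) := by
  have hr : 0 < p - 1 := by linarith
  obtain ⟨C', hC', hinc⟩ := exists_abs_spow_add_sub_le hp hC
  obtain ⟨D, hD, hlint⟩ := exists_lintegral_increment_le (n := n) hn hp hσp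
  refine ⟨C' * D, by positivity, fun f hf hf2 e he g ρ hg hρ hfg ε hε => ?_⟩
  set A := {h : Eu n | ε < ‖h‖ ∧ ‖h‖ < ρ}
  have hA : MeasurableSet A := measurableSet_shell ε ρ
  set α := min (p - 2) 0
  set B : Eu n → ℝ := fun h =>
    ‖ρ⁻¹ • h‖ ^ (p - α) * |inner ℝ e (ρ⁻¹ • h)| ^ α * ‖h‖ ^ (-(n + σ))
  have hB0 : ∀ h, 0 ≤ B h := fun h => by positivity
  have hBm : Measurable B := by
    refine Measurable.mul (Measurable.mul ?_ ?_) (measurable_kernel σ)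
    · exact (measurable_norm.comp (measurable_const_smul _)).pow_const _
    · exact ((by fun_prop : Measurable fun h : Eu n => |inner ℝ e (ρ⁻¹ • h)|)).pow_const _
  have hBA : ∫⁻ h in A, ENNReal.ofReal (B h) ≤ ENNReal.ofReal (D * ρ ^ (-σ)) :=
    (lintegral_mono_set fun h hh => mem_ball_zero_iff.2 hh.2).trans (hlint e he ρ hρ)
  have hBi : IntegrableOn B A := by
    refine ⟨hBm.aestronglyMeasurable, ?_⟩
    rw [hasFiniteIntegral_iff_ofReal (Filter.Eventually.of_forall hB0)]
    exact hBA.trans_lt ENNReal.ofReal_lt_top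
  have hBle : ∫ h in A, B h ≤ D * ρ ^ (-σ) := by
    rw [integral_eq_lintegral_of_nonneg_ae (Filter.Eventually.of_forall hB0)
      hBm.aestronglyMeasurable]
    exact ENNReal.toReal_le_of_le_ofReal (by positivity) hBA
  have hnorm : ∀ h : Eu n, ‖ρ⁻¹ • h‖ = ‖h‖ / ρ := fun h => by
    rw [norm_smul, norm_inv, Real.norm_of_nonneg hρ.le, inv_mul_eq_div]
  have hinner : ∀ h : Eu n, |inner ℝ e (ρ⁻¹ • h)| ≤ ‖ρ⁻¹ • h‖ := fun h => by
    simpa [he] using abs_real_inner_le_norm e (ρ⁻¹ • h)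
  -- The contribution of the linear part alone, in units of `ρ`; it integrates to zero over the
  -- shell.
  set O : Eu n → ℝ := fun h => spow (p - 1) (inner ℝ e (ρ⁻¹ • h))
  have hOm : Measurable O := (continuous_spow hr).measurable.comp (by fun_prop)
  have hO1 : ∀ h, ‖h‖ < ρ → |O h| ≤ 1 := fun h hh => by
    rw [abs_spow hr]
    refine Real.rpow_le_one (abs_nonneg _) ((hinner h).trans ?_) hr.le
    rw [hnorm, div_le_one hρ]
    exact hh.le
  have hOi := integrableOn_shell_mul_kernel (σ := σ) (ρ := ρ) hσ hε hOm hO1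
  have hO0 : ∫ h in A, O h * ‖h‖ ^ (-(n + σ)) = 0 := setIntegral_shell_odd fun h => by
    simp only [O, smul_neg, inner_neg_right, spow_neg]
  have hfi : IntegrableOn (fun h => spow (p - 1) (f h) * ‖h‖ ^ (-(n + σ))) A :=
    integrableOn_shell_mul_kernel (M := 2 ^ (p - 1)) hσ hε
      ((continuous_spow hr).measurable.comp hf) fun h _ => by
        rw [abs_spow hr]
        exact Real.rpow_le_rpow (abs_nonneg _) (hf2 h) hr.le
  have hGi : IntegrableOn (fun h => (g * ρ) ^ (p - 1) *
      (O h * ‖h‖ ^ (-(n + σ)) + C' * B h)) A := (hOi.add (hBi.const_mul C')).const_mul _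
  calc ∫ h in A, spow (p - 1) (f h) * ‖h‖ ^ (-(n + σ))
      ≤ ∫ h in A, (g * ρ) ^ (p - 1) * (O h * ‖h‖ ^ (-(n + σ)) + C' * B h) := by
        refine setIntegral_mono_ae_restrict hfi hGi ?_
        -- After rescaling, `f` lies below `g ρ (x + e)` with `x` linear and `e` quadratic in `t =
        -- ‖h‖ / ρ ≤ 1`. The increment bound `hinc` needs `x ≠ 0`, which excludes a null hyperplane.
        filter_upwards [ae_restrict_of_ae (ae_inner_ne_zero he), ae_restrict_mem hA] with h hne hh
        have hk0 : 0 ≤ ‖h‖ ^ (-(n + σ)) := by positivity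
        have hne' : inner ℝ e (ρ⁻¹ • h) ≠ 0 := by
          rw [inner_smul_right]
          exact mul_ne_zero (inv_pos.2 hρ).ne' hne
        have h1 := hinc (inner ℝ e (ρ⁻¹ • h)) (C * ‖ρ⁻¹ • h‖ ^ 2) ‖ρ⁻¹ • h‖ hne' (hinner h)
          (by rw [hnorm, div_le_one hρ]; exact hh.2.le) (by positivity) le_rfl
        have h2 : f h ≤ (g * ρ) * (inner ℝ e (ρ⁻¹ • h) + C * ‖ρ⁻¹ • h‖ ^ 2) := by
          refine (hfg h hh.2).trans_eq ?_
          rw [hnorm, inner_smul_right]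
          field_simp
        have h3 : spow (p - 1) (f h) ≤
            (g * ρ) ^ (p - 1) * (O h + C' * (‖ρ⁻¹ • h‖ ^ (p - α) *
              |inner ℝ e (ρ⁻¹ • h)| ^ α)) := by
          refine (spow_mono hr h2).trans ?_
          rw [spow_mul hr, spow_of_nonneg hr (by positivity)]
          gcongr
          have := (abs_le.1 h1).2
          linarith
        refine (mul_le_mul_of_nonneg_right h3 hk0).trans_eq ?_
        simp only [B]
        ring
    _ = (g * ρ) ^ (p - 1) * (C' * ∫ h in A, B h) := by
        rw [integral_const_mul, integral_add hOi (hBi.const_mul C'), hO0, zero_add,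
          integral_const_mul]
    _ ≤ (g * ρ) ^ (p - 1) * (C' * (D * ρ ^ (-σ))) := by gcongr
    _ = _ := by ring

/-! ### The barrier -/

lemma abs_one_add_pow_sub_one_le {t : ℝ} (ht : |t| ≤ 1) (N : ℕ) :
    |(1 + t) ^ N - 1| ≤ (2 ^ N - 1) * |t| := by
  induction N with
  | zero => simp
  | succ N ih =>
    have h1 : |1 + t| ≤ 2 := (abs_add_le _ _).trans (by rw [abs_one]; linarith)
    calc |(1 + t) ^ (N + 1) - 1| = |(1 + t) * ((1 + t) ^ N - 1) + t| := by congr 1; ring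
      _ ≤ |1 + t| * |(1 + t) ^ N - 1| + |t| := by
          rw [← abs_mul]; exact abs_add_le _ _
      _ ≤ 2 * ((2 ^ N - 1) * |t|) + |t| := by gcongr
      _ = _ := by ring

lemma abs_one_add_pow_sub_sub_le {t : ℝ} (ht : |t| ≤ 1) (N : ℕ) :
    |(1 + t) ^ N - 1 - N * t| ≤ 4 ^ N * t ^ 2 := by
  induction N with
  | zero => simp; positivity
  | succ N ih =>
    have h1 : |1 + t| ≤ 2 := (abs_add_le _ _).trans (by rw [abs_one]; linarith)
    have hN : (N : ℝ) ≤ 4 ^ N := by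
      exact_mod_cast (Nat.lt_pow_self (by norm_num : 1 < 4)).le
    calc |(1 + t) ^ (N + 1) - 1 - (N + 1 : ℕ) * t|
        = |(1 + t) * ((1 + t) ^ N - 1 - N * t) + N * t ^ 2| := by congr 1; push_cast; ring
      _ ≤ |1 + t| * |(1 + t) ^ N - 1 - N * t| + |N * t ^ 2| := by
          rw [← abs_mul]; exact abs_add_le _ _
      _ ≤ 2 * (4 ^ N * t ^ 2) + N * t ^ 2 := by
          rw [abs_of_nonneg (by positivity : (0 : ℝ) ≤ N * t ^ 2)]
          gcongr
      _ ≤ 2 * (4 ^ N * t ^ 2) + 4 ^ N * t ^ 2 := by gcongr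
      _ ≤ _ := by
          have : 0 ≤ (4 : ℝ) ^ N * t ^ 2 := by positivity
          rw [pow_succ (4 : ℝ)]; linarith

/-- The regularized distance to the boundary of the unit ball. -/
def rdist (N : ℕ) (κ : ℝ) (y : Eu n) : ℝ := κ + max 0 (1 - ‖y‖ ^ (2 * N))

/-- The profile of the barrier in the unit ball. -/
def profile (N : ℕ) (β κ : ℝ) (y : Eu n) : ℝ := -1 + 2 * (κ / rdist N κ y) ^ β

section Profile

variable {N : ℕ} {β κ : ℝ}

lemma le_rdist (y : Eu n) : κ ≤ rdist N κ y :=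
  le_add_of_nonneg_right (le_max_left _ _)

lemma rdist_le (y : Eu n) : rdist N κ y ≤ κ + 1 := by
  unfold rdist
  gcongr
  exact max_le (by norm_num) (by linarith [pow_nonneg (norm_nonneg y) (2 * N)])

lemma rdist_eq {y : Eu n} (hy : ‖y‖ ≤ 1) : rdist N κ y = κ + 1 - ‖y‖ ^ (2 * N) := by
  unfold rdist
  rw [max_eq_right (sub_nonneg.2 (pow_le_one₀ (norm_nonneg _) hy))]
  ring

lemma div_rdist_mem (hκ : 0 < κ) (y : Eu n) : κ / rdist N κ y ∈ Ioc (0 : ℝ) 1 :=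
  ⟨div_pos hκ (hκ.trans_le (le_rdist y)), (div_le_one (hκ.trans_le (le_rdist y))).2 (le_rdist y)⟩

lemma profile_mem (hκ : 0 < κ) (hβ : 0 ≤ β) (y : Eu n) : profile N β κ y ∈ Ioc (-1 : ℝ) 1 := by
  have h := div_rdist_mem (N := N) hκ y
  have h1 : 0 < (κ / rdist N κ y) ^ β := Real.rpow_pos_of_pos h.1 _
  have h2 : (κ / rdist N κ y) ^ β ≤ 1 := Real.rpow_le_one h.1.le h.2 hβ
  constructor <;> unfold profile <;> linarith

lemma continuous_profile (hκ : 0 < κ) : Continuous (profile N β κ : Eu n → ℝ) := by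
  unfold profile rdist
  refine continuous_const.add (continuous_const.mul (Continuous.rpow_const ?_ fun y => Or.inl ?_))
  · refine continuous_const.div (by fun_prop) fun y => ?_
    exact (hκ.trans_le (le_rdist (N := N) y)).ne'
  · exact (div_rdist_mem (N := N) hκ y).1.ne'

lemma profile_eq_one (hκ : 0 < κ) {y : Eu n} (hy : 1 ≤ ‖y‖) :
    profile N β κ y = 1 := by
  unfold profile rdist
  rw [max_eq_left (sub_nonpos.2 (one_le_pow₀ hy)), add_zero, div_self hκ.ne', Real.one_rpow]
  norm_num

lemma abs_profile_sub_le (hκ : 0 < κ) (hβ : 0 ≤ β) (y z : Eu n) :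
    |profile N β κ y - profile N β κ z| ≤ 2 := by
  have h1 := profile_mem (N := N) hκ hβ y
  have h2 := profile_mem (N := N) hκ hβ z
  rw [abs_le]
  constructor <;> linarith [h1.1, h1.2, h2.1, h2.2]

set_option maxHeartbeats 800000 in
/-- The profile is touched from above by a paraboloid in a ball which is small with respect to the
distances from the centre and from the boundary. -/
lemma exists_profile_touching (hN : N ≠ 0) (hβ : 0 < β) :
    ∃ C : ℝ, 0 ≤ C ∧ ∀ κ : ℝ, 0 < κ → ∀ y : Eu n, y ≠ 0 → ‖y‖ < 1 → ∀ h : Eu n,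
      ‖h‖ < (6 * 2 ^ N)⁻¹ * min ‖y‖ (rdist N κ y) →
      profile N β κ (y + h) - profile N β κ y ≤
        (4 * (κ / rdist N κ y) ^ β * β * N * (‖y‖ ^ (2 * N) / ‖y‖) / rdist N κ y) *
          (inner ℝ (‖y‖⁻¹ • y) h + C * ‖h‖ ^ 2 / ((6 * 2 ^ N)⁻¹ * min ‖y‖ (rdist N κ y))) := by
  obtain ⟨C₂, hC₂, hpow⟩ := exists_one_sub_rpow_neg_le hβ.le
  have hN0 : (0 : ℝ) < N := by exact_mod_cast Nat.pos_of_ne_zero hN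
  set C₁ : ℝ := (N + 9 * 4 ^ N) / (2 * N) with hC₁
  set C₃ : ℝ := C₂ * (3 * 2 ^ N) ^ 2 / (2 * β * N) with hC₃
  refine ⟨C₁ + C₃, by positivity, fun κ hκ y hy0 hy1 h hh => ?_⟩
  set a := ‖y‖ with ha
  set d := rdist N κ y with hd
  -- Small enough that `|t| ≤ 1` and that the relative change `q` of `rdist` stays below `3 * 2 ^ N
  -- * c = 1 / 2`.
  set c : ℝ := (6 * 2 ^ N)⁻¹ with hc
  set A := (κ / d) ^ β with hA
  set P := a ^ (2 * N) with hP
  have ha0 : 0 < a := norm_pos_iff.2 hy0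
  have hd0 : 0 < d := hκ.trans_le (le_rdist y)
  have hc0 : 0 < c := by positivity
  have h2N : (1 : ℝ) ≤ 2 ^ N := one_le_pow₀ (by norm_num)
  have hcN : c * (6 * 2 ^ N) = 1 := inv_mul_cancel₀ (by positivity)
  have hc1 : c ≤ 1 / 6 := by nlinarith
  have hA0 : 0 < A := Real.rpow_pos_of_pos (div_rdist_mem hκ y).1 _
  have hP0 : 0 < P := by positivity
  have hPa : P / a ≤ 1 := by
    rw [div_le_one ha0]
    exact pow_le_of_le_one ha0.le hy1.le (by omega)
  have hha : ‖h‖ < c * a := hh.trans_le (by gcongr; exact min_le_left _ _)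
  have hhd : ‖h‖ < c * d := hh.trans_le (by gcongr; exact min_le_right _ _)
  have hh0 : 0 ≤ ‖h‖ := norm_nonneg h
  set I : ℝ := inner ℝ (a⁻¹ • y) h with hI
  have hyh : inner ℝ y h = a * I := by
    rw [hI, inner_smul_left]; simp; field_simp
  have hI' : |I| ≤ ‖h‖ := by
    have h1 := abs_real_inner_le_norm (a⁻¹ • y) h
    rw [norm_smul, norm_inv, norm_norm, inv_mul_cancel₀ ha0.ne', one_mul] at h1
    exact h1
  set t : ℝ := 2 * I / a + ‖h‖ ^ 2 / a ^ 2 with ht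
  have hsq : ‖y + h‖ ^ 2 = a ^ 2 * (1 + t) := by
    rw [norm_add_sq_real, hyh, ht]; field_simp; ring
  have hta : |t| ≤ 3 * (‖h‖ / a) := by
    have h1 : ‖h‖ / a ≤ 1 := by rw [div_le_one ha0]; nlinarith
    have h2 : |2 * I / a| ≤ 2 * (‖h‖ / a) := by
      rw [abs_div, abs_mul, abs_of_pos ha0, abs_two, mul_div_assoc]
      gcongr
    have h3 : |‖h‖ ^ 2 / a ^ 2| ≤ ‖h‖ / a := by
      rw [abs_of_nonneg (by positivity), ← div_pow]
      exact pow_le_of_le_one (by positivity) h1 (by norm_num)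
    have := abs_add_le (2 * I / a) (‖h‖ ^ 2 / a ^ 2)
    rw [← ht] at this
    linarith
  have ht1 : |t| ≤ 1 := by
    refine hta.trans ?_
    have : ‖h‖ / a ≤ c := by rw [div_le_iff₀ ha0]; exact hha.le
    linarith
  set δ : ℝ := ‖y + h‖ ^ (2 * N) - P with hδ
  have hδ' : δ = P * ((1 + t) ^ N - 1) := by
    rw [hδ, pow_mul, hsq, mul_pow, ← pow_mul, ← hP]; ring
  have hδabs : |δ| ≤ 3 * 2 ^ N * (P / a) * ‖h‖ := by
    rw [hδ', abs_mul, abs_of_pos hP0]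
    calc P * |(1 + t) ^ N - 1| ≤ P * ((2 ^ N - 1) * |t|) := by
          gcongr; exact abs_one_add_pow_sub_one_le ht1 N
      _ ≤ P * (2 ^ N * (3 * (‖h‖ / a))) := by
          gcongr
          linarith
      _ = _ := by ring
  have hδle : δ ≤ 2 * N * (P / a) * (I + C₁ * ‖h‖ ^ 2 / a) := by
    have h1 := (abs_le.1 (abs_one_add_pow_sub_sub_le ht1 N)).2
    have h2 : t ^ 2 ≤ 9 * (‖h‖ ^ 2 / a ^ 2) := by
      rw [← sq_abs t]
      calc |t| ^ 2 ≤ (3 * (‖h‖ / a)) ^ 2 := by gcongr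
        _ = _ := by ring
    rw [hδ']
    calc P * ((1 + t) ^ N - 1) ≤ P * (N * t + 4 ^ N * (9 * (‖h‖ ^ 2 / a ^ 2))) := by
          gcongr
          have : 4 ^ N * t ^ 2 ≤ 4 ^ N * (9 * (‖h‖ ^ 2 / a ^ 2)) := by gcongr
          linarith
      _ = _ := by rw [ht, hC₁]; field_simp; ring
  set q : ℝ := δ / d with hq
  have hqabs : |q| ≤ 3 * 2 ^ N * (P / a) * ‖h‖ / d := by
    rw [hq, abs_div, abs_of_pos hd0]; gcongr
  have hq12 : |q| ≤ 1 / 2 := by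
    refine hqabs.trans ?_
    rw [div_le_iff₀ hd0]
    calc 3 * 2 ^ N * (P / a) * ‖h‖ ≤ 3 * 2 ^ N * 1 * (c * d) := by gcongr
      _ = (c * (6 * 2 ^ N)) * d / 2 := by ring
      _ = 1 / 2 * d := by rw [hcN]; ring
  have hq1 : 0 < 1 - q := by linarith [(abs_le.1 hq12).2]
  -- Only an inequality, since `y + h` may leave the unit ball; it points the right way, because a
  -- smaller distance gives a larger profile.
  have hdh : d * (1 - q) ≤ rdist N κ (y + h) := by
    have h1 : d = κ + 1 - P := rdist_eq hy1.le
    have h2 : d * (1 - q) = κ + (1 - ‖y + h‖ ^ (2 * N)) := by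
      rw [hq, mul_sub, mul_div_cancel₀ _ hd0.ne', hδ, mul_one, h1]; ring
    rw [h2]
    unfold rdist
    gcongr
    exact le_max_right _ _
  have hmain : (κ / rdist N κ (y + h)) ^ β ≤ A * (1 + β * q + C₂ * q ^ 2) := by
    calc (κ / rdist N κ (y + h)) ^ β ≤ (κ / (d * (1 - q))) ^ β := by
          apply Real.rpow_le_rpow (div_rdist_mem hκ _).1.le _ hβ.le
          gcongr
      _ = A * (1 - q) ^ (-β) := by
          rw [← div_div, div_eq_mul_inv (κ / d), Real.mul_rpow (div_rdist_mem hκ y).1.le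
            (inv_pos.2 hq1).le, Real.inv_rpow hq1.le, Real.rpow_neg hq1.le]
      _ ≤ _ := by gcongr; exact hpow q hq12
  have hqle : q ≤ 2 * N * (P / a) * (I + C₁ * ‖h‖ ^ 2 / a) / d := by
    rw [hq]; gcongr
  -- One of the two factors `P / a ≤ 1` is discarded so that the quadratic error carries the same
  -- factor as the gradient, and the gradient can be pulled out of the whole bound.
  have hq2 : q ^ 2 ≤ (3 * 2 ^ N) ^ 2 * ((P / a) * 1) * ‖h‖ ^ 2 / d ^ 2 := by
    rw [← sq_abs q]
    calc |q| ^ 2 ≤ (3 * 2 ^ N * (P / a) * ‖h‖ / d) ^ 2 := by gcongr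
      _ = (3 * 2 ^ N) ^ 2 * ((P / a) * (P / a)) * ‖h‖ ^ 2 / d ^ 2 := by ring
      _ ≤ _ := by gcongr
  set ρ := c * min a d with hρ
  have hm0 : 0 < min a d := lt_min ha0 hd0
  have hρ0 : 0 < ρ := by positivity
  have hρm : ρ ≤ min a d := mul_le_of_le_one_left hm0.le (by linarith)
  have hρa : ρ ≤ a := hρm.trans (min_le_left _ _)
  have hρd : ρ ≤ d := hρm.trans (min_le_right _ _)
  calc profile N β κ (y + h) - profile N β κ y
      = 2 * ((κ / rdist N κ (y + h)) ^ β - A) := by unfold profile; ring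
    _ ≤ 2 * (A * (1 + β * q + C₂ * q ^ 2) - A) := by gcongr
    _ = 2 * A * β * q + 2 * A * C₂ * q ^ 2 := by ring
    _ ≤ 2 * A * β * (2 * N * (P / a) * (I + C₁ * ‖h‖ ^ 2 / a) / d) +
        2 * A * C₂ * ((3 * 2 ^ N) ^ 2 * ((P / a) * 1) * ‖h‖ ^ 2 / d ^ 2) := by gcongr
    _ = (4 * A * β * N * (P / a) / d) * (I + (C₁ * ‖h‖ ^ 2 / a + C₃ * ‖h‖ ^ 2 / d)) := by
        rw [hC₃]; field_simp; ring
    _ ≤ (4 * A * β * N * (P / a) / d) * (I + (C₁ * ‖h‖ ^ 2 / ρ + C₃ * ‖h‖ ^ 2 / ρ)) := by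
        have : 0 ≤ C₁ := by positivity
        have : 0 ≤ C₃ := by positivity
        gcongr
    _ = _ := by ring

/-- The profile is smallest at the origin and exceeds its value there by `O(‖z‖^(2N))` at `z`. Since
`‖h‖ ≥ c ‖y‖`, the point `y + h` has norm at most a multiple of `‖h‖`. If `‖y + h‖ > 1/2` then `‖h‖`
is bounded below and the oscillation bound `2` is enough. -/
lemma exists_profile_far (N : ℕ) (hβ : 0 < β) {c : ℝ} (hc : 0 < c) :
    ∃ C : ℝ, 0 ≤ C ∧ ∀ κ : ℝ, 0 < κ → ∀ y : Eu n, ∀ h : Eu n, c * ‖y‖ ≤ ‖h‖ → N ≠ 0 →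
      profile N β κ (y + h) - profile N β κ y ≤ C * ‖h‖ ^ (2 * N) := by
  obtain ⟨C₂, hC₂, hpow⟩ := exists_one_sub_rpow_neg_le hβ.le
  refine ⟨2 * (β + C₂ + 1) * (2 * (1 + c⁻¹)) ^ (2 * N), by positivity,
    fun κ hκ y h hh hN => ?_⟩
  have hyh : ‖y + h‖ ≤ (1 + c⁻¹) * ‖h‖ := by
    have h1 : ‖y‖ ≤ c⁻¹ * ‖h‖ := by
      rw [inv_mul_eq_div, le_div_iff₀ hc]; linarith
    linarith [norm_add_le y h]
  rcases le_or_gt ‖y + h‖ (1 / 2) with h12 | h12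
  · set t := ‖y + h‖ ^ (2 * N) with ht
    have ht0 : 0 ≤ t := by positivity
    have ht2 : t ≤ 1 / 2 := (pow_le_of_le_one (norm_nonneg _) (by linarith) (by omega)).trans h12
    set q := t / (κ + 1) with hq
    have hq0 : 0 ≤ q := by positivity
    have hqt : q ≤ t := div_le_self ht0 (by linarith)
    have h1 := hpow q (by rw [abs_of_nonneg hq0]; linarith)
    have hd : rdist N κ (y + h) = (κ + 1) * (1 - q) := by
      rw [rdist_eq (by linarith), hq]; field_simp; rw [ht]
    have hA0 : 0 < κ / (κ + 1) := by positivity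
    have hA : (κ / (κ + 1)) ^ β ≤ (κ / rdist N κ y) ^ β := by
      apply Real.rpow_le_rpow hA0.le _ hβ.le
      have := hκ.trans_le (le_rdist (N := N) y)
      gcongr
      exact rdist_le y
    have hA1 : (κ / (κ + 1)) ^ β ≤ 1 :=
      Real.rpow_le_one hA0.le ((div_le_one (by linarith)).2 (by linarith)) hβ.le
    have hq1 : 0 < 1 - q := by linarith
    have hB : (κ / rdist N κ (y + h)) ^ β = (κ / (κ + 1)) ^ β * (1 - q) ^ (-β) := by
      rw [hd, ← div_div, div_eq_mul_inv (κ / (κ + 1)), Real.mul_rpow hA0.le (inv_pos.2 hq1).le,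
        Real.inv_rpow hq1.le, Real.rpow_neg hq1.le]
    have hA0' : 0 ≤ (κ / (κ + 1)) ^ β := by positivity
    have hqq : β * q + C₂ * q ^ 2 ≤ (β + C₂ + 1) * t := by
      have h3 : q ^ 2 ≤ t := by nlinarith
      have h4 := mul_le_mul_of_nonneg_left h3 hC₂
      have h5 := mul_le_mul_of_nonneg_left hqt hβ.le
      linarith
    calc profile N β κ (y + h) - profile N β κ y
        = 2 * ((κ / rdist N κ (y + h)) ^ β - (κ / rdist N κ y) ^ β) := by unfold profile; ring
      _ ≤ 2 * ((κ / (κ + 1)) ^ β * (1 + β * q + C₂ * q ^ 2) - (κ / (κ + 1)) ^ β) := by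
          rw [hB]; gcongr
      _ = 2 * ((κ / (κ + 1)) ^ β * (β * q + C₂ * q ^ 2)) := by ring
      _ ≤ 2 * (1 * (β * q + C₂ * q ^ 2)) := by gcongr
      _ ≤ 2 * (β + C₂ + 1) * t := by linarith
      _ ≤ 2 * (β + C₂ + 1) * ((1 + c⁻¹) * ‖h‖) ^ (2 * N) := by rw [ht]; gcongr
      _ ≤ 2 * (β + C₂ + 1) * ((2 * (1 + c⁻¹)) * ‖h‖) ^ (2 * N) := by
          have : 0 < c⁻¹ := by positivity
          gcongr
          linarith
      _ = _ := by rw [mul_pow]; ring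
  · have h1 : 1 ≤ (2 * (1 + c⁻¹) * ‖h‖) ^ (2 * N) := one_le_pow₀ (by linarith)
    have h2 := (abs_le.1 (abs_profile_sub_le (N := N) hκ hβ.le (y + h) y)).2
    rw [mul_pow] at h1
    refine h2.trans ?_
    rw [mul_assoc]
    nlinarith

end Profile

/-! ### The nonlinear operator on the barrier -/

lemma measurableSet_tail (ε : ℝ) : MeasurableSet {h : Eu n | ε < ‖h‖} :=
  measurableSet_lt measurable_const measurable_norm

lemma integrableOn_tail_kernel {σ ε : ℝ} (hσ : 0 < σ) (hε : 0 < ε) :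
    IntegrableOn (fun h : Eu n => ‖h‖ ^ (-(n + σ))) {h : Eu n | ε < ‖h‖} := by
  refine ⟨(measurable_kernel σ).aestronglyMeasurable, ?_⟩
  rw [hasFiniteIntegral_iff_ofReal (Filter.Eventually.of_forall fun h => by positivity)]
  obtain ⟨C, -, hC⟩ := exists_lintegral_tail_le (n := n) hσ
  refine lt_of_le_of_lt ?_ ((hC ε hε).trans_lt ENNReal.ofReal_lt_top)
  exact lintegral_mono_set fun h (hh : ε < ‖h‖) => show ε ≤ ‖h‖ from hh.le

lemma integrableOn_tail_mul_kernel {σ ε M : ℝ} (hσ : 0 < σ) (hε : 0 < ε) {f : Eu n → ℝ}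
    (hf : Measurable f) (hM : ∀ h, |f h| ≤ M) :
    IntegrableOn (fun h => f h * ‖h‖ ^ (-(n + σ))) {h : Eu n | ε < ‖h‖} :=
  (integrableOn_tail_kernel hσ hε).bdd_mul hf.aestronglyMeasurable (Filter.Eventually.of_forall hM)

lemma setIntegral_le_of_lintegral_le {s : Set (Eu n)} (hs : MeasurableSet s) {f G : Eu n → ℝ}
    {M : ℝ} (hM : 0 ≤ M) (hf : IntegrableOn f s) (hG : Measurable G) (hG0 : ∀ h, 0 ≤ G h)
    (hfG : ∀ h ∈ s, f h ≤ G h) (hGM : ∫⁻ h in s, ENNReal.ofReal (G h) ≤ ENNReal.ofReal M) :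
    ∫ h in s, f h ≤ M := by
  have hGi : IntegrableOn G s := by
    refine ⟨hG.aestronglyMeasurable, ?_⟩
    rw [hasFiniteIntegral_iff_ofReal (Filter.Eventually.of_forall hG0)]
    exact hGM.trans_lt ENNReal.ofReal_lt_top
  refine (setIntegral_mono_on hf hGi hs hfG).trans ?_
  rw [integral_eq_lintegral_of_nonneg_ae (Filter.Eventually.of_forall hG0)
    hG.aestronglyMeasurable]
  exact ENNReal.toReal_le_of_le_ofReal hM hGM

/-- The integral is split at `ρ = c * min ‖y‖ d`, where `d` is the regularized distance. Inside, the
touching paraboloid applies. Outside, if `d ≤ ‖y‖`, the oscillation bound and the tail of the kernel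
give a multiple of `d^(-σ)`. If `‖y‖ ≤ d` that tail would blow up at the centre; the growth
`‖h‖^(2N)` replaces it by a convergent integral, and in the inner part the small gradient
compensates `ρ^(-σ)`. Bounded quantities are multiples of `d^(-σ)` because `d ≤ 2`. -/
lemma exists_profile_operator_le {N : ℕ} {β p σ : ℝ} (hn : 0 < n) (hN : N ≠ 0) (hβ : 0 < β)
    (hp : 1 < p) (hσ : 0 < σ) (hσp : σ < p) (hNσ : σ ≤ (2 * N - 1) * (p - 1)) :
    ∃ C : ℝ, 0 < C ∧ ∀ κ : ℝ, 0 < κ → κ ≤ 1 → ∀ y : Eu n, y ≠ 0 → ‖y‖ < 1 → ∀ ε : ℝ, 0 < ε →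
      ∫ h in {h : Eu n | ε < ‖h‖},
        spow (p - 1) (profile N β κ (y + h) - profile N β κ y) * ‖h‖ ^ (-(n + σ)) ≤
          C * rdist N κ y ^ (-σ) := by
  have hr : 0 < p - 1 := by linarith
  set c : ℝ := (6 * 2 ^ N)⁻¹ with hc
  have hc0 : 0 < c := by positivity
  have hN0 : (0 : ℝ) < N := by exact_mod_cast Nat.pos_of_ne_zero hN
  obtain ⟨C₁, hC₁, htouch⟩ := exists_profile_touching (n := n) hN hβ
  obtain ⟨C₂, hC₂, hfar⟩ := exists_profile_far (n := n) N hβ hc0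
  obtain ⟨C₃, hC₃, hnear⟩ := exists_integral_shell_le (n := n) hn hp hσ hσp hC₁
  obtain ⟨C₄, hC₄, htail⟩ := exists_lintegral_tail_le (n := n) hσ
  have hmid := lintegral_min_rpow_kernel_lt_top (n := n) (b := ((2 * N : ℕ) : ℝ)) hn hσ hp hC₂
    (by push_cast; linarith)
  set C₅ := (∫⁻ h : Eu n, ENNReal.ofReal ((min 2 (C₂ * ‖h‖ ^ ((2 * N : ℕ) : ℝ))) ^ (p - 1)
    * ‖h‖ ^ (-(n + σ)))).toReal with hC₅
  have hC₅0 : 0 ≤ C₅ := ENNReal.toReal_nonneg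
  refine ⟨C₃ * (4 * β * N) ^ (p - 1) * c ^ (-σ) * (1 + 2 ^ σ) + 2 ^ (p - 1) * C₄ * c ^ (-σ)
    + C₅ * 2 ^ σ, by positivity, fun κ hκ hκ1 y hy0 hy1 ε hε => ?_⟩
  set a := ‖y‖ with ha
  set d := rdist N κ y with hd
  have ha0 : 0 < a := norm_pos_iff.2 hy0
  have hd0 : 0 < d := hκ.trans_le (le_rdist y)
  have hd2 : d ≤ 2 := (rdist_le y).trans (by linarith)
  have hdσ : 0 < d ^ (-σ) := by positivity
  have h1d : 1 ≤ 2 ^ σ * d ^ (-σ) := by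
    rw [Real.rpow_neg hd0.le, ← div_eq_mul_inv, ← Real.div_rpow (by norm_num) hd0.le]
    exact Real.one_le_rpow ((one_le_div hd0).2 hd2) hσ.le
  set ρ := c * min a d with hρ
  have hρ0 : 0 < ρ := mul_pos hc0 (lt_min ha0 hd0)
  set g := 4 * (κ / d) ^ β * β * N * (a ^ (2 * N) / a) / d with hg
  have hA0 : 0 < (κ / d) ^ β := Real.rpow_pos_of_pos (div_rdist_mem hκ y).1 _
  have hA1 : (κ / d) ^ β ≤ 1 := Real.rpow_le_one (div_rdist_mem hκ y).1.le (div_rdist_mem hκ y).2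
    hβ.le
  have hg0 : 0 ≤ g := by positivity
  set f : Eu n → ℝ := fun h => profile N β κ (y + h) - profile N β κ y with hf
  have hfm : Measurable f :=
    (((continuous_profile hκ).comp (continuous_const.add continuous_id)).sub
      continuous_const).measurable
  have hf2 : ∀ h, |f h| ≤ 2 := fun h => abs_profile_sub_le hκ hβ.le _ _
  have he : ‖a⁻¹ • y‖ = 1 := by
    rw [norm_smul, norm_inv, norm_norm, inv_mul_cancel₀ ha0.ne']
  have hI1 := hnear f hfm hf2 (a⁻¹ • y) he g ρ hg0 hρ0 (fun h hh => htouch κ hκ y hy0 hy1 h hh)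
    ε hε
  have hsm : Measurable fun h => spow (p - 1) (f h) := (continuous_spow hr).measurable.comp hfm
  have hs2 : ∀ h, |spow (p - 1) (f h)| ≤ 2 ^ (p - 1) := fun h => by
    rw [abs_spow hr]
    exact Real.rpow_le_rpow (abs_nonneg _) (hf2 h) hr.le
  have hint := integrableOn_tail_mul_kernel hσ hε hsm hs2
  set far : Set (Eu n) := {h : Eu n | ε < ‖h‖} ∩ {h | ρ ≤ ‖h‖} with hfar'
  have hfarm : MeasurableSet far :=
    (measurableSet_tail ε).inter (measurableSet_le measurable_const measurable_norm)
  have hunion : {h : Eu n | ε < ‖h‖} = {h : Eu n | ε < ‖h‖ ∧ ‖h‖ < ρ} ∪ far := by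
    ext h
    simp only [hfar', mem_ofPred_eq, mem_union, mem_inter_iff]
    constructor
    · intro hh
      rcases lt_or_ge ‖h‖ ρ with h1 | h1
      · exact Or.inl ⟨hh, h1⟩
      · exact Or.inr ⟨hh, h1⟩
    · rintro (hh | hh) <;> exact hh.1
  have hdisj : Disjoint {h : Eu n | ε < ‖h‖ ∧ ‖h‖ < ρ} far := by
    rw [Set.disjoint_left]
    intro h hh hh'
    exact absurd hh.2 (not_lt.2 hh'.2)
  have hsplit : ∫ h in {h : Eu n | ε < ‖h‖}, spow (p - 1) (f h) * ‖h‖ ^ (-(n + σ)) =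
      (∫ h in {h : Eu n | ε < ‖h‖ ∧ ‖h‖ < ρ}, spow (p - 1) (f h) * ‖h‖ ^ (-(n + σ))) +
      ∫ h in far, spow (p - 1) (f h) * ‖h‖ ^ (-(n + σ)) := by
    have h1 := hint
    rw [hunion] at h1
    rw [hunion]
    exact setIntegral_union hdisj hfarm (h1.mono_set subset_union_left)
      (h1.mono_set subset_union_right)
  have hfint : IntegrableOn (fun h => spow (p - 1) (f h) * ‖h‖ ^ (-(n + σ))) far :=
    hint.mono_set inter_subset_left
  have hgρ : g * ρ ≤ (4 * β * N) * (a ^ (2 * N) / a) := by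
    have h1 : ρ ≤ d := by
      have h2 : c ≤ 1 := by
        rw [hc]
        apply inv_le_one_of_one_le₀
        have : (1 : ℝ) ≤ 2 ^ N := one_le_pow₀ (by norm_num)
        linarith
      calc ρ ≤ 1 * d := by rw [hρ]; gcongr; exact min_le_right _ _
        _ = d := one_mul d
    calc g * ρ ≤ g * d := by gcongr
      _ = (κ / d) ^ β * ((4 * β * N) * (a ^ (2 * N) / a)) := by rw [hg]; field_simp
      _ ≤ 1 * ((4 * β * N) * (a ^ (2 * N) / a)) := by gcongr
      _ = _ := one_mul _
  have hPa : a ^ (2 * N) / a ≤ 1 := by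
    rw [div_le_one ha0]
    exact pow_le_of_le_one ha0.le hy1.le (by omega)
  have hX : ∀ X : ℝ, (a ^ (2 * N) / a) ^ (p - 1) * ρ ^ (-σ) ≤ X →
      C₃ * ((g * ρ) ^ (p - 1) * ρ ^ (-σ)) ≤ C₃ * (4 * β * N) ^ (p - 1) * X := by
    intro X hX
    calc C₃ * ((g * ρ) ^ (p - 1) * ρ ^ (-σ))
        ≤ C₃ * (((4 * β * N) * (a ^ (2 * N) / a)) ^ (p - 1) * ρ ^ (-σ)) := by gcongr
      _ = C₃ * (4 * β * N) ^ (p - 1) * ((a ^ (2 * N) / a) ^ (p - 1) * ρ ^ (-σ)) := by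
          rw [Real.mul_rpow (by positivity) (by positivity)]; ring
      _ ≤ _ := by gcongr
  have hspow_le : ∀ h, spow (p - 1) (f h) ≤ 2 ^ (p - 1) := fun h => (le_abs_self _).trans (hs2 h)
  rcases le_total d a with hda | hda
  · have hρd : ρ = c * d := by rw [hρ, min_eq_right hda]
    have hρσ : ρ ^ (-σ) = c ^ (-σ) * d ^ (-σ) := by rw [hρd, Real.mul_rpow hc0.le hd0.le]
    have hfarle : ∫ h in far, spow (p - 1) (f h) * ‖h‖ ^ (-(n + σ)) ≤
        2 ^ (p - 1) * (C₄ * ρ ^ (-σ)) := by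
      refine setIntegral_le_of_lintegral_le (G := fun h => 2 ^ (p - 1) * ‖h‖ ^ (-(n + σ))) hfarm
        (by positivity) hfint (measurable_const.mul (measurable_kernel σ))
        (fun h => by positivity) (fun h _ => ?_) ?_
      · exact mul_le_mul_of_nonneg_right (hspow_le h) (by positivity)
      · simp_rw [ENNReal.ofReal_mul (show (0 : ℝ) ≤ 2 ^ (p - 1) by positivity)]
        rw [lintegral_const_mul' _ _ ENNReal.ofReal_ne_top]
        gcongr
        exact (lintegral_mono_set inter_subset_right).trans (htail ρ hρ0)
    have h1 := hX (c ^ (-σ) * d ^ (-σ)) (by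
      rw [hρσ]
      exact mul_le_of_le_one_left (by positivity)
        (Real.rpow_le_one (by positivity) hPa hr.le))
    rw [hsplit]
    have e1 : 0 ≤ C₃ * (4 * β * N) ^ (p - 1) * c ^ (-σ) * 2 ^ σ * d ^ (-σ) := by positivity
    have e2 : 0 ≤ C₅ * 2 ^ σ * d ^ (-σ) := by positivity
    rw [hρσ] at hfarle
    linarith
  · have hρa : ρ = c * a := by rw [hρ, min_eq_left hda]
    have hρσ : ρ ^ (-σ) = c ^ (-σ) * a ^ (-σ) := by rw [hρa, Real.mul_rpow hc0.le ha0.le]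
    have hfarle : ∫ h in far, spow (p - 1) (f h) * ‖h‖ ^ (-(n + σ)) ≤ C₅ := by
      refine setIntegral_le_of_lintegral_le
        (G := fun h => (min 2 (C₂ * ‖h‖ ^ ((2 * N : ℕ) : ℝ))) ^ (p - 1) * ‖h‖ ^ (-(n + σ))) hfarm
        hC₅0 hfint ?_ (fun h => ?_) (fun h hh => ?_) ?_
      · refine Measurable.mul (Measurable.pow_const ?_ _) (measurable_kernel σ)
        exact measurable_const.min (measurable_const.mul (measurable_norm.pow_const _))
      · have : 0 ≤ min 2 (C₂ * ‖h‖ ^ ((2 * N : ℕ) : ℝ)) := le_min (by norm_num) (by positivity)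
        positivity
      · have hm0 : 0 ≤ min 2 (C₂ * ‖h‖ ^ ((2 * N : ℕ) : ℝ)) :=
          le_min (by norm_num) (by positivity)
        refine mul_le_mul_of_nonneg_right ?_ (by positivity)
        rw [← spow_of_nonneg hr hm0]
        apply spow_mono hr
        refine le_min (abs_le.1 (hf2 h)).2 ?_
        rw [Real.rpow_natCast]
        exact hfar κ hκ y h (by rw [← hρa]; exact hh.2) hN
      · rw [hC₅, ENNReal.ofReal_toReal hmid.ne]
        exact setLIntegral_le_lintegral _ _
    -- The gradient contributes `a^((2N-1)(p-1))`, which absorbs `a^(-σ)` precisely by the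
    -- assumption on `N`.
    have h1 := hX (c ^ (-σ) * 1) (by
      rw [hρσ, mul_left_comm]
      gcongr
      have h2 : a ^ (2 * N) / a = a ^ ((2 * N - 1 : ℝ)) := by
        rw [Real.rpow_sub_one ha0.ne']
        congr 1
        rw [← Real.rpow_natCast]; push_cast; rfl
      rw [h2, ← Real.rpow_mul ha0.le, ← Real.rpow_add ha0]
      exact Real.rpow_le_one ha0.le hy1.le (by linarith))
    rw [hsplit]
    have hY : 0 ≤ C₃ * (4 * β * N) ^ (p - 1) * c ^ (-σ) := by positivity
    have e1 := mul_le_mul_of_nonneg_left h1d hY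
    have e2 := mul_le_mul_of_nonneg_left h1d hC₅0
    have e3 : 0 ≤ 2 ^ (p - 1) * C₄ * c ^ (-σ) * d ^ (-σ) := by positivity
    have e4 : 0 ≤ C₃ * (4 * β * N) ^ (p - 1) * c ^ (-σ) * d ^ (-σ) := by positivity
    linarith

/-- Scaling of truncated integrals against the kernel. -/
lemma setIntegral_tail_scale (F : Eu n → ℝ) (σ ε : ℝ) {R : ℝ} (hR : 0 < R) :
    ∫ h in {h : Eu n | ε < ‖h‖}, F (R⁻¹ • h) * ‖h‖ ^ (-(n + σ)) =
      R ^ (-σ) * ∫ k in {k : Eu n | ε / R < ‖k‖}, F k * ‖k‖ ^ (-(n + σ)) := by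
  rw [← integral_indicator (measurableSet_tail _), ← integral_indicator (measurableSet_tail _)]
  have h1 := Measure.integral_comp_smul (volume : Measure (Eu n))
    ({k : Eu n | ε / R < ‖k‖}.indicator fun k => F k * ‖k‖ ^ (-(n + σ))) R⁻¹
  have hpt : ∀ h : Eu n, ({h : Eu n | ε < ‖h‖}.indicator fun h =>
      F (R⁻¹ • h) * ‖h‖ ^ (-(n + σ))) h = R ^ (-(n + σ)) *
      ({k : Eu n | ε / R < ‖k‖}.indicator fun k => F k * ‖k‖ ^ (-(n + σ))) (R⁻¹ • h) := by
    intro h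
    have hn1 : ‖R⁻¹ • h‖ = ‖h‖ / R := by
      rw [norm_smul, norm_inv, Real.norm_of_nonneg hR.le, inv_mul_eq_div]
    have hiff : ε / R < ‖R⁻¹ • h‖ ↔ ε < ‖h‖ := by
      rw [hn1, div_lt_div_iff_of_pos_right hR]
    simp only [indicator, mem_ofPred_eq, hiff]
    split_ifs
    · rw [hn1, Real.div_rpow (norm_nonneg _) hR.le]
      have : R ^ (-(n + σ)) ≠ 0 := by positivity
      field_simp
    · simp
  simp_rw [hpt]
  rw [integral_const_mul, h1, finrank_euclideanSpace_fin, smul_eq_mul, ← mul_assoc]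
  congr 1
  rw [inv_pow, inv_inv, abs_of_pos (by positivity), ← Real.rpow_natCast, ← Real.rpow_add hR]
  congr 1
  ring

/-- Existence of barriers. -/
lemma exists_barrier {p σ m τ a₂ : ℝ} (hn : 0 < n) (hp : 1 < p) (hσ : 0 < σ) (hσp : σ < p)
    (hm : 1 < m) (hτ : 0 < τ) (ha₂ : 0 < a₂) :
    ∃ K C : ℝ, 0 < K ∧ 0 < C ∧ ∀ R : ℝ, K ≤ R → ∃ w : Eu n → ℝ, Continuous w ∧
      (∀ x, w x ∈ Ioc (-1 : ℝ) 1) ∧ (∀ x, R ≤ ‖x‖ → w x = 1) ∧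
      (∀ x, ‖x‖ ≤ R - K → w x ≤ -1 + a₂) ∧
      (∀ x, ‖x‖ ≤ R → (1 + w x) ^ (m - 1) ≤ C * (1 + R - ‖x‖) ^ (-σ)) ∧
      ∀ x, x ≠ 0 → ‖x‖ < R → ∀ ε : ℝ, 0 < ε →
        ∫ h in {h : Eu n | ε < ‖h‖}, spow (p - 1) (w (x + h) - w x) * ‖h‖ ^ (-(n + σ)) ≤
          τ * (1 + w x) ^ (m - 1) := by
  have hr : 0 < p - 1 := by linarith
  have hm1 : 0 < m - 1 := by linarith
  -- For `p` near `1` the operator is singular where the gradient vanishes; making the profile flat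
  -- to high order at the centre keeps it bounded there.
  obtain ⟨N, hN1, hNσ⟩ : ∃ N : ℕ, N ≠ 0 ∧ σ ≤ (2 * N - 1) * (p - 1) := by
    obtain ⟨N, hN⟩ := exists_nat_ge (σ / (p - 1))
    refine ⟨N + 1, by omega, ?_⟩
    rw [div_le_iff₀ hr] at hN
    have : (N : ℝ) ≤ 2 * ((N + 1 : ℕ) : ℝ) - 1 := by
      push_cast; linarith [(Nat.cast_nonneg N : (0 : ℝ) ≤ N)]
    nlinarith
  -- With this exponent `(1 + w)^(m-1)` is a multiple of `rdist^(-σ)`, the same power that bounds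
  -- the operator.
  set β := σ / (m - 1) with hβ
  have hβ0 : 0 < β := by positivity
  have hβm : β * (m - 1) = σ := by rw [hβ]; field_simp
  obtain ⟨C, hC, hop⟩ := exists_profile_operator_le (n := n) hn hN1 hβ0 hp hσ hσp hNσ
  -- The regularization scale `L`, after rescaling by `R`, multiplies `(1 + w)^(m-1)` by `L^σ` but
  -- leaves the operator bound unchanged; a large `L` therefore yields an arbitrarily small `τ`.
  set L := max 1 ((C / (τ * 2 ^ (m - 1))) ^ σ⁻¹) with hL
  have hL1 : 1 ≤ L := le_max_left _ _
  have hL0 : 0 < L := by linarith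
  have hLσ : C ≤ τ * 2 ^ (m - 1) * L ^ σ := by
    have h1 : C / (τ * 2 ^ (m - 1)) ≤ L ^ σ := by
      calc C / (τ * 2 ^ (m - 1)) = ((C / (τ * 2 ^ (m - 1))) ^ σ⁻¹) ^ σ := by
            rw [← Real.rpow_mul (by positivity), inv_mul_cancel₀ hσ.ne', Real.rpow_one]
        _ ≤ L ^ σ := Real.rpow_le_rpow (by positivity) (le_max_right _ _) hσ.le
    rw [div_le_iff₀ (by positivity)] at h1
    linarith
  -- At depth `K` below the sphere of radius `R` the bound `1 + w ≤ 2 (L / K)^β` is at most `a₂`;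
  -- also `K ≥ L` ensures `κ ≤ 1`.
  set K := max L (L / (a₂ / 2) ^ β⁻¹) with hK
  have hKL : L ≤ K := le_max_left _ _
  have hK0 : 0 < K := by linarith
  refine ⟨K, 2 ^ (m - 1) * L ^ σ, hK0, by positivity, fun R hR => ?_⟩
  have hR0 : 0 < R := by linarith
  set κ := L / R with hκ
  have hκ0 : 0 < κ := by positivity
  have hκ1 : κ ≤ 1 := (div_le_one hR0).2 (by linarith)
  set w : Eu n → ℝ := fun x => profile N β κ (R⁻¹ • x) with hw
  have hnorm : ∀ x : Eu n, ‖R⁻¹ • x‖ = ‖x‖ / R := fun x => by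
    rw [norm_smul, norm_inv, Real.norm_of_nonneg hR0.le, inv_mul_eq_div]
  have hd0 : ∀ x : Eu n, 0 < rdist N κ x := fun x => hκ0.trans_le (le_rdist x)
  have hRd : ∀ x : Eu n, ‖x‖ ≤ R → L + R - ‖x‖ ≤ R * rdist N κ (R⁻¹ • x) := by
    intro x hx
    have h1 : ‖x‖ / R ≤ 1 := (div_le_one hR0).2 hx
    have h2 : (‖x‖ / R) ^ (2 * N) ≤ ‖x‖ / R := pow_le_of_le_one (by positivity) h1 (by omega)
    rw [rdist_eq (by rw [hnorm]; exact h1), hnorm]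
    calc L + R - ‖x‖ = R * (κ + 1 - ‖x‖ / R) := by rw [hκ]; field_simp
      _ ≤ _ := by gcongr
  have hw1 : ∀ x, 1 + w x = 2 * (L / (R * rdist N κ (R⁻¹ • x))) ^ β := by
    intro x
    simp only [hw, profile, hκ, div_div]
    ring
  have hwm : ∀ x, (1 + w x) ^ (m - 1) =
      2 ^ (m - 1) * L ^ σ * (R * rdist N κ (R⁻¹ • x)) ^ (-σ) := by
    intro x
    have h1 : 0 < R * rdist N κ (R⁻¹ • x) := mul_pos hR0 (hd0 _)
    rw [hw1, Real.mul_rpow (by norm_num) (by positivity), ← Real.rpow_mul (by positivity), hβm,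
      Real.div_rpow hL0.le h1.le, Real.rpow_neg h1.le]
    ring
  refine ⟨w, (continuous_profile hκ0).comp (continuous_const_smul _),
    fun x => profile_mem hκ0 hβ0.le _, fun x hx => ?_, fun x hx => ?_, fun x hx => ?_,
    fun x hx0 hx ε hε => ?_⟩
  · exact profile_eq_one hκ0 (by rw [hnorm]; exact (one_le_div hR0).2 hx)
  · have hxR : ‖x‖ ≤ R := by linarith
    have h1 := hRd x hxR
    have h2 : (L / (R * rdist N κ (R⁻¹ • x))) ^ β ≤ a₂ / 2 := by
      calc (L / (R * rdist N κ (R⁻¹ • x))) ^ β ≤ ((a₂ / 2) ^ β⁻¹) ^ β := by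
            apply Real.rpow_le_rpow (by have := hd0 (R⁻¹ • x); positivity) _ hβ0.le
            have h3 : L / (a₂ / 2) ^ β⁻¹ ≤ R * rdist N κ (R⁻¹ • x) :=
              (le_max_right L _).trans (by rw [← hK]; linarith)
            have h4 : 0 < (a₂ / 2) ^ β⁻¹ := by positivity
            rw [div_le_iff₀ h4] at h3
            rw [div_le_iff₀ (mul_pos hR0 (hd0 _))]
            linarith
        _ = a₂ / 2 := by
            rw [← Real.rpow_mul (by positivity), inv_mul_cancel₀ hβ0.ne', Real.rpow_one]
    have := hw1 x
    linarith
  · rw [hwm]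
    gcongr 2 ^ (m - 1) * L ^ σ * ?_
    exact Real.rpow_le_rpow_of_nonpos (by linarith) (by linarith [hRd x hx]) (by linarith)
  · have h1 := setIntegral_tail_scale (fun k => spow (p - 1)
      (profile N β κ (R⁻¹ • x + k) - profile N β κ (R⁻¹ • x))) σ ε hR0
    have h2 : ∀ h : Eu n, profile N β κ (R⁻¹ • x + R⁻¹ • h) = w (x + h) := fun h => by
      rw [← smul_add]
    simp_rw [h2] at h1
    rw [h1, hwm]
    have h3 := hop κ hκ0 hκ1 (R⁻¹ • x) (smul_ne_zero (inv_pos.2 hR0).ne' hx0)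
      (by rw [hnorm]; exact (div_lt_one hR0).2 hx) (ε / R) (by positivity)
    calc _ ≤ R ^ (-σ) * (C * rdist N κ (R⁻¹ • x) ^ (-σ)) := by gcongr
      _ = C * (R * rdist N κ (R⁻¹ • x)) ^ (-σ) := by
          rw [Real.mul_rpow hR0.le (hd0 _).le]; ring
      _ ≤ (τ * 2 ^ (m - 1) * L ^ σ) * (R * rdist N κ (R⁻¹ • x)) ^ (-σ) := by
          have := mul_pos hR0 (hd0 (R⁻¹ • x))
          gcongr
      _ = _ := by ring

/-! ### A nonlocal isoperimetric inequality -/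

/-- The kernel `|h| ^ (-(n + σ))` restricted to `|h| ≥ 1`. -/
def farKernel (σ : ℝ) (h : Eu n) : ℝ≥0∞ :=
  {h : Eu n | 1 ≤ ‖h‖}.indicator (fun h => ENNReal.ofReal (‖h‖ ^ (-(n + σ)))) h

/-- The interaction of two sets through the kernel `farKernel`. -/
def interaction (σ : ℝ) (S T : Set (Eu n)) : ℝ≥0∞ :=
  ∫⁻ x in S, ∫⁻ y in T, farKernel σ (x - y)

/-- The measure of the points of `S` which leave `S` under the translation by `h`. -/
def shiftLoss (S : Set (Eu n)) (h : Eu n) : ℝ≥0∞ := volume (S ∩ (fun x => x + h) ⁻¹' Sᶜ)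

lemma measurable_farKernel (σ : ℝ) : Measurable (farKernel σ : Eu n → ℝ≥0∞) :=
  (ENNReal.measurable_ofReal.comp (measurable_kernel σ)).indicator
    (measurableSet_le measurable_const measurable_norm)

lemma farKernel_neg (σ : ℝ) (h : Eu n) : farKernel σ (-h) = farKernel σ h := by
  simp only [farKernel, indicator, mem_ofPred_eq, norm_neg]

lemma measurableSet_shiftLoss {S : Set (Eu n)} (hS : MeasurableSet S) :
    MeasurableSet {z : Eu n × Eu n | z.1 ∈ S ∧ z.1 + z.2 ∈ Sᶜ} :=
  (measurable_fst hS).inter ((measurable_fst.add measurable_snd) hS.compl)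

lemma shiftLoss_eq_lintegral {S : Set (Eu n)} (hS : MeasurableSet S) (h : Eu n) :
    shiftLoss S h = ∫⁻ x, {z : Eu n × Eu n | z.1 ∈ S ∧ z.1 + z.2 ∈ Sᶜ}.indicator 1 (x, h) := by
  have h1 : MeasurableSet (S ∩ (fun x => x + h) ⁻¹' Sᶜ) :=
    hS.inter ((measurable_add_const h) hS.compl)
  rw [shiftLoss, ← lintegral_indicator_one h1]
  rfl

/-- Tonelli on the set of pairs `(x, h)` with `x ∈ S` and `x + h ∉ S`. It serves both for the
interaction and for integrals of `shiftLoss` over a set of translations. -/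
lemma lintegral_mul_shiftLoss {S : Set (Eu n)} (hS : MeasurableSet S) {F : Eu n → ℝ≥0∞}
    (hF : Measurable F) :
    ∫⁻ h, F h * shiftLoss S h = ∫⁻ x in S, ∫⁻ h in (fun h => x + h) ⁻¹' Sᶜ, F h := by
  have hZ := measurableSet_shiftLoss hS
  have h1 : ∀ h, F h * shiftLoss S h = ∫⁻ x, F h *
      {z : Eu n × Eu n | z.1 ∈ S ∧ z.1 + z.2 ∈ Sᶜ}.indicator 1 (x, h) := by
    intro h
    rw [shiftLoss_eq_lintegral hS, lintegral_const_mul]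
    exact (measurable_one.indicator hZ).comp (measurable_id.prodMk measurable_const)
  simp_rw [h1]
  rw [lintegral_lintegral_swap, ← lintegral_indicator hS]
  · refine lintegral_congr fun x => ?_
    by_cases hx : x ∈ S
    · rw [indicator_of_mem hx, ← lintegral_indicator ((measurable_const_add x) hS.compl)]
      refine lintegral_congr fun h => ?_
      by_cases hh : x + h ∈ Sᶜ
      · have h2 : (x, h) ∈ {z : Eu n × Eu n | z.1 ∈ S ∧ z.1 + z.2 ∈ Sᶜ} := ⟨hx, hh⟩
        have h3 : h ∈ (fun h => x + h) ⁻¹' Sᶜ := hh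
        rw [indicator_of_mem h2, indicator_of_mem h3, Pi.one_apply, mul_one]
      · have h2 : (x, h) ∉ {z : Eu n × Eu n | z.1 ∈ S ∧ z.1 + z.2 ∈ Sᶜ} := fun h2 => hh h2.2
        have h3 : h ∉ (fun h => x + h) ⁻¹' Sᶜ := hh
        rw [indicator_of_notMem h2, indicator_of_notMem h3, mul_zero]
    · rw [indicator_of_notMem hx]
      refine (lintegral_congr fun h => ?_).trans lintegral_zero
      have h2 : (x, h) ∉ {z : Eu n × Eu n | z.1 ∈ S ∧ z.1 + z.2 ∈ Sᶜ} := fun h2 => hx h2.1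
      rw [indicator_of_notMem h2, mul_zero]
  · exact ((hF.comp measurable_fst).mul ((measurable_one.indicator hZ).comp
      measurable_swap)).aemeasurable

lemma interaction_compl_eq {S : Set (Eu n)} (hS : MeasurableSet S) (σ : ℝ) :
    interaction σ S Sᶜ = ∫⁻ h, farKernel σ h * shiftLoss S h := by
  rw [lintegral_mul_shiftLoss hS (measurable_farKernel σ), interaction]
  refine lintegral_congr fun x => ?_
  rw [← lintegral_indicator hS.compl, ← lintegral_indicator ((measurable_const_add x) hS.compl),
    ← lintegral_add_left_eq_self _ x]
  refine lintegral_congr fun h => ?_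
  simp only [indicator, sub_add_cancel_left, farKernel_neg]
  rfl

/-- A point that has left `S` after two steps was outside `S` after the first, or left it during the
second; translation invariance makes the two measures equal. -/
lemma shiftLoss_add_self_le (S : Set (Eu n)) (h : Eu n) :
    shiftLoss S (h + h) ≤ 2 * shiftLoss S h := by
  have hsub : S ∩ (fun x => x + (h + h)) ⁻¹' Sᶜ ⊆ (S ∩ (fun x => x + h) ⁻¹' Sᶜ) ∪
      (fun x => x + h) ⁻¹' (S ∩ (fun x => x + h) ⁻¹' Sᶜ) := by
    rintro x ⟨hx, hx2⟩
    by_cases hxh : x + h ∈ S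
    · refine Or.inr ⟨hxh, ?_⟩
      simpa only [mem_preimage, add_assoc] using hx2
    · exact Or.inl ⟨hx, hxh⟩
  refine (measure_mono hsub).trans ((measure_union_le _ _).trans ?_)
  rw [measure_preimage_add_right, two_mul]
  rfl

lemma shiftLoss_two_pow_smul_le (S : Set (Eu n)) (j : ℕ) (h : Eu n) :
    shiftLoss S ((2 : ℝ) ^ j • h) ≤ 2 ^ j * shiftLoss S h := by
  induction j with
  | zero => simp
  | succ j ih =>
    have h1 : (2 : ℝ) ^ (j + 1) • h = (2 : ℝ) ^ j • h + (2 : ℝ) ^ j • h := by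
      rw [← add_smul, pow_succ, mul_two]
    rw [h1]
    refine (shiftLoss_add_self_le S _).trans ?_
    calc 2 * shiftLoss S ((2 : ℝ) ^ j • h) ≤ 2 * (2 ^ j * shiftLoss S h) := by gcongr
      _ = _ := by rw [pow_succ]; ring

/-- Dyadic shells. -/
def shell (n j : ℕ) : Set (Eu n) := {h : Eu n | (2 : ℝ) ^ j ≤ ‖h‖ ∧ ‖h‖ < 2 ^ (j + 1)}

lemma measurableSet_dyadic_shell (j : ℕ) : MeasurableSet (shell n j) :=
  (measurableSet_le measurable_const measurable_norm).inter
    (measurableSet_lt measurable_norm measurable_const)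

lemma two_pow_smul_mem_shell {i j : ℕ} {h : Eu n} :
    (2 : ℝ) ^ i • h ∈ shell n (i + j) ↔ h ∈ shell n j := by
  have h2 : (0 : ℝ) < 2 ^ i := by positivity
  have hn : ‖(2 : ℝ) ^ i • h‖ = 2 ^ i * ‖h‖ := by
    rw [norm_smul, Real.norm_of_nonneg h2.le]
  simp only [shell, mem_ofPred_eq, hn, pow_add, mul_assoc, mul_le_mul_iff_right₀ h2,
    mul_lt_mul_iff_right₀ h2]

lemma ofReal_two_pow_rpow (i : ℕ) :
    ENNReal.ofReal (((2 : ℝ) ^ i) ^ (-(n : ℝ))) * (2 ^ i) ^ n = 1 := by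
  have h2 : (0 : ℝ) < 2 ^ i := by positivity
  have h3 : ((2 : ℝ≥0∞) ^ i) ^ n = ENNReal.ofReal (((2 : ℝ) ^ i) ^ n) := by
    rw [ENNReal.ofReal_pow h2.le, ENNReal.ofReal_pow (by norm_num)]; simp
  rw [h3, ← ENNReal.ofReal_mul (by positivity), Real.rpow_neg h2.le, Real.rpow_natCast,
    inv_mul_cancel₀ (by positivity), ENNReal.ofReal_one]

lemma volume_shell (i j : ℕ) : volume (shell n (i + j)) = (2 ^ i) ^ n * volume (shell n j) := by
  have h2 : (0 : ℝ) < 2 ^ i := by positivity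
  have h1 := lintegral_comp_smul_eu ((shell n (i + j)).indicator 1) h2
  rw [lintegral_indicator_one (measurableSet_dyadic_shell _)] at h1
  have h3 : ∀ x : Eu n, (shell n (i + j)).indicator (1 : Eu n → ℝ≥0∞) ((2 : ℝ) ^ i • x) =
      (shell n j).indicator 1 x := by
    intro x
    by_cases hx : x ∈ shell n j
    · rw [indicator_of_mem hx, indicator_of_mem (two_pow_smul_mem_shell.2 hx)]
      rfl
    · rw [indicator_of_notMem hx, indicator_of_notMem fun h => hx (two_pow_smul_mem_shell.1 h)]
  simp_rw [h3] at h1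
  rw [lintegral_indicator_one (measurableSet_dyadic_shell _)] at h1
  rw [h1, ← mul_assoc, mul_comm ((2 ^ i) ^ n), ofReal_two_pow_rpow, one_mul]

/-- The factor is `2^(i n)` from the dilation of the shell and `2^i` from the subadditivity of
`shiftLoss`. It carries information from a large scale down to all smaller ones. -/
lemma lintegral_shell_shiftLoss_le (S : Set (Eu n)) (i j : ℕ) :
    ∫⁻ h in shell n (i + j), shiftLoss S h ≤
      (2 ^ i) ^ (n + 1) * ∫⁻ h in shell n j, shiftLoss S h := by
  have h2 : (0 : ℝ) < 2 ^ i := by positivity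
  have h1 := lintegral_comp_smul_eu ((shell n (i + j)).indicator (shiftLoss S)) h2
  rw [lintegral_indicator (measurableSet_dyadic_shell _)] at h1
  have h3 : ∫⁻ x, (shell n (i + j)).indicator (shiftLoss S) ((2 : ℝ) ^ i • x) ≤
      2 ^ i * ∫⁻ h in shell n j, shiftLoss S h := by
    rw [← lintegral_indicator (measurableSet_dyadic_shell _), ← lintegral_const_mul' _ _ (by simp)]
    refine lintegral_mono fun x => ?_
    by_cases hx : x ∈ shell n j
    · rw [indicator_of_mem hx, indicator_of_mem (two_pow_smul_mem_shell.2 hx)]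
      exact shiftLoss_two_pow_smul_le S i x
    · rw [indicator_of_notMem hx, indicator_of_notMem fun h => hx (two_pow_smul_mem_shell.1 h),
        mul_zero]
  rw [h1] at h3
  calc ∫⁻ h in shell n (i + j), shiftLoss S h
      = (2 ^ i) ^ n * (ENNReal.ofReal (((2 : ℝ) ^ i) ^ (-(n : ℝ))) *
          ∫⁻ h in shell n (i + j), shiftLoss S h) := by
        rw [← mul_assoc, mul_comm ((2 ^ i) ^ n), ofReal_two_pow_rpow, one_mul]
    _ ≤ (2 ^ i) ^ n * (2 ^ i * ∫⁻ h in shell n j, shiftLoss S h) := by gcongr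
    _ = _ := by rw [pow_succ]; ring

/-- For each `x ∈ S`, the translations that keep `x` in `S` form a set of measure `volume S`, so
those in `A` that move it out have measure at least the difference. -/
lemma mul_le_lintegral_shiftLoss {S A : Set (Eu n)} (hS : MeasurableSet S) (hA : MeasurableSet A) :
    volume S * (volume A - volume S) ≤ ∫⁻ h in A, shiftLoss S h := by
  have h1 : ∫⁻ h in A, shiftLoss S h = ∫⁻ h, A.indicator 1 h * shiftLoss S h := by
    rw [← lintegral_indicator hA]
    refine lintegral_congr fun h => ?_
    by_cases hh : h ∈ A <;> simp [hh]
  rw [h1, lintegral_mul_shiftLoss hS (measurable_one.indicator hA), mul_comm,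
    ← setLIntegral_const]
  refine lintegral_mono fun x => ?_
  rw [lintegral_indicator_one hA, Measure.restrict_apply hA]
  have h2 : volume ((fun h => x + h) ⁻¹' S) = volume S := measure_preimage_add _ _ _
  rw [← h2]
  refine (le_measure_sdiff).trans (measure_mono ?_)
  exact fun h hh => hh

/-- The dyadic sum `∑_{j ≤ N} 2 ^ (j (1 - σ))`. -/
def dyadicSum (σ : ℝ) (N : ℕ) : ℝ := ∑ j ∈ Finset.range (N + 1), ((2 : ℝ) ^ (1 - σ)) ^ j

lemma dyadicSum_mono (σ : ℝ) {M N : ℕ} (h : M ≤ N) : dyadicSum σ M ≤ dyadicSum σ N :=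
  Finset.sum_le_sum_of_subset_of_nonneg (Finset.range_mono (by omega)) fun _ _ _ => by positivity

lemma one_le_dyadicSum (σ : ℝ) (N : ℕ) : 1 ≤ dyadicSum σ N := by
  refine le_trans ?_ (dyadicSum_mono σ (Nat.zero_le N))
  simp [dyadicSum]

lemma volume_shell_lt_top (j : ℕ) : volume (shell n j) < ∞ :=
  (measure_mono fun _ hh => mem_ball_zero_iff.2 hh.2).trans_lt
    (measure_ball_lt_top (x := (0 : Eu n)) (r := 2 ^ (j + 1)))

lemma volume_shell_zero_pos (hn : 0 < n) : 0 < volume (shell n 0) := by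
  have hopen : IsOpen {h : Eu n | 1 < ‖h‖ ∧ ‖h‖ < 2} :=
    (isOpen_lt continuous_const continuous_norm).inter (isOpen_lt continuous_norm continuous_const)
  have hne : {h : Eu n | 1 < ‖h‖ ∧ ‖h‖ < 2}.Nonempty := by
    refine ⟨EuclideanSpace.single ⟨0, hn⟩ (3 / 2), ?_⟩
    simp only [mem_ofPred_eq, PiLp.norm_single]
    norm_num
  refine (hopen.measure_pos volume hne).trans_le (measure_mono fun h hh => ?_)
  refine ⟨?_, ?_⟩
  · simpa using hh.1.le
  · simpa using hh.2

lemma disjoint_shell {i j : ℕ} (h : i ≠ j) : Disjoint (shell n i) (shell n j) := by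
  rw [Set.disjoint_left]
  rintro x ⟨h1, h2⟩ ⟨h3, h4⟩
  rcases Nat.lt_or_gt_of_ne h with h | h
  · have : (2 : ℝ) ^ (i + 1) ≤ 2 ^ j := pow_le_pow_right₀ (by norm_num) h
    linarith
  · have : (2 : ℝ) ^ (j + 1) ≤ 2 ^ i := pow_le_pow_right₀ (by norm_num) h
    linarith

lemma lintegral_shell_farKernel_ge {σ : ℝ} (hσ : 0 < σ) (S : Set (Eu n)) (j : ℕ) :
    ENNReal.ofReal (((2 : ℝ) ^ (j + 1)) ^ (-(n + σ))) * ∫⁻ h in shell n j, shiftLoss S h ≤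
      ∫⁻ h in shell n j, farKernel σ h * shiftLoss S h := by
  rw [← lintegral_const_mul' _ _ ENNReal.ofReal_ne_top]
  refine setLIntegral_mono' (measurableSet_dyadic_shell j) fun h hh => ?_
  gcongr
  have h1 : (1 : ℝ) ≤ ‖h‖ := (one_le_pow₀ (by norm_num)).trans hh.1
  have h2 : h ∈ {h : Eu n | 1 ≤ ‖h‖} := h1
  rw [farKernel, indicator_of_mem h2]
  apply ENNReal.ofReal_le_ofReal
  refine Real.rpow_le_rpow_of_nonpos (by linarith) hh.2.le ?_
  have : (0 : ℝ) ≤ n := n.cast_nonneg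
  linarith

/-- The nonlocal isoperimetric inequality at the natural scale of the set. -/
lemma interaction_compl_ge_of_volume_le {σ : ℝ} (hσ : 0 < σ) {S : Set (Eu n)}
    (hS : MeasurableSet S) {N : ℕ}
    (hN : volume.real S ≤ volume.real (shell n 0) / 2 * (2 ^ N) ^ n) (hSfin : volume S ≠ ∞) :
    ENNReal.ofReal (volume.real (shell n 0) / 2 * 2 ^ (-(n + σ)) * volume.real S / 2 ^ N *
      dyadicSum σ N) ≤ interaction σ S Sᶜ := by
  set a := volume.real (shell n 0) with ha
  set M := volume.real S with hM
  have ha0 : 0 ≤ a := measureReal_nonneg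
  have hM0 : 0 ≤ M := measureReal_nonneg
  have hvS : volume S = ENNReal.ofReal M := (ofReal_measureReal hSfin).symm
  have hvA : volume (shell n N) = ENNReal.ofReal ((2 ^ N) ^ n * a) := by
    have h1 := volume_shell (n := n) N 0
    rw [add_zero] at h1
    rw [h1, ENNReal.ofReal_mul (by positivity), ha, ofReal_measureReal (volume_shell_lt_top 0).ne,
      ENNReal.ofReal_pow (by positivity), ENNReal.ofReal_pow (by norm_num)]
    simp
  -- At scale `N` the shell has at least twice the volume of `S`, so at least half of its
  -- translations move any given point out of `S`.
  have hbig : ENNReal.ofReal (M * (a / 2 * (2 ^ N) ^ n)) ≤ ∫⁻ h in shell n N, shiftLoss S h := by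
    refine le_trans ?_ (mul_le_lintegral_shiftLoss hS (measurableSet_dyadic_shell N))
    rw [hvS, hvA, ENNReal.ofReal_mul hM0, ← ENNReal.ofReal_sub _ hM0]
    gcongr
    linarith
  -- Going down from scale `N` to scale `j` leaves `M * 2^(-N)` times `2^j` times the kernel weight
  -- `2^(-jσ)`: one term of the dyadic sum.
  have hpiece : ∀ j ∈ Finset.range (N + 1),
      ENNReal.ofReal (a / 2 * 2 ^ (-(n + σ)) * M / 2 ^ N * ((2 : ℝ) ^ (1 - σ)) ^ j) ≤
        ∫⁻ h in shell n j, farKernel σ h * shiftLoss S h := by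
    intro j hj
    obtain ⟨i, rfl⟩ : ∃ i, N = i + j := ⟨N - j, by have := Finset.mem_range.1 hj; omega⟩
    have h2i : (0 : ℝ) < 2 ^ i := by positivity
    have h1 := hbig.trans (lintegral_shell_shiftLoss_le S i j)
    refine le_trans ?_ (lintegral_shell_farKernel_ge hσ S j)
    have h3 : ENNReal.ofReal (((2 : ℝ) ^ i) ^ (n + 1))⁻¹ * (2 ^ i) ^ (n + 1) = 1 := by
      have : ((2 : ℝ≥0∞) ^ i) ^ (n + 1) = ENNReal.ofReal (((2 : ℝ) ^ i) ^ (n + 1)) := by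
        rw [ENNReal.ofReal_pow h2i.le, ENNReal.ofReal_pow (by norm_num)]; simp
      rw [this, ← ENNReal.ofReal_mul (by positivity), inv_mul_cancel₀ (by positivity),
        ENNReal.ofReal_one]
    have h4 : ENNReal.ofReal ((((2 : ℝ) ^ i) ^ (n + 1))⁻¹ * (M * (a / 2 * (2 ^ (i + j)) ^ n))) ≤
        ∫⁻ h in shell n j, shiftLoss S h := by
      rw [ENNReal.ofReal_mul (by positivity)]
      calc _ ≤ ENNReal.ofReal (((2 : ℝ) ^ i) ^ (n + 1))⁻¹ * ((2 ^ i) ^ (n + 1) *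
            ∫⁻ h in shell n j, shiftLoss S h) := by gcongr
        _ = _ := by rw [← mul_assoc, h3, one_mul]
    refine le_trans (le_of_eq ?_) (mul_le_mul_right h4 _)
    rw [← ENNReal.ofReal_mul (by positivity)]
    congr 1
    have e1 : ((2 : ℝ) ^ (j + 1)) ^ (-(n + σ)) =
        2 ^ (-(n + σ)) * (((2 : ℝ) ^ (1 - σ)) ^ j * ((2 ^ j) ^ n)⁻¹ * (2 ^ j)⁻¹) := by
      rw [pow_succ, Real.mul_rpow (by positivity) (by positivity), mul_comm]
      congr 1
      rw [← Real.rpow_natCast, ← Real.rpow_natCast, ← Real.rpow_natCast, ← Real.rpow_mul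
        (by norm_num), ← Real.rpow_mul (by norm_num), ← Real.rpow_mul (by norm_num),
        ← Real.rpow_neg (by norm_num), ← Real.rpow_neg (by norm_num),
        ← Real.rpow_add (by norm_num), ← Real.rpow_add (by norm_num)]
      congr 1
      ring
    rw [e1, pow_add, mul_pow]
    field_simp
    ring
  have hsum : ENNReal.ofReal (a / 2 * 2 ^ (-(n + σ)) * M / 2 ^ N * dyadicSum σ N) =
      ∑ j ∈ Finset.range (N + 1),
        ENNReal.ofReal (a / 2 * 2 ^ (-(n + σ)) * M / 2 ^ N * ((2 : ℝ) ^ (1 - σ)) ^ j) := by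
    rw [dyadicSum, Finset.mul_sum, ENNReal.ofReal_sum_of_nonneg fun _ _ => by positivity]
  rw [hsum, interaction_compl_eq hS]
  calc _ ≤ ∑ j ∈ Finset.range (N + 1), ∫⁻ h in shell n j, farKernel σ h * shiftLoss S h :=
        Finset.sum_le_sum hpiece
    _ = ∫⁻ h in ⋃ j ∈ Finset.range (N + 1), shell n j, farKernel σ h * shiftLoss S h :=
        (lintegral_biUnion_finset (fun i _ j _ hij => disjoint_shell hij)
          (fun j _ => measurableSet_dyadic_shell j) _).symm
    _ ≤ _ := setLIntegral_le_lintegral _ _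

/-- The nonlocal isoperimetric inequality. -/
lemma exists_isoperimetric {σ : ℝ} (hn : 0 < n) (hσ : 0 < σ) :
    ∃ b c : ℝ, 0 < b ∧ 0 < c ∧ ∀ S : Set (Eu n), MeasurableSet S → volume S ≠ ∞ →
      ∀ (N : ℕ) (v : ℝ), 0 ≤ v → v ≤ b * (2 ^ N) ^ n → v ≤ volume.real S →
      ENNReal.ofReal (c * (v / 2 ^ N) * dyadicSum σ N) ≤ interaction σ S Sᶜ := by
  set a := volume.real (shell n 0) with ha
  have ha0 : 0 < a := ENNReal.toReal_pos (volume_shell_zero_pos hn).ne' (volume_shell_lt_top 0).ne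
  refine ⟨a / 2, a / 2 * 2 ^ (-(n + σ)) * (2 ^ n)⁻¹, by positivity, by positivity,
    fun S hS hSfin N v hv hvN hvS => ?_⟩
  set M := volume.real S with hM
  have hM0 : 0 ≤ M := measureReal_nonneg
  -- The true volume of `S` may be too large for scale `N`. The first admissible scale `N' ≥ N` is
  -- used instead; by minimality `M` is then comparable to the volume of that scale, and since `n ≥
  -- 1` the ratio of volume to length does not drop from `N` to `N'` by more than a fixed factor.
  have hex : ∃ N', N ≤ N' ∧ M ≤ a / 2 * (2 ^ N') ^ n := by
    obtain ⟨k, hk⟩ := pow_unbounded_of_one_lt (M / (a / 2)) (by norm_num : (1 : ℝ) < 2)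
    refine ⟨max N k, le_max_left _ _, ?_⟩
    rw [div_lt_iff₀ (by positivity)] at hk
    have h1 : (2 : ℝ) ^ k ≤ (2 ^ max N k) ^ n :=
      (pow_le_pow_right₀ (by norm_num) (le_max_right N k)).trans
        (le_self_pow₀ (one_le_pow₀ (by norm_num)) hn.ne')
    nlinarith
  classical
  set N' := Nat.find hex with hN'
  obtain ⟨hNN', hMN'⟩ := Nat.find_spec hex
  rw [← hN'] at hNN' hMN'
  refine le_trans (ENNReal.ofReal_le_ofReal ?_)
    (interaction_compl_ge_of_volume_le hσ hS hMN' hSfin)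
  rw [← ha, ← hM]
  have hkey : (2 ^ n)⁻¹ * (v / 2 ^ N) ≤ M / 2 ^ N' := by
    rcases eq_or_lt_of_le hNN' with h | h
    · rw [← h]
      have h1 : ((2 : ℝ) ^ n)⁻¹ ≤ 1 := inv_le_one_of_one_le₀ (one_le_pow₀ (by norm_num))
      calc ((2 : ℝ) ^ n)⁻¹ * (v / 2 ^ N) ≤ 1 * (v / 2 ^ N) := by gcongr
        _ ≤ M / 2 ^ N := by rw [one_mul]; gcongr
    · obtain ⟨i, hi⟩ : ∃ i, N' = N + i + 1 := ⟨N' - N - 1, by omega⟩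
      have h1 := Nat.find_min hex (m := N + i) (by rw [← hN']; omega)
      push Not at h1
      have h2 := h1 (by omega)
      rw [hi]
      obtain ⟨k, rfl⟩ : ∃ k, n = k + 1 := ⟨n - 1, by omega⟩
      calc ((2 : ℝ) ^ (k + 1))⁻¹ * (v / 2 ^ N)
          ≤ ((2 : ℝ) ^ (k + 1))⁻¹ * ((a / 2 * (2 ^ N) ^ (k + 1)) / 2 ^ N) := by gcongr
        _ = (2 ^ (k + 1))⁻¹ * (a / 2 * (2 ^ N) ^ k) := by rw [pow_succ (2 ^ N)]; field_simp
        _ ≤ 2⁻¹ * (a / 2 * (2 ^ (N + i)) ^ k) := by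
            gcongr
            · exact le_self_pow₀ (by norm_num) (by omega)
            · norm_num
            · omega
        _ = (a / 2 * (2 ^ (N + i)) ^ (k + 1)) / 2 ^ (N + i + 1) := by
            rw [pow_succ (2 ^ (N + i)), pow_succ 2 (N + i)]; field_simp
        _ ≤ M / 2 ^ (N + i + 1) := by gcongr
  have hd := dyadicSum_mono σ hNN'
  have hd0 : 0 ≤ dyadicSum σ N := zero_le_one.trans (one_le_dyadicSum σ N)
  calc a / 2 * 2 ^ (-(n + σ)) * (2 ^ n)⁻¹ * (v / 2 ^ N) * dyadicSum σ N
      = a / 2 * 2 ^ (-(n + σ)) * ((2 ^ n)⁻¹ * (v / 2 ^ N)) * dyadicSum σ N := by ring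
    _ ≤ a / 2 * 2 ^ (-(n + σ)) * (M / 2 ^ N') * dyadicSum σ N' := by gcongr
    _ = _ := by ring

/-! ### Comparison of the kinetic energies -/

/-- The excess of `u` over `w`. -/
def excess (u w : Eu n → ℝ) (x : Eu n) : ℝ := max (u x - w x) 0

lemma excess_nonneg (u w : Eu n → ℝ) (x : Eu n) : 0 ≤ excess u w x := le_max_right _ _

lemma excess_eq_sub_min (u w : Eu n → ℝ) (x : Eu n) : excess u w x = u x - min (u x) (w x) := by
  unfold excess
  rcases le_total (u x) (w x) with h | h
  · rw [min_eq_left h, max_eq_right (by linarith), sub_self]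
  · rw [min_eq_right h, max_eq_left (by linarith)]

lemma excess_eq_zero {u w : Eu n → ℝ} {x : Eu n} (h : u x ≤ w x) : excess u w x = 0 :=
  max_eq_right (by linarith)

/-- If exactly one of the points lies in `{u > w}`, replacing `w` by `min u w` lowers the value at
the other point, so the difference moves in the same direction as the excess difference. In the
other cases the two sides agree. -/
lemma spow_mul_excess_le {r : ℝ} (hr : 0 < r) (u w : Eu n → ℝ) (x y : Eu n) :
    spow r (w x - w y) * (excess u w x - excess u w y) ≤
      spow r (min (u x) (w x) - min (u y) (w y)) * (excess u w x - excess u w y) := by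
  have hx0 := excess_nonneg u w x
  have hy0 := excess_nonneg u w y
  rcases le_total (u x) (w x) with hx | hx <;> rcases le_total (u y) (w y) with hy | hy
  · rw [excess_eq_zero hx, excess_eq_zero hy]; simp
  · rw [excess_eq_zero hx, min_eq_left hx, min_eq_right hy]
    exact mul_le_mul_of_nonpos_right (spow_mono hr (by linarith)) (by linarith)
  · rw [excess_eq_zero hy, min_eq_right hx, min_eq_left hy]
    exact mul_le_mul_of_nonneg_right (spow_mono hr (by linarith)) (by linarith)
  · rw [min_eq_right hx, min_eq_right hy]

/-- The pointwise convexity inequality behind the comparison. -/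
lemma abs_min_sub_rpow_le {p c a₁ : ℝ} (hp : 1 < p)
    (hgap : ∀ a b : ℝ, |a| ≤ 2 → |b| ≤ 2 → a₁ ≤ |a - b| →
      |b| ^ p + p * spow (p - 1) b * (a - b) + c ≤ |a| ^ p)
    {u w : Eu n → ℝ} (hu : ∀ x, |u x| ≤ 1) (hw : ∀ x, |w x| ≤ 1) (x y : Eu n) :
    |min (u x) (w x) - min (u y) (w y)| ^ p +
      p * spow (p - 1) (w x - w y) * (excess u w x - excess u w y) +
      {z : Eu n × Eu n | a₁ ≤ |excess u w z.1 - excess u w z.2|}.indicator (fun _ => c) (x, y) ≤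
      |u x - u y| ^ p := by
  have hr : 0 < p - 1 := by linarith
  set a := u x - u y
  set b := min (u x) (w x) - min (u y) (w y)
  have hab : a - b = excess u w x - excess u w y := by
    rw [excess_eq_sub_min, excess_eq_sub_min]; simp only [a, b]; ring
  have h1 := spow_mul_excess_le hr u w x y
  rw [← hab] at h1 ⊢
  have h1' : p * spow (p - 1) (w x - w y) * (a - b) ≤ p * spow (p - 1) b * (a - b) := by
    rw [mul_assoc, mul_assoc]
    exact mul_le_mul_of_nonneg_left h1 (by linarith)
  have hmin : ∀ x, |min (u x) (w x)| ≤ 1 := fun x => by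
    rcases min_choice (u x) (w x) with h | h <;> rw [h]
    · exact hu x
    · exact hw x
  by_cases hz : (x, y) ∈ {z : Eu n × Eu n | a₁ ≤ |excess u w z.1 - excess u w z.2|}
  · rw [indicator_of_mem hz]
    have h2 : a₁ ≤ |a - b| := by rw [hab]; exact hz
    have h3 := hgap a b
      ((abs_sub _ _).trans (by linarith [hu x, hu y]))
      ((abs_sub _ _).trans (by linarith [hmin x, hmin y])) h2
    linarith
  · rw [indicator_of_notMem hz]
    have h3 := abs_rpow_tangent_le hp a b
    linarith

/-- The measure on pairs of points which underlies the kinetic energy in `Ω`. -/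
def pairMeasure (Ω : Set (Eu n)) : Measure (Eu n × Eu n) :=
  (1 / 2 : ℝ≥0∞) • (volume : Measure (Eu n × Eu n)).restrict (Ω ×ˢ Ω) +
    (volume : Measure (Eu n × Eu n)).restrict (Ω ×ˢ Ωᶜ)

lemma measurable_gagliardo (s p : ℝ) {u : Eu n → ℝ} (hu : Measurable u) :
    Measurable fun z : Eu n × Eu n => gagliardo s p u z.1 z.2 := by
  unfold gagliardo
  refine ENNReal.measurable_ofReal.comp (Measurable.div ?_ ?_)
  · exact ((hu.comp measurable_fst).sub (hu.comp measurable_snd)).norm.pow_const p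
  · exact (measurable_fst.sub measurable_snd).norm.pow_const _

lemma lintegral_prod_restrict_eq (A B : Set (Eu n)) {F : Eu n × Eu n → ℝ≥0∞}
    (hF : Measurable F) :
    ∫⁻ z in A ×ˢ B, F z = ∫⁻ x in A, ∫⁻ y in B, F (x, y) := by
  rw [Measure.volume_eq_prod, ← Measure.prod_restrict, lintegral_prod _ hF.aemeasurable]

lemma lintegral_pairMeasure (Ω : Set (Eu n)) (F : Eu n × Eu n → ℝ≥0∞) :
    ∫⁻ z, F z ∂pairMeasure Ω = (1 / 2) * (∫⁻ z in Ω ×ˢ Ω, F z) + ∫⁻ z in Ω ×ˢ Ωᶜ, F z := by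
  rw [pairMeasure, lintegral_add_measure, lintegral_smul_measure, smul_eq_mul]

lemma kinetic_eq_lintegral (s p : ℝ) {u : Eu n → ℝ} (hu : Measurable u) (Ω : Set (Eu n)) :
    kinetic s p u Ω = ∫⁻ z, gagliardo s p u z.1 z.2 ∂pairMeasure Ω := by
  have h := measurable_gagliardo s p hu
  rw [lintegral_pairMeasure, lintegral_prod_restrict_eq _ _ h, lintegral_prod_restrict_eq _ _ h,
    kinetic]

lemma lintegral_prod_swap_symm (A B : Set (Eu n)) {F : Eu n × Eu n → ℝ≥0∞} (hF : Measurable F)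
    (hsymm : ∀ x y, F (x, y) = F (y, x)) : ∫⁻ z in A ×ˢ B, F z = ∫⁻ z in B ×ˢ A, F z := by
  rw [lintegral_prod_restrict_eq _ _ hF, lintegral_prod_restrict_eq _ _ hF,
    lintegral_lintegral_swap (f := fun x y => F (x, y)) hF.aemeasurable]
  exact lintegral_congr fun y => lintegral_congr fun x => hsymm x y

/-- The high superlevel lies in `Ω` and the complement of `Ω` in the low sublevel. Pairs inside `Ω`
occur in both orders, which compensates the factor `1/2`; pairs with one point outside are counted
once with full weight. -/
lemma interaction_le_lintegral_pairMeasure {σ a₁ : ℝ} (ha₁ : 0 < a₁) {η : Eu n → ℝ}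
    (hη : Measurable η) {Ω : Set (Eu n)} (hΩ : MeasurableSet Ω) (hηΩ : ∀ x, x ∉ Ω → η x = 0) :
    interaction σ {x | 2 * a₁ ≤ η x} {x | η x ≤ a₁} ≤
      ∫⁻ z, {z : Eu n × Eu n | a₁ ≤ |η z.1 - η z.2|}.indicator
        (fun z => farKernel σ (z.1 - z.2)) z ∂pairMeasure Ω := by
  set S := {x | 2 * a₁ ≤ η x}
  set T := {x | η x ≤ a₁}
  have hS : MeasurableSet S := measurableSet_le measurable_const hη
  have hT : MeasurableSet T := measurableSet_le hη measurable_const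
  set D := {z : Eu n × Eu n | a₁ ≤ |η z.1 - η z.2|}
  have hD : MeasurableSet D := measurableSet_le measurable_const
    ((hη.comp measurable_fst).sub (hη.comp measurable_snd)).norm
  set F : Eu n × Eu n → ℝ≥0∞ := D.indicator fun z => farKernel σ (z.1 - z.2)
  have hk : Measurable fun z : Eu n × Eu n => farKernel σ (z.1 - z.2) :=
    (measurable_farKernel σ).comp (measurable_fst.sub measurable_snd)
  have hF : Measurable F := hk.indicator hD
  have hFsymm : ∀ x y, F (x, y) = F (y, x) := by
    intro x y
    have h1 : (x, y) ∈ D ↔ (y, x) ∈ D := by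
      simp only [D, mem_ofPred_eq]
      rw [abs_sub_comm]
    by_cases h : (x, y) ∈ D
    · simp only [F, indicator_of_mem h, indicator_of_mem (h1.1 h)]
      rw [← farKernel_neg, neg_sub]
    · simp only [F, indicator_of_notMem h, indicator_of_notMem fun h' => h (h1.2 h')]
  have hSΩ : S ⊆ Ω := by
    intro x hx
    by_contra hxΩ
    have h1 : 2 * a₁ ≤ η x := hx
    rw [hηΩ x hxΩ] at h1
    linarith
  have hΩT : Ωᶜ ⊆ T := fun x hx => show η x ≤ a₁ by rw [hηΩ x hx]; exact ha₁.le
  have hST : ∀ {B : Set (Eu n)}, B ⊆ T → MeasurableSet B →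
      ∫⁻ x in S, ∫⁻ y in B, farKernel σ (x - y) = ∫⁻ z in S ×ˢ B, F z := by
    intro B hB hBm
    rw [← lintegral_prod_restrict_eq S B hk]
    refine setLIntegral_congr_fun (hS.prod hBm) fun z hz => ?_
    have h1 : 2 * a₁ ≤ η z.1 := hz.1
    have h2 : η z.2 ≤ a₁ := hB hz.2
    have h3 : z ∈ D := show a₁ ≤ |η z.1 - η z.2| from le_trans (by linarith) (le_abs_self _)
    simp only [F, indicator_of_mem h3]
  have hdisj : Disjoint (S ×ˢ (T ∩ Ω)) ((T ∩ Ω) ×ˢ S) := by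
    rw [Set.disjoint_left]
    rintro ⟨x, y⟩ ⟨h1, -⟩ ⟨⟨h2, -⟩, -⟩
    have h1' : 2 * a₁ ≤ η x := h1
    have h2' : η x ≤ a₁ := h2
    linarith
  have hsplit : interaction σ S T = (∫⁻ z in S ×ˢ (T ∩ Ω), F z) + ∫⁻ z in S ×ˢ Ωᶜ, F z := by
    rw [← hST inter_subset_left (hT.inter hΩ), ← hST hΩT hΩ.compl, interaction,
      ← lintegral_add_left]
    · refine lintegral_congr fun x => ?_
      have h1 : T ∩ Ωᶜ = Ωᶜ := inter_eq_right.2 hΩT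
      have h2 := lintegral_inter_add_sdiff (μ := volume) (fun y => farKernel σ (x - y)) T hΩ
      rw [sdiff_eq, h1] at h2
      exact h2.symm
    · exact Measurable.lintegral_prod_right' (f := fun z : Eu n × Eu n => farKernel σ (z.1 - z.2)) hk
  rw [hsplit, lintegral_pairMeasure]
  gcongr
  · have h1 : (∫⁻ z in S ×ˢ (T ∩ Ω), F z) + ∫⁻ z in (T ∩ Ω) ×ˢ S, F z ≤ ∫⁻ z in Ω ×ˢ Ω, F z := by
      rw [← lintegral_union ((hT.inter hΩ).prod hS) hdisj]
      refine lintegral_mono_set (union_subset ?_ ?_)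
      · exact prod_mono hSΩ inter_subset_right
      · exact prod_mono inter_subset_right hSΩ
    rw [lintegral_prod_swap_symm (T ∩ Ω) S hF hFsymm, ← two_mul] at h1
    calc ∫⁻ z in S ×ˢ (T ∩ Ω), F z = (1 / 2) * (2 * ∫⁻ z in S ×ˢ (T ∩ Ω), F z) := by
          rw [← mul_assoc, one_div, ENNReal.inv_mul_cancel (by norm_num) (by norm_num), one_mul]
      _ ≤ _ := by gcongr

/-! ### Truncated kernels and the first-order term. -/

/-- The kernel `|h| ^ (-(n + σ))` restricted to `|h| > ε`. -/
def truncKernel (σ ε : ℝ) (h : Eu n) : ℝ :=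
  {h : Eu n | ε < ‖h‖}.indicator (fun h => ‖h‖ ^ (-(n + σ))) h

lemma measurable_truncKernel (σ ε : ℝ) : Measurable (truncKernel σ ε : Eu n → ℝ) :=
  (measurable_kernel σ).indicator (measurableSet_tail ε)

lemma truncKernel_nonneg (σ ε : ℝ) (h : Eu n) : 0 ≤ truncKernel σ ε h :=
  indicator_nonneg (fun _ _ => by positivity) h

lemma truncKernel_neg (σ ε : ℝ) (h : Eu n) : truncKernel σ ε (-h) = truncKernel σ ε h := by
  simp only [truncKernel, indicator, mem_ofPred_eq, norm_neg]

lemma integrable_truncKernel {σ ε : ℝ} (hσ : 0 < σ) (hε : 0 < ε) :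
    Integrable (truncKernel σ ε : Eu n → ℝ) :=
  (integrable_indicator_iff (measurableSet_tail ε)).2 (integrableOn_tail_kernel hσ hε)

lemma measurable_truncKernel_sub (σ ε : ℝ) :
    Measurable fun z : Eu n × Eu n => truncKernel σ ε (z.1 - z.2) :=
  (measurable_truncKernel σ ε).comp (measurable_fst.sub measurable_snd)

/-- Absolute integrability is what allows the first-order term to be split into two non-symmetric
halves; this is the reason for truncating. -/
lemma integrableOn_truncKernel_prod {σ ε : ℝ} (hσ : 0 < σ) (hε : 0 < ε) {Ω : Set (Eu n)}
    (hΩ : volume Ω ≠ ∞) :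
    IntegrableOn (fun z : Eu n × Eu n => truncKernel σ ε (z.1 - z.2)) (Ω ×ˢ univ) := by
  rw [IntegrableOn, Measure.volume_eq_prod, ← Measure.prod_restrict, Measure.restrict_univ,
    integrable_prod_iff (measurable_truncKernel_sub σ ε).aestronglyMeasurable]
  refine ⟨Filter.Eventually.of_forall fun x =>
    (integrable_truncKernel hσ hε).comp_sub_left x, ?_⟩
  have h1 : ∀ x : Eu n, ∫ y, ‖truncKernel σ ε (x - y)‖ = ∫ y : Eu n, ‖truncKernel σ ε y‖ :=
    fun x => integral_sub_left_eq_self (fun y : Eu n => ‖truncKernel σ ε y‖) volume x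
  simp_rw [h1]
  have : IsFiniteMeasure ((volume : Measure (Eu n)).restrict Ω) := isFiniteMeasure_restrict.2 hΩ
  exact integrable_const _

lemma integral_truncKernel_sub (F : Eu n → ℝ) (σ ε : ℝ) (x : Eu n) :
    ∫ y, F y * truncKernel σ ε (x - y) =
      ∫ h in {h : Eu n | ε < ‖h‖}, F (x + h) * ‖h‖ ^ (-(n + σ)) := by
  rw [← integral_indicator (measurableSet_tail ε), ← integral_add_left_eq_self _ x]
  refine integral_congr_ae (Filter.Eventually.of_forall fun h => ?_)
  simp only [sub_add_cancel_left, truncKernel_neg]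
  by_cases hh : h ∈ {h : Eu n | ε < ‖h‖}
  · rw [truncKernel, indicator_of_mem hh, indicator_of_mem hh]
  · rw [truncKernel, indicator_of_notMem hh, indicator_of_notMem hh, mul_zero]

/-- The first order term of the comparison, in the truncated setting. -/
lemma integrable_and_integral_firstOrder_le {p σ ε R : ℝ} (hn : 0 < n) (hp : 1 < p) (hσ : 0 < σ)
    (hε : 0 < ε) {u w B : Eu n → ℝ} (hu : Measurable u) (hu1 : ∀ x, |u x| ≤ 1)
    (hw : Measurable w) (hw1 : ∀ x, |w x| ≤ 1) (hwR : ∀ x, R ≤ ‖x‖ → w x = 1)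
    {Ω : Set (Eu n)} (hΩ : MeasurableSet Ω) (hΩfin : volume Ω ≠ ∞) (hRΩ : Metric.ball 0 R ⊆ Ω)
    (hBi : IntegrableOn (fun x => excess u w x * B x) Ω)
    (hop : ∀ x, x ≠ 0 → ‖x‖ < R →
      ∫ h in {h : Eu n | ε < ‖h‖}, spow (p - 1) (w (x + h) - w x) * ‖h‖ ^ (-(n + σ)) ≤ B x) :
    Integrable (fun z : Eu n × Eu n => p * spow (p - 1) (w z.2 - w z.1) *
        (excess u w z.1 - excess u w z.2) * truncKernel σ ε (z.1 - z.2)) (pairMeasure Ω) ∧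
      ∫ z, p * spow (p - 1) (w z.2 - w z.1) *
        (excess u w z.1 - excess u w z.2) * truncKernel σ ε (z.1 - z.2) ∂pairMeasure Ω ≤
        p * ∫ x in Ω, excess u w x * B x := by
  have hr : 0 < p - 1 := by linarith
  set η := excess u w with hη
  have hη0 : ∀ x, 0 ≤ η x := excess_nonneg u w
  have hηm : Measurable η := (hu.sub hw).max measurable_const
  have hη2 : ∀ x, η x ≤ 2 := fun x => max_le
    (by linarith [(abs_le.1 (hu1 x)).2, (abs_le.1 (hw1 x)).1]) (by norm_num)
  have hηR : ∀ x, R ≤ ‖x‖ → η x = 0 := fun x hx =>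
    excess_eq_zero (by rw [hwR x hx]; exact (abs_le.1 (hu1 x)).2)
  have hηΩ : ∀ x, x ∉ Ω → η x = 0 := fun x hx => hηR x (by
    by_contra h
    exact hx (hRΩ (mem_ball_zero_iff.2 (not_le.1 h))))
  set Y : Eu n × Eu n → ℝ := fun z =>
    (p * η z.1 * spow (p - 1) (w z.2 - w z.1)) * truncKernel σ ε (z.1 - z.2) with hY
  set Z : Eu n × Eu n → ℝ := fun z => p * spow (p - 1) (w z.2 - w z.1) *
        (η z.1 - η z.2) * truncKernel σ ε (z.1 - z.2) with hZ
  have hspm : Measurable fun z : Eu n × Eu n => spow (p - 1) (w z.2 - w z.1) :=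
    (continuous_spow hr).measurable.comp ((hw.comp measurable_snd).sub (hw.comp measurable_fst))
  have hsp2 : ∀ x y, |spow (p - 1) (w y - w x)| ≤ 2 ^ (p - 1) := fun x y => by
    rw [abs_spow hr]
    exact Real.rpow_le_rpow (abs_nonneg _)
      ((abs_sub _ _).trans (by linarith [hw1 x, hw1 y])) hr.le
  have hYi : IntegrableOn Y (Ω ×ˢ univ) := by
    refine (integrableOn_truncKernel_prod hσ hε hΩfin).bdd_mul (c := p * 2 * 2 ^ (p - 1)) ?_ ?_
    · exact ((measurable_const.mul (hηm.comp measurable_fst)).mul hspm).aestronglyMeasurable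
    · refine Filter.Eventually.of_forall fun z => ?_
      rw [Real.norm_eq_abs, abs_mul, abs_mul, abs_of_nonneg (hη0 _),
        abs_of_pos (by linarith : 0 < p)]
      gcongr
      · exact hη2 _
      · exact hsp2 _ _
  -- Discrete integration by parts: in `Ω ×ˢ Ω` the two halves have equal integrals and cancel the
  -- `1/2`, while in `Ω ×ˢ Ωᶜ` the second half vanishes with the excess. What remains is `Y` over `Ω
  -- ×ˢ univ`, that is, the operator of `w` tested against the excess.
  have hZY : ∀ z, Z z = Y z + Y z.swap := by
    intro z
    have h1 : spow (p - 1) (w z.1 - w z.2) = -spow (p - 1) (w z.2 - w z.1) := by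
      rw [← spow_neg, neg_sub]
    have h2 : truncKernel σ ε (z.2 - z.1) = truncKernel σ ε (z.1 - z.2) := by
      rw [← truncKernel_neg, neg_sub]
    simp only [hZ, hY, Prod.fst_swap, Prod.snd_swap, h1, h2]
    ring
  have hY1 : IntegrableOn Y (Ω ×ˢ Ω) := hYi.mono_set (prod_mono le_rfl (subset_univ _))
  have hY2 : IntegrableOn Y (Ω ×ˢ Ωᶜ) := hYi.mono_set (prod_mono le_rfl (subset_univ _))
  have hYs : IntegrableOn (fun z => Y z.swap) (Ω ×ˢ Ω) := by
    rw [IntegrableOn, Measure.volume_eq_prod, ← Measure.prod_restrict] at hY1 ⊢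
    exact hY1.swap
  have hYsw : ∫ z in Ω ×ˢ Ω, Y z.swap = ∫ z in Ω ×ˢ Ω, Y z := by
    rw [Measure.volume_eq_prod, ← Measure.prod_restrict]
    exact integral_prod_swap Y
  have hZ1 : IntegrableOn Z (Ω ×ˢ Ω) := by
    have := hY1.add hYs
    exact this.congr (Filter.Eventually.of_forall fun z => (hZY z).symm)
  have hZeq2 : EqOn Z Y (Ω ×ˢ Ωᶜ) := by
    intro z hz
    simp only [hZ, hY, hηΩ z.2 hz.2]
    ring
  have hm2 : MeasurableSet (Ω ×ˢ Ωᶜ) := hΩ.prod hΩ.compl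
  have hZ2 : IntegrableOn Z (Ω ×ˢ Ωᶜ) := hY2.congr_fun hZeq2.symm hm2
  have hZ1' : Integrable Z ((1 / 2 : ℝ≥0∞) • (volume : Measure (Eu n × Eu n)).restrict (Ω ×ˢ Ω)) :=
    hZ1.smul_measure (by simp)
  refine ⟨hZ1'.add_measure hZ2, ?_⟩
  have hint1 : ∫ z in Ω ×ˢ Ω, Z z = 2 * ∫ z in Ω ×ˢ Ω, Y z := by
    rw [integral_congr_ae (Filter.Eventually.of_forall hZY), integral_add hY1 hYs, hYsw]
    ring
  have hint2 : ∫ z in Ω ×ˢ Ωᶜ, Z z = ∫ z in Ω ×ˢ Ωᶜ, Y z := setIntegral_congr_fun hm2 hZeq2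
  have hint : ∫ z, Z z ∂pairMeasure Ω = ∫ z in Ω ×ˢ univ, Y z := by
    rw [pairMeasure, integral_add_measure hZ1' hZ2, integral_smul_measure, hint1, hint2,
      ← union_compl_self Ω, prod_union, setIntegral_union _ hm2 hY1 hY2]
    · simp
    · exact Set.disjoint_prod.2 (Or.inr disjoint_compl_right)
  change ∫ z, Z z ∂pairMeasure Ω ≤ _
  rw [hint]
  rw [IntegrableOn, Measure.volume_eq_prod, ← Measure.prod_restrict, Measure.restrict_univ] at hYi
  rw [Measure.volume_eq_prod, ← Measure.prod_restrict, Measure.restrict_univ, integral_prod _ hYi,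
    ← integral_const_mul]
  refine integral_mono_ae hYi.integral_prod_left (hBi.const_mul p) ?_
  -- The operator bound is not assumed at the centre of the barrier, a single point.
  have hne : ∀ᵐ x : Eu n, x ≠ 0 := by
    have : Nonempty (Fin n) := ⟨⟨0, hn⟩⟩
    exact Measure.ae_ne _ _
  refine ae_restrict_of_ae (hne.mono fun x hx0 => ?_)
  have h1 : ∫ y, Y (x, y) = p * η x *
      ∫ h in {h : Eu n | ε < ‖h‖}, spow (p - 1) (w (x + h) - w x) * ‖h‖ ^ (-(n + σ)) := by
    rw [← integral_truncKernel_sub (fun y => spow (p - 1) (w y - w x)), ← integral_const_mul]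
    refine integral_congr_ae (Filter.Eventually.of_forall fun y => ?_)
    simp only [hY]
    ring
  simp only [h1]
  rcases lt_or_ge ‖x‖ R with hx | hx
  · have h2 := mul_le_mul_of_nonneg_left (hop x hx0 hx)
      (mul_nonneg (by linarith : 0 ≤ p) (hη0 x))
    linarith
  · rw [hηR x hx]; simp

lemma gagliardo_eq (s p : ℝ) (u : Eu n → ℝ) (x y : Eu n) :
    gagliardo s p u x y = ENNReal.ofReal (|u x - u y| ^ p * ‖x - y‖ ^ (-(n + s * p))) := by
  rw [gagliardo, Real.rpow_neg (norm_nonneg _), div_eq_mul_inv]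

lemma gagliardo_self {p : ℝ} (hp : 1 < p) (s : ℝ) (u : Eu n → ℝ) (x : Eu n) :
    gagliardo s p u x x = 0 := by
  rw [gagliardo, sub_self, abs_zero, Real.zero_rpow (by linarith), zero_div, ENNReal.ofReal_zero]

lemma ofReal_mul_truncKernel (s p ε : ℝ) (u : Eu n → ℝ) (z : Eu n × Eu n) :
    ENNReal.ofReal (|u z.1 - u z.2| ^ p * truncKernel (s * p) ε (z.1 - z.2)) =
      {z : Eu n × Eu n | ε < ‖z.1 - z.2‖}.indicator (fun z => gagliardo s p u z.1 z.2) z := by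
  by_cases hz : ε < ‖z.1 - z.2‖
  · have h1 : z ∈ {z : Eu n × Eu n | ε < ‖z.1 - z.2‖} := hz
    have h2 : z.1 - z.2 ∈ {h : Eu n | ε < ‖h‖} := hz
    rw [indicator_of_mem h1, gagliardo_eq, truncKernel, indicator_of_mem h2]
  · have h1 : z ∉ {z : Eu n × Eu n | ε < ‖z.1 - z.2‖} := hz
    have h2 : z.1 - z.2 ∉ {h : Eu n | ε < ‖h‖} := hz
    rw [indicator_of_notMem h1, truncKernel, indicator_of_notMem h2, mul_zero, ENNReal.ofReal_zero]

/-- The kinetic energy is the supremum of its truncations. -/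
lemma lintegral_gagliardo_eq_iSup {p : ℝ} (hp : 1 < p) (s : ℝ) {u : Eu n → ℝ} (hu : Measurable u)
    (μ : Measure (Eu n × Eu n)) :
    ∫⁻ z, gagliardo s p u z.1 z.2 ∂μ = ⨆ k : ℕ, ∫⁻ z,
      {z : Eu n × Eu n | 1 / ((k : ℝ) + 2) < ‖z.1 - z.2‖}.indicator
        (fun z => gagliardo s p u z.1 z.2) z ∂μ := by
  rw [← lintegral_iSup]
  · refine lintegral_congr fun z => le_antisymm ?_ (iSup_le fun k => indicator_le_self _ _ _)
    rcases eq_or_ne z.1 z.2 with h | h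
    · rw [h, gagliardo_self hp]
      exact zero_le
    · have hpos : 0 < ‖z.1 - z.2‖ := norm_pos_iff.2 (sub_ne_zero.2 h)
      obtain ⟨k, hk⟩ := exists_nat_one_div_lt hpos
      refine le_iSup_of_le k ?_
      have hz : z ∈ {z : Eu n × Eu n | 1 / ((k : ℝ) + 2) < ‖z.1 - z.2‖} := by
        refine lt_of_le_of_lt ?_ hk
        gcongr
        norm_num
      rw [indicator_of_mem hz]
  · intro k
    exact (measurable_gagliardo s p hu).indicator
      (measurableSet_lt measurable_const (measurable_fst.sub measurable_snd).norm)
  · intro k l hkl z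
    refine indicator_le_indicator_of_subset (fun z hz => ?_) (fun _ => zero_le) z
    have hz' : 1 / ((k : ℝ) + 2) < ‖z.1 - z.2‖ := hz
    have hkl' : (k : ℝ) ≤ l := by exact_mod_cast hkl
    have h1 : 1 / ((l : ℝ) + 2) ≤ 1 / ((k : ℝ) + 2) := by gcongr
    exact h1.trans_lt hz'

/-- Comparison of the kinetic energies of `u` and `min u w`. -/
lemma kinetic_min_add_interaction_le {s p R c a₁ : ℝ} (hn : 0 < n) (hp : 1 < p) (hs : 0 < s)
    (hc : 0 < c) (ha₁ : 0 < a₁)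
    (hgap : ∀ a b : ℝ, |a| ≤ 2 → |b| ≤ 2 → a₁ ≤ |a - b| →
      |b| ^ p + p * spow (p - 1) b * (a - b) + c ≤ |a| ^ p)
    {u w B : Eu n → ℝ} (hu : Measurable u) (hu1 : ∀ x, |u x| ≤ 1)
    (hw : Measurable w) (hw1 : ∀ x, |w x| ≤ 1) (hwR : ∀ x, R ≤ ‖x‖ → w x = 1)
    {Ω : Set (Eu n)} (hΩ : MeasurableSet Ω) (hΩfin : volume Ω ≠ ∞) (hRΩ : Metric.ball 0 R ⊆ Ω)
    (hBi : IntegrableOn (fun x => excess u w x * B x) Ω)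
    (hop : ∀ x, x ≠ 0 → ‖x‖ < R → ∀ ε : ℝ, 0 < ε →
      ∫ h in {h : Eu n | ε < ‖h‖}, spow (p - 1) (w (x + h) - w x) * ‖h‖ ^ (-(n + s * p)) ≤ B x)
    (hfin : kinetic s p u Ω < ∞) :
    kinetic s p (fun x => min (u x) (w x)) Ω + ENNReal.ofReal c *
      interaction (s * p) {x | 2 * a₁ ≤ excess u w x} {x | excess u w x ≤ a₁} ≤
      kinetic s p u Ω + ENNReal.ofReal (p * ∫ x in Ω, excess u w x * B x) := by
  set v : Eu n → ℝ := fun x => min (u x) (w x) with hv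
  have hvm : Measurable v := hu.min hw
  set σ := s * p with hσ'
  have hσ : 0 < σ := by positivity
  set η := excess u w with hη
  have hηm : Measurable η := (hu.sub hw).max measurable_const
  have hηΩ : ∀ x, x ∉ Ω → η x = 0 := fun x hx => excess_eq_zero (by
    have : R ≤ ‖x‖ := by
      by_contra h
      exact hx (hRΩ (mem_ball_zero_iff.2 (not_le.1 h)))
    rw [hwR x this]; exact (abs_le.1 (hu1 x)).2)
  set D := {z : Eu n × Eu n | a₁ ≤ |η z.1 - η z.2|} with hD
  have hDm : MeasurableSet D := measurableSet_le measurable_const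
    ((hηm.comp measurable_fst).sub (hηm.comp measurable_snd)).norm
  rw [kinetic_eq_lintegral s p hu] at hfin ⊢
  rw [kinetic_eq_lintegral s p hvm, lintegral_gagliardo_eq_iSup hp s hvm, ENNReal.iSup_add]
  refine iSup_le fun k => ?_
  -- The shift by `2` gives `ε < 1` for every `k`, so the truncated kernel dominates the far kernel.
  -- The right-hand side does not depend on `k`, and only the energy of `min u w` has to be
  -- recovered as a supremum.
  set ε : ℝ := 1 / ((k : ℝ) + 2) with hε'
  have hε : 0 < ε := by positivity
  have hε1 : ε < 1 := by
    rw [hε', div_lt_one (by positivity)]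
    linarith [(Nat.cast_nonneg k : (0 : ℝ) ≤ k)]
  obtain ⟨hZi, hZle⟩ := integrable_and_integral_firstOrder_le hn hp hσ hε hu hu1 hw hw1 hwR hΩ
    hΩfin hRΩ hBi fun x hx0 hx => hop x hx0 hx ε hε
  set Z : Eu n × Eu n → ℝ := fun z => p * spow (p - 1) (w z.2 - w z.1) *
        (η z.1 - η z.2) * truncKernel σ ε (z.1 - z.2) with hZ
  set Fu : Eu n × Eu n → ℝ := fun z => |u z.1 - u z.2| ^ p * truncKernel σ ε (z.1 - z.2) with hFu
  set Fv : Eu n × Eu n → ℝ := fun z => |v z.1 - v z.2| ^ p * truncKernel σ ε (z.1 - z.2) with hFv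
  have hFu0 : ∀ z, 0 ≤ Fu z := fun z => mul_nonneg (by positivity) (truncKernel_nonneg _ _ _)
  have hFv0 : ∀ z, 0 ≤ Fv z := fun z => mul_nonneg (by positivity) (truncKernel_nonneg _ _ _)
  have hFum : Measurable Fu :=
    (((hu.comp measurable_fst).sub (hu.comp measurable_snd)).norm.pow_const p).mul
      (measurable_truncKernel_sub σ ε)
  have hFule : ∫⁻ z, ENNReal.ofReal (Fu z) ∂pairMeasure Ω ≤
      ∫⁻ z, gagliardo s p u z.1 z.2 ∂pairMeasure Ω := by
    refine lintegral_mono fun z => ?_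
    simp only [hFu, hσ', ofReal_mul_truncKernel]
    exact indicator_le_self _ _ _
  have hFui : Integrable Fu (pairMeasure Ω) := by
    refine ⟨hFum.aestronglyMeasurable, ?_⟩
    rw [hasFiniteIntegral_iff_ofReal (Filter.Eventually.of_forall hFu0)]
    exact hFule.trans_lt hfin
  set X : Eu n × Eu n → ℝ≥0∞ := D.indicator fun z => farKernel σ (z.1 - z.2) with hX
  have hXm : Measurable X :=
    ((measurable_farKernel σ).comp (measurable_fst.sub measurable_snd)).indicator hDm
  -- The convexity gap is available at all distances; only pairs at distance at least `1` are
  -- retained.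
  have hpt : ∀ z, ENNReal.ofReal (Fv z) + ENNReal.ofReal c * X z ≤ ENNReal.ofReal (Fu z + Z z) := by
    intro z
    have hkey := abs_min_sub_rpow_le hp hgap hu1 hw1 z.1 z.2
    have hk0 := truncKernel_nonneg σ ε (z.1 - z.2)
    have hZ' : Z z = -(p * spow (p - 1) (w z.1 - w z.2) * (η z.1 - η z.2)) *
        truncKernel σ ε (z.1 - z.2) := by
      have h1 : spow (p - 1) (w z.2 - w z.1) = -spow (p - 1) (w z.1 - w z.2) := by
        rw [← spow_neg, neg_sub]
      simp only [hZ, h1]; ring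
    have hmul := mul_le_mul_of_nonneg_right hkey hk0
    have hfar : ENNReal.ofReal c * X z ≤ ENNReal.ofReal
        (D.indicator (fun _ => c) z * truncKernel σ ε (z.1 - z.2)) := by
      by_cases hz : z ∈ D
      · rw [hX, indicator_of_mem hz, indicator_of_mem hz, ENNReal.ofReal_mul hc.le]
        gcongr
        by_cases h1 : 1 ≤ ‖z.1 - z.2‖
        · have h2 : z.1 - z.2 ∈ {h : Eu n | 1 ≤ ‖h‖} := h1
          have h3 : z.1 - z.2 ∈ {h : Eu n | ε < ‖h‖} := hε1.trans_le h1
          rw [farKernel, indicator_of_mem h2, truncKernel, indicator_of_mem h3]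
        · have h2 : z.1 - z.2 ∉ {h : Eu n | 1 ≤ ‖h‖} := h1
          rw [farKernel, indicator_of_notMem h2]
          exact zero_le
      · rw [hX, indicator_of_notMem hz, mul_zero]
        exact zero_le
    calc _ ≤ ENNReal.ofReal (Fv z) + ENNReal.ofReal
          (D.indicator (fun _ => c) z * truncKernel σ ε (z.1 - z.2)) := by gcongr
      _ = ENNReal.ofReal (Fv z + D.indicator (fun _ => c) z * truncKernel σ ε (z.1 - z.2)) := by
          rw [ENNReal.ofReal_add (hFv0 z)]
          exact mul_nonneg (indicator_nonneg (fun _ _ => hc.le) z) hk0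
      _ ≤ _ := by
          apply ENNReal.ofReal_le_ofReal
          rw [hZ']
          simp only [hFu, hFv]
          have h5 : {z : Eu n × Eu n | a₁ ≤ |excess u w z.1 - excess u w z.2|}.indicator
            (fun _ => c) (z.1, z.2) = D.indicator (fun _ => c) z := rfl
          rw [h5] at hmul
          simp only [← hη] at hmul
          linarith
  have hint0 := interaction_le_lintegral_pairMeasure (σ := σ) ha₁ hηm hΩ hηΩ
  have hFuZ0 : ∀ z, 0 ≤ Fu z + Z z := by
    intro z
    have hkey := abs_min_sub_rpow_le hp hgap hu1 hw1 z.1 z.2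
    have hk0 := truncKernel_nonneg σ ε (z.1 - z.2)
    have h1 : spow (p - 1) (w z.2 - w z.1) = -spow (p - 1) (w z.1 - w z.2) := by
      rw [← spow_neg, neg_sub]
    have h2 : 0 ≤ |min (u z.1) (w z.1) - min (u z.2) (w z.2)| ^ p := by positivity
    have h3 : 0 ≤ {z : Eu n × Eu n | a₁ ≤ |excess u w z.1 - excess u w z.2|}.indicator
      (fun _ => c) (z.1, z.2) := indicator_nonneg (fun _ _ => hc.le) _
    have h4 : Fu z + Z z = (|u z.1 - u z.2| ^ p -
        p * spow (p - 1) (w z.1 - w z.2) * (η z.1 - η z.2)) * truncKernel σ ε (z.1 - z.2) := by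
      simp only [hFu, hZ, h1]; ring
    rw [h4]
    exact mul_nonneg (by linarith) hk0
  calc _ ≤ ∫⁻ z, ENNReal.ofReal (Fv z) ∂pairMeasure Ω +
        ENNReal.ofReal c * ∫⁻ z, X z ∂pairMeasure Ω := by
        gcongr with z
        simp only [hFv, hσ', ofReal_mul_truncKernel]
        exact le_rfl
    _ = ∫⁻ z, (ENNReal.ofReal (Fv z) + ENNReal.ofReal c * X z) ∂pairMeasure Ω := by
        rw [lintegral_add_right _ (hXm.const_mul _), lintegral_const_mul _ hXm]
    _ ≤ ∫⁻ z, ENNReal.ofReal (Fu z + Z z) ∂pairMeasure Ω := lintegral_mono hpt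
    _ = ENNReal.ofReal (∫ z, (Fu z + Z z) ∂pairMeasure Ω) :=
        (ofReal_integral_eq_lintegral_ofReal (hFui.add hZi)
          (Filter.Eventually.of_forall hFuZ0)).symm
    _ = ENNReal.ofReal ((∫ z, Fu z ∂pairMeasure Ω) + ∫ z, Z z ∂pairMeasure Ω) := by
        rw [integral_add hFui hZi]
    _ ≤ ENNReal.ofReal (∫ z, Fu z ∂pairMeasure Ω) + ENNReal.ofReal (∫ z, Z z ∂pairMeasure Ω) :=
        ENNReal.ofReal_add_le
    _ ≤ _ := by
        gcongr
        rw [ofReal_integral_eq_lintegral_ofReal hFui (Filter.Eventually.of_forall hFu0)]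
        exact hFule

/-! ### The energy estimate -/

section Potential

variable {W : ℝ → ℝ} {m lam Lam θ q c₁ : ℝ}

lemma IsDegeneratePotential.nonneg (hW : IsDegeneratePotential W m lam Lam θ q c₁) {t : ℝ}
    (ht : |t| ≤ 1) : 0 ≤ W t := by
  refine le_trans ?_ (hW.bounds t (abs_le.1 ht)).1
  have h1 : 0 ≤ (Iic θ).indicator (fun _ => (1 : ℝ)) t := indicator_nonneg (fun _ _ => zero_le_one) t
  have h2 := hW.lam_mem.1.le
  positivity

/-- One power of `1 + t ≤ 2` is given up to match the exponent `m - 1` in the decay of the barrier.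
-/
lemma IsDegeneratePotential.le (hW : IsDegeneratePotential W m lam Lam θ q c₁) (hm : 1 < m) {t : ℝ}
    (ht : |t| ≤ 1) : W t ≤ 2 * Lam * (1 + t) ^ (m - 1) := by
  obtain ⟨h1, h2⟩ := abs_le.1 ht
  have h0 : 0 ≤ 1 + t := by linarith
  have hL : 1 ≤ Lam := hW.Lam_mem
  have h3 := (hW.bounds t ⟨h1, h2⟩).2
  rw [abs_of_nonneg h0] at h3
  have h4 : (1 + t) ^ m ≤ 2 * (1 + t) ^ (m - 1) := by
    rcases h0.eq_or_lt with h | h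
    · rw [← h, Real.zero_rpow (by linarith), Real.zero_rpow (by linarith)]; simp
    · have h5 : (1 + t) ^ m = (1 + t) * (1 + t) ^ (m - 1) := by
        rw [mul_comm, ← Real.rpow_add_one h.ne']; ring_nf
      rw [h5]
      gcongr
      linarith
  nlinarith

lemma IsDegeneratePotential.measurable_comp (hW : IsDegeneratePotential W m lam Lam θ q c₁)
    {u : Eu n → ℝ} (hu : Measurable u) (hu1 : ∀ x, |u x| ≤ 1) : Measurable fun x => W (u x) := by
  have h1 := (lowerSemicontinuous_restrict_iff.2 hW.lsc).measurable
  have h2 : Measurable fun x => (⟨u x, abs_le.1 (hu1 x)⟩ : Icc (-1 : ℝ) 1) := hu.subtype_mk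
  exact h1.comp h2

lemma IsDegeneratePotential.integrableOn_comp (hW : IsDegeneratePotential W m lam Lam θ q c₁)
    (hm : 1 < m) {u : Eu n → ℝ} (hu : Measurable u) (hu1 : ∀ x, |u x| ≤ 1) {Ω : Set (Eu n)}
    (hΩ : volume Ω ≠ ∞) : IntegrableOn (fun x => W (u x)) Ω := by
  refine Measure.integrableOn_of_bounded (M := 2 * Lam * 2 ^ (m - 1)) hΩ
    (hW.measurable_comp hu hu1).aestronglyMeasurable (Filter.Eventually.of_forall fun x => ?_)
  have hL : 1 ≤ Lam := hW.Lam_mem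
  obtain ⟨h1, h2⟩ := abs_le.1 (hu1 x)
  rw [Real.norm_of_nonneg (hW.nonneg (hu1 x))]
  refine (hW.le hm (hu1 x)).trans ?_
  gcongr <;> linarith

/-- The pointwise lower bound for the gain of potential energy. -/
lemma IsDegeneratePotential.gain_ge (hW : IsDegeneratePotential W m lam Lam θ q c₁) (hm : 1 < m)
    {θs a₂ : ℝ} (ha₂ : a₂ = (1 + θs) / 2) (ha₂0 : 0 < a₂) (hθq : θs ≤ -1 + q) {t r : ℝ}
    (ht : |t| ≤ 1) (hr : r ∈ Ioc (-1 : ℝ) 1) :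
    (if a₂ / 2 < max (t - r) 0 ∧ max (t - r) 0 < a₂ then c₁ * (a₂ / 2) ^ ⌈m⌉₊ else 0) -
      (if r < t ∧ θs < t then (2 * Lam + 2 * c₁ + c₁ * (a₂ / 2) ^ ⌈m⌉₊ / a₂ ^ (m - 1)) *
        (1 + r) ^ (m - 1) else 0) ≤
      W t - W (min t r) - c₁ * max (t - r) 0 * (1 + r) ^ (m - 1) := by
  have hc₁ := hW.c₁_pos
  have hL : 1 ≤ Lam := hW.Lam_mem
  obtain ⟨ht1, ht2⟩ := abs_le.1 ht
  have hr0 : 0 < 1 + r := by linarith [hr.1]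
  have hX : 0 < (1 + r) ^ (m - 1) := Real.rpow_pos_of_pos hr0 _
  rcases le_or_gt t r with h | h
  · rw [max_eq_right (by linarith), min_eq_left h, if_neg (by rintro ⟨h1, -⟩; linarith),
      if_neg (by rintro ⟨h1, -⟩; linarith)]
    simp
  rw [max_eq_left (by linarith), min_eq_right h.le]
  -- Below `-1 + q` the growth condition applies: its linear term cancels the first-order term and
  -- its power term pays for the layer. Above, `t > θs`, and everything is charged to the error, a
  -- multiple of `(1 + r)^(m-1)`.
  rcases le_or_gt t (-1 + q) with hq | hq
  · have hg := hW.growth r t hr.1.le h.le hq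
    rw [abs_of_pos hr0] at hg
    have h1 : (if a₂ / 2 < t - r ∧ t - r < a₂ then c₁ * (a₂ / 2) ^ ⌈m⌉₊ else 0) ≤
        c₁ * (t - r) ^ ⌈m⌉₊ := by
      split_ifs with h2
      · have h3 : 0 ≤ a₂ / 2 := by linarith
        gcongr
        exact h2.1.le
      · have : 0 ≤ t - r := by linarith
        positivity
    have h2 : 0 ≤ (if r < t ∧ θs < t then
        (2 * Lam + 2 * c₁ + c₁ * (a₂ / 2) ^ ⌈m⌉₊ / a₂ ^ (m - 1)) * (1 + r) ^ (m - 1) else 0) := by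
      split_ifs <;> positivity
    linarith
  · rw [if_pos (⟨h, by linarith⟩ : r < t ∧ θs < t)]
    have h1 := hW.nonneg ht
    have h2 := hW.le hm (abs_le.2 ⟨hr.1.le, hr.2⟩)
    have h3 : c₁ * (t - r) * (1 + r) ^ (m - 1) ≤ 2 * c₁ * (1 + r) ^ (m - 1) := by
      have : t - r ≤ 2 := by linarith [hr.1]
      gcongr ?_ * _
      nlinarith
    have h4 : (if a₂ / 2 < t - r ∧ t - r < a₂ then c₁ * (a₂ / 2) ^ ⌈m⌉₊ else 0) ≤
        c₁ * (a₂ / 2) ^ ⌈m⌉₊ / a₂ ^ (m - 1) * (1 + r) ^ (m - 1) := by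
      split_ifs with h5
      -- Here `1 + t > 1 + θs = 2 a₂` while `t - r < a₂`.
      · have h6 : a₂ ≤ 1 + r := by linarith [h5.2]
        have h7 : a₂ ^ (m - 1) ≤ (1 + r) ^ (m - 1) :=
          Real.rpow_le_rpow ha₂0.le h6 (by linarith)
        have h8 : 0 < a₂ ^ (m - 1) := by positivity
        rw [div_mul_eq_mul_div, le_div_iff₀ h8]
        gcongr
      · positivity
    nlinarith

end Potential

/-- The far kernel is integrable, so `G` interacts with any set by at most a constant times its
measure. This is why the kernel is cut at distance `1`. -/
lemma interaction_compl_le {σ C : ℝ} {S T G : Set (Eu n)} (hcover : Sᶜ ⊆ T ∪ G)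
    (hC : ∫⁻ h : Eu n, farKernel σ h ≤ ENNReal.ofReal C) :
    interaction σ S Sᶜ ≤ interaction σ S T + ENNReal.ofReal C * volume G := by
  have hk : Measurable fun z : Eu n × Eu n => farKernel σ (z.1 - z.2) :=
    (measurable_farKernel σ).comp (measurable_fst.sub measurable_snd)
  have h1 : ∫⁻ x in S, ∫⁻ y in G, farKernel σ (x - y) ≤ ENNReal.ofReal C * volume G := by
    rw [lintegral_lintegral_swap (f := fun x y => farKernel σ (x - y)) hk.aemeasurable,
      ← setLIntegral_const]
    refine lintegral_mono fun y => (setLIntegral_le_lintegral _ _).trans ?_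
    rw [lintegral_sub_right_eq_self (fun x => farKernel σ x) y]
    exact hC
  calc interaction σ S Sᶜ ≤ ∫⁻ x in S, ((∫⁻ y in T, farKernel σ (x - y)) +
        ∫⁻ y in G, farKernel σ (x - y)) :=
        lintegral_mono fun x => (lintegral_mono_set hcover).trans (lintegral_union_le _ _ _)
    _ = interaction σ S T + ∫⁻ x in S, ∫⁻ y in G, farKernel σ (x - y) := by
        rw [lintegral_add_right _ (Measurable.lintegral_prod_right'
          (f := fun z : Eu n × Eu n => farKernel σ (z.1 - z.2)) hk)]
        rfl
    _ ≤ _ := by gcongr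

lemma exists_lintegral_farKernel_le {σ : ℝ} (hσ : 0 < σ) :
    ∃ C : ℝ, 0 < C ∧ ∫⁻ h : Eu n, farKernel σ h ≤ ENNReal.ofReal C := by
  obtain ⟨C, hC, h⟩ := exists_lintegral_tail_le (n := n) hσ
  refine ⟨C, hC, ?_⟩
  have h1 := h 1 one_pos
  rw [Real.one_rpow, mul_one] at h1
  refine le_trans (le_of_eq ?_) h1
  rw [← lintegral_indicator (measurableSet_le measurable_const measurable_norm)]
  rfl

/-- The weighted measure of the set `{u > θ}` in the ball of radius `R`. -/
def weightedMeas (σ θ : ℝ) (u : Eu n → ℝ) (R : ℝ) : ℝ :=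
  ∫ x in Metric.ball 0 R ∩ {x | θ < u x}, (1 + R - ‖x‖) ^ (-σ)

lemma integrableOn_weight {σ θ : ℝ} (hσ : 0 < σ) {u : Eu n → ℝ} (hu : Measurable u) (R : ℝ) :
    IntegrableOn (fun x : Eu n => (1 + R - ‖x‖) ^ (-σ)) (Metric.ball 0 R ∩ {x | θ < u x}) := by
  refine Measure.integrableOn_of_bounded (M := 1) ?_
    ((measurable_const.sub measurable_norm).pow_const _).aestronglyMeasurable ?_
  · exact ((measure_mono inter_subset_left).trans_lt measure_ball_lt_top).ne
  · refine (ae_restrict_iff' (Metric.isOpen_ball.measurableSet.inter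
      (measurableSet_lt measurable_const hu))).2 (Filter.Eventually.of_forall fun x hx => ?_)
    have h1 : ‖x‖ < R := mem_ball_zero_iff.1 hx.1
    rw [Real.norm_of_nonneg (Real.rpow_nonneg (by linarith) _)]
    exact Real.rpow_le_one_of_one_le_of_nonpos (by linarith) (by linarith)

set_option maxHeartbeats 1000000 in
/-- The energy estimate: the nonlocal perimeter of a set containing `{u > θs}` in a smaller ball is
controlled by the weighted measure of `{u > θs}`. -/
lemma exists_energy_estimate {s p m c₁ θs : ℝ} (hn : 0 < n) (hs : 0 < s) (hs1 : s < 1)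
    (hp : 1 < p) (hm : 1 < m) (hc₁ : 0 < c₁) (hθs : -1 < θs) :
    ∃ K c₂ : ℝ, 0 < K ∧ 0 < c₂ ∧ ∀ Lam : ℝ, 1 ≤ Lam → ∃ C : ℝ, 0 < C ∧
      ∀ (lam θ q : ℝ) (W : ℝ → ℝ), IsDegeneratePotential W m lam Lam θ q c₁ → θs ≤ -1 + q →
      ∀ (Ω : Set (Eu n)) (u : Eu n → ℝ), MeasurableSet Ω → volume Ω ≠ ∞ → Measurable u →
      (∀ x, |u x| ≤ 1) → ∀ ε : ℝ, 0 ≤ ε → EpsMinimizes W s p ε u Ω →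
      ∀ R : ℝ, K ≤ R → Metric.ball 0 R ⊆ Ω →
      ∃ S : Set (Eu n), MeasurableSet S ∧ volume S ≠ ∞ ∧
        Metric.ball 0 (R - K) ∩ {x | θs < u x} ⊆ S ∧
        ENNReal.ofReal c₂ * interaction (s * p) S Sᶜ ≤
          ENNReal.ofReal (ε + C * weightedMeas (s * p) θs u R) := by
  set σ := s * p with hσ'
  have hσ : 0 < σ := by positivity
  have hσp : σ < p := by rw [hσ']; nlinarith
  -- Where `u > θs` and `w ≤ -1 + a₂`, the excess is at least `θs + 1 - a₂ = a₂`.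
  set a₂ := (1 + θs) / 2 with ha₂
  have ha₂0 : 0 < a₂ := by rw [ha₂]; linarith
  set a₁ := a₂ / 2 with ha₁
  have ha₁0 : 0 < a₁ := by positivity
  obtain ⟨c, hc, hgap⟩ := exists_convexity_gap hp ha₁0
  -- The first-order term of the comparison carries a factor `p`; with this `τ` its coefficient is
  -- the `c₁` of the growth condition.
  set τ := c₁ / p with hτ
  have hτ0 : 0 < τ := by positivity
  obtain ⟨K, Cb, hK, hCb, hbar⟩ := exists_barrier (n := n) hn hp hσ hσp hm hτ0 ha₂0
  obtain ⟨CJ, hCJ, hfar⟩ := exists_lintegral_farKernel_le (n := n) hσ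
  set κ := c₁ * (a₂ / 2) ^ ⌈m⌉₊ with hκ
  have hκ0 : 0 < κ := by positivity
  -- The gain constant is fixed before `Lam` is introduced; only the error constant `C' * Cb` sees
  -- `Lam`.
  refine ⟨K, min ((1 - s) * c) (κ / CJ), hK,
    lt_min (mul_pos (by linarith) hc) (by positivity), fun Lam hLam => ?_⟩
  set C' := 2 * Lam + 2 * c₁ + κ / a₂ ^ (m - 1) with hC'
  have hC'0 : 0 < C' := by positivity
  refine ⟨C' * Cb, by positivity, ?_⟩
  intro lam θ q W hW hθq Ω u hΩ hΩfin hu hu1 ε hε hmin R hR hRΩ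
  obtain ⟨w, hwc, hwI, hwR, hwsmall, hwdecay, hwop⟩ := hbar R hR
  have hw : Measurable w := hwc.measurable
  have hw1 : ∀ x, |w x| ≤ 1 := fun x => abs_le.2 ⟨(hwI x).1.le, (hwI x).2⟩
  set v : Eu n → ℝ := fun x => min (u x) (w x) with hv
  have hvm : Measurable v := hu.min hw
  have hv1 : ∀ x, |v x| ≤ 1 := fun x => by
    rcases min_choice (u x) (w x) with h | h <;> simp only [hv, h]
    · exact hu1 x
    · exact hw1 x
  set η := excess u w with hη
  have hη0 : ∀ x, 0 ≤ η x := excess_nonneg u w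
  have hηm : Measurable η := (hu.sub hw).max measurable_const
  have hη2 : ∀ x, η x ≤ 2 := fun x => max_le
    (by linarith [(abs_le.1 (hu1 x)).2, (abs_le.1 (hw1 x)).1]) (by norm_num)
  have huw : ∀ x, R ≤ ‖x‖ → u x ≤ w x := fun x hx => by
    rw [hwR x hx]; exact (abs_le.1 (hu1 x)).2
  have hηR : ∀ x, R ≤ ‖x‖ → η x = 0 := fun x hx => excess_eq_zero (huw x hx)
  have hwpow : Measurable fun x => (1 + w x) ^ (m - 1) := (measurable_const.add hw).pow_const _
  have hwpow2 : ∀ x, (1 + w x) ^ (m - 1) ≤ 2 ^ (m - 1) := fun x =>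
    Real.rpow_le_rpow (by linarith [(hwI x).1]) (by linarith [(hwI x).2]) (by linarith)
  have hwpow0 : ∀ x, 0 ≤ (1 + w x) ^ (m - 1) := fun x =>
    Real.rpow_nonneg (by linarith [(hwI x).1]) _
  have hBi : IntegrableOn (fun x => η x * (τ * (1 + w x) ^ (m - 1))) Ω := by
    refine Measure.integrableOn_of_bounded (M := 2 * (τ * 2 ^ (m - 1))) hΩfin
      (hηm.mul (hwpow.const_mul τ)).aestronglyMeasurable (Filter.Eventually.of_forall fun x => ?_)
    rw [Real.norm_of_nonneg (mul_nonneg (hη0 x) (mul_nonneg hτ0.le (hwpow0 x)))]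
    exact mul_le_mul (hη2 x) (mul_le_mul_of_nonneg_left (hwpow2 x) hτ0.le)
      (mul_nonneg hτ0.le (hwpow0 x)) (by norm_num)
  obtain ⟨⟨_, hKu, _⟩, hmin'⟩ := hmin
  have hkin := kinetic_min_add_interaction_le hn hp hs hc ha₁0 hgap hu hu1 hw hw1 hwR hΩ hΩfin hRΩ
    hBi hwop hKu
  rw [show 2 * a₁ = a₂ by rw [ha₁]; ring] at hkin
  set S := {x | a₂ ≤ η x} with hS'
  set T := {x | η x ≤ a₁} with hT'
  have hS : MeasurableSet S := measurableSet_le measurable_const hηm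
  set G := {x | a₁ < η x ∧ η x < a₂} with hG'
  have hG : MeasurableSet G :=
    (measurableSet_lt measurable_const hηm).inter (measurableSet_lt hηm measurable_const)
  have hball : ∀ x, 0 < η x → x ∈ Metric.ball (0 : Eu n) R := fun x hx => by
    rw [mem_ball_zero_iff]
    by_contra h
    rw [hηR x (not_lt.1 h)] at hx
    exact lt_irrefl _ hx
  have hSR : S ⊆ Metric.ball 0 R := fun x (hx : a₂ ≤ η x) => hball x (ha₂0.trans_le hx)
  have hGR : G ⊆ Metric.ball 0 R := fun x hx => hball x (ha₁0.trans hx.1)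
  have hGfin : volume G ≠ ∞ := ((measure_mono hGR).trans_lt measure_ball_lt_top).ne
  have hSfin : volume S ≠ ∞ := ((measure_mono hSR).trans_lt measure_ball_lt_top).ne
  refine ⟨S, hS, hSfin, ?_, ?_⟩
  · rintro x ⟨hx1, hx2⟩
    have h1 := hwsmall x (mem_ball_zero_iff.1 hx1).le
    have h2 : θs < u x := hx2
    have h3 : u x - w x ≤ η x := le_max_left _ _
    change a₂ ≤ η x
    linarith
  set P := ∫ x in Ω, c₁ * η x * (1 + w x) ^ (m - 1) with hP
  have hPeq : p * ∫ x in Ω, η x * (τ * (1 + w x) ^ (m - 1)) = P := by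
    rw [← integral_const_mul]
    refine integral_congr_ae (Filter.Eventually.of_forall fun x => ?_)
    simp only [hτ]
    field_simp
  rw [hPeq] at hkin
  have hP0 : 0 ≤ P := integral_nonneg fun x => mul_nonneg (mul_nonneg hc₁.le (hη0 x)) (hwpow0 x)
  have hrhs : kinetic s p u Ω + ENNReal.ofReal P < ∞ :=
    ENNReal.add_lt_top.2 ⟨hKu, ENNReal.ofReal_lt_top⟩
  have hlhs := hkin.trans_lt hrhs
  obtain ⟨hKv, hcI⟩ := ENNReal.add_lt_top.1 hlhs
  have hIfin : interaction σ S T ≠ ∞ := by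
    intro h
    rw [h, ENNReal.mul_top (by simpa using hc)] at hcI
    exact lt_irrefl _ hcI
  have hvX : v ∈ XTrace s p u Ω := by
    refine ⟨⟨hvm.aemeasurable, hKv, Filter.Eventually.of_forall hv1⟩,
      Filter.Eventually.of_forall fun x hx => ?_⟩
    have h1 : R ≤ ‖x‖ := by
      by_contra h
      exact hx (hRΩ (mem_ball_zero_iff.2 (not_le.1 h)))
    exact min_eq_left (huw x h1)
  have hE := hmin' v hvX
  set ku := (kinetic s p u Ω).toReal with hku
  set kv := (kinetic s p v Ω).toReal with hkv
  set I := (interaction σ S T).toReal with hI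
  have hI0 : 0 ≤ I := ENNReal.toReal_nonneg
  have hku' : kinetic s p u Ω = ENNReal.ofReal ku := (ENNReal.ofReal_toReal hKu.ne).symm
  have hkv' : kinetic s p v Ω = ENNReal.ofReal kv := (ENNReal.ofReal_toReal hKv.ne).symm
  have hI' : interaction σ S T = ENNReal.ofReal I := (ENNReal.ofReal_toReal hIfin).symm
  have hku0 : 0 ≤ ku := ENNReal.toReal_nonneg
  have hkv0 : 0 ≤ kv := ENNReal.toReal_nonneg
  have hWu := hW.integrableOn_comp hm hu hu1 hΩfin
  have hWv := hW.integrableOn_comp hm hvm hv1 hΩfin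
  have hkin' : kv + c * I ≤ ku + P := by
    rw [hku', hI', ← ENNReal.ofReal_mul hc.le, ← ENNReal.ofReal_add hku0 hP0] at hkin
    change kinetic s p v Ω + _ ≤ _ at hkin
    rw [hkv', ← ENNReal.ofReal_add hkv0 (by positivity)] at hkin
    exact (ENNReal.ofReal_le_ofReal_iff (by positivity)).1 hkin
  have hE' : (1 - s) * ku + ∫ x in Ω, W (u x) ≤ ε + ((1 - s) * kv + ∫ x in Ω, W (v x)) := by
    have h1s : 0 ≤ 1 - s := by linarith
    have hWu0 : 0 ≤ ∫ x in Ω, W (u x) := integral_nonneg fun x => hW.nonneg (hu1 x)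
    have hWv0 : 0 ≤ ∫ x in Ω, W (v x) := integral_nonneg fun x => hW.nonneg (hv1 x)
    rw [energy, energy, hku', hkv', ← ofReal_integral_eq_lintegral_ofReal hWu
      (Filter.Eventually.of_forall fun x => hW.nonneg (hu1 x)),
      ← ofReal_integral_eq_lintegral_ofReal hWv
      (Filter.Eventually.of_forall fun x => hW.nonneg (hv1 x)),
      ← ENNReal.ofReal_mul h1s, ← ENNReal.ofReal_mul h1s,
      ← ENNReal.ofReal_add (by positivity) hWu0, ← ENNReal.ofReal_add (by positivity) hWv0,
      ← ENNReal.ofReal_add hε (by positivity)] at hE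
    exact (ENNReal.ofReal_le_ofReal_iff (by positivity)).1 hE
  have hPi : IntegrableOn (fun x => c₁ * η x * (1 + w x) ^ (m - 1)) Ω := by
    refine (hBi.const_mul p).congr (Filter.Eventually.of_forall fun x => ?_)
    simp only [hτ]
    field_simp
  set A := Metric.ball (0 : Eu n) R ∩ {x | θs < u x} with hA'
  have hA : MeasurableSet A :=
    Metric.isOpen_ball.measurableSet.inter (measurableSet_lt measurable_const hu)
  have hAΩ : A ⊆ Ω := inter_subset_left.trans hRΩ
  have hAfin : volume A ≠ ∞ := ((measure_mono inter_subset_left).trans_lt measure_ball_lt_top).ne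
  have hwA : IntegrableOn (fun x => (1 + w x) ^ (m - 1)) A := by
    refine Measure.integrableOn_of_bounded (M := 2 ^ (m - 1)) hAfin hwpow.aestronglyMeasurable
      (Filter.Eventually.of_forall fun x => ?_)
    rw [Real.norm_of_nonneg (hwpow0 x)]
    exact hwpow2 x
  have hgain : κ * volume.real G - C' * ∫ x in A, (1 + w x) ^ (m - 1) ≤
      (∫ x in Ω, W (u x)) - (∫ x in Ω, W (v x)) - P := by
    have hsub : IntegrableOn (fun x => W (u x) - W (v x)) Ω := hWu.sub hWv
    rw [hP, ← integral_sub hWu hWv, ← integral_sub hsub hPi]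
    have hg1 : IntegrableOn (G.indicator fun _ => κ) Ω := by
      rw [integrableOn_indicator_iff hG]
      exact integrableOn_const ((measure_mono inter_subset_left).trans_lt hGfin.lt_top).ne
    have hg2 : IntegrableOn (A.indicator fun x => C' * (1 + w x) ^ (m - 1)) Ω := by
      rw [integrableOn_indicator_iff hA]
      exact IntegrableOn.mono_set (hwA.const_mul C') inter_subset_left
    have e1 : ∫ x in Ω, G.indicator (fun _ => κ) x = κ * volume.real G := by
      rw [setIntegral_indicator hG, inter_eq_right.2 (hGR.trans hRΩ), setIntegral_const,
        smul_eq_mul, mul_comm]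
    have e2 : ∫ x in Ω, A.indicator (fun x => C' * (1 + w x) ^ (m - 1)) x =
        C' * ∫ x in A, (1 + w x) ^ (m - 1) := by
      rw [setIntegral_indicator hA, inter_eq_right.2 hAΩ, integral_const_mul]
    rw [← e1, ← e2, ← integral_sub hg1 hg2]
    refine integral_mono (hg1.sub hg2) (hsub.sub hPi) fun x => ?_
    have h1 := hW.gain_ge hm ha₂ ha₂0 hθq (hu1 x) (hwI x)
    have h2 : G.indicator (fun _ => κ) x =
        if a₂ / 2 < max (u x - w x) 0 ∧ max (u x - w x) 0 < a₂ then κ else 0 := by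
      rw [indicator_apply]; rfl
    have h3 : (if w x < u x ∧ θs < u x then C' * (1 + w x) ^ (m - 1) else 0) ≤
        A.indicator (fun x => C' * (1 + w x) ^ (m - 1)) x := by
      split_ifs with h
      · have hxA : x ∈ A := by
          refine ⟨?_, h.2⟩
          rw [mem_ball_zero_iff]
          by_contra hx
          exact absurd (huw x (not_lt.1 hx)) (not_le.2 h.1)
        rw [indicator_of_mem hxA]
      · exact indicator_nonneg (fun y _ => mul_nonneg hC'0.le (hwpow0 y)) x
    rw [h2]
    refine le_trans ?_ h1
    rw [← hC']
    linarith
  have hdecay : ∫ x in A, (1 + w x) ^ (m - 1) ≤ Cb * weightedMeas σ θs u R := by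
    rw [weightedMeas, ← integral_const_mul]
    refine setIntegral_mono_on hwA ((integrableOn_weight hσ hu R).const_mul Cb) hA fun x hx => ?_
    exact hwdecay x (mem_ball_zero_iff.1 hx.1).le
  have hfinal : (1 - s) * c * I + κ * volume.real G ≤ ε + C' * Cb * weightedMeas σ θs u R := by
    have h1 : C' * ∫ x in A, (1 + w x) ^ (m - 1) ≤ C' * (Cb * weightedMeas σ θs u R) := by gcongr
    have h2 : (1 - s) * (kv + c * I) ≤ (1 - s) * (ku + P) :=
      mul_le_mul_of_nonneg_left hkin' (by linarith)
    -- The potential gain absorbs all of `P`, while the renormalized kinetic energy only requires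
    -- the fraction `1 - s`.
    have h3 : (1 - s) * P ≤ P := mul_le_of_le_one_left hP0 (by linarith)
    rw [mul_add, mul_add, ← mul_assoc] at h2
    rw [mul_assoc C']
    linarith
  have hcov : Sᶜ ⊆ T ∪ G := by
    intro x hx
    have h1 : η x < a₂ := not_le.1 hx
    rcases le_or_gt (η x) a₁ with h2 | h2
    · exact Or.inl h2
    · exact Or.inr ⟨h2, h1⟩
  have hint := interaction_compl_le (σ := σ) hcov hfar
  set c₂ := min ((1 - s) * c) (κ / CJ) with hc₂
  have hc₂0 : 0 < c₂ := lt_min (mul_pos (by linarith) hc) (by positivity)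
  have hG0 : 0 ≤ volume.real G := measureReal_nonneg
  calc ENNReal.ofReal c₂ * interaction σ S Sᶜ
      ≤ ENNReal.ofReal c₂ * (interaction σ S T + ENNReal.ofReal CJ * volume G) := by gcongr
    _ = ENNReal.ofReal (c₂ * (I + CJ * volume.real G)) := by
        rw [hI', ← ofReal_measureReal hGfin, ← ENNReal.ofReal_mul hCJ.le,
          ← ENNReal.ofReal_add hI0 (by positivity), ← ENNReal.ofReal_mul hc₂0.le]
    _ ≤ _ := by
        apply ENNReal.ofReal_le_ofReal
        have h1 : c₂ * I ≤ (1 - s) * c * I := by gcongr; exact min_le_left _ _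
        have h2 : c₂ * (CJ * volume.real G) ≤ κ * volume.real G := by
          calc c₂ * (CJ * volume.real G) ≤ (κ / CJ) * (CJ * volume.real G) := by
                gcongr; exact min_le_right _ _
            _ = κ * volume.real G := by field_simp
        linarith

/-! ### Iteration -/

/-- For a fixed point, `d + i` is its depth in the `i`-th ball. Once positive, depths grow by unit
steps, so the `k`-th positive one exceeds `k`; the induction discards the radii that do not yet
reach the point. -/
lemma sum_truncated_rpow_le {σ : ℝ} (hσ : 0 ≤ σ) (ℓ : ℕ) (d : ℝ) :
    ∑ i ∈ Finset.range ℓ, (if 0 < d + i then (1 + (d + i)) ^ (-σ) else 0) ≤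
      ∑ k ∈ Finset.range ℓ, (1 + (k : ℝ)) ^ (-σ) := by
  rcases lt_or_ge 0 d with hd | hd
  · refine Finset.sum_le_sum fun i _ => ?_
    have hi : (0 : ℝ) ≤ i := Nat.cast_nonneg i
    rw [if_pos (by linarith)]
    exact Real.rpow_le_rpow_of_nonpos (by linarith) (by linarith) (by linarith)
  · induction ℓ generalizing d with
    | zero => simp
    | succ ℓ ih =>
      rw [Finset.sum_range_succ', Finset.sum_range_succ _ ℓ, if_neg (by simpa using hd)]
      have hlast : (0 : ℝ) ≤ (1 + (ℓ : ℝ)) ^ (-σ) := by positivity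
      have hshift : ∀ i : ℕ, d + ((i + 1 : ℕ) : ℝ) = d + 1 + i := fun i => by push_cast; ring
      simp only [hshift]
      rcases lt_or_ge 0 (d + 1) with hd1 | hd1
      · have : ∑ i ∈ Finset.range ℓ, (if 0 < d + 1 + i then (1 + (d + 1 + i)) ^ (-σ) else 0) ≤
            ∑ k ∈ Finset.range ℓ, (1 + (k : ℝ)) ^ (-σ) := by
          refine Finset.sum_le_sum fun i _ => ?_
          have hi : (0 : ℝ) ≤ i := Nat.cast_nonneg i
          rw [if_pos (by linarith)]
          exact Real.rpow_le_rpow_of_nonpos (by linarith) (by linarith) (by linarith)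
        linarith
      · linarith [ih (d + 1) hd1]

/-- The block of indices from `2^M` to `2^(M+1)` contributes at most `2^M * 2^(-Mσ)`. -/
lemma sum_range_two_pow_rpow_le {σ : ℝ} (hσ : 0 ≤ σ) (M : ℕ) :
    ∑ k ∈ Finset.range (2 ^ M), (1 + (k : ℝ)) ^ (-σ) ≤ 2 * dyadicSum σ M := by
  have h : ∑ k ∈ Finset.range (2 ^ M), (1 + (k : ℝ)) ^ (-σ) ≤
      1 + ∑ j ∈ Finset.range M, ((2 : ℝ) ^ (1 - σ)) ^ j := by
    induction M with
    | zero => simp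
    | succ M ih =>
      rw [pow_succ, mul_two, Finset.sum_range_add, Finset.sum_range_succ _ M]
      have h1 : ∑ k ∈ Finset.range (2 ^ M), (1 + ((2 ^ M + k : ℕ) : ℝ)) ^ (-σ) ≤
          ((2 : ℝ) ^ (1 - σ)) ^ M := by
        calc ∑ k ∈ Finset.range (2 ^ M), (1 + ((2 ^ M + k : ℕ) : ℝ)) ^ (-σ)
            ≤ ∑ k ∈ Finset.range (2 ^ M), ((2 : ℝ) ^ M) ^ (-σ) := by
              refine Finset.sum_le_sum fun k _ => ?_
              refine Real.rpow_le_rpow_of_nonpos (by positivity) ?_ (by linarith)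
              push_cast
              linarith [(Nat.cast_nonneg k : (0 : ℝ) ≤ k)]
          _ = ((2 : ℝ) ^ (1 - σ)) ^ M := by
              rw [Finset.sum_const, Finset.card_range, nsmul_eq_mul, sub_eq_add_neg,
                Real.rpow_add two_pos, Real.rpow_one, mul_pow, ← Real.rpow_natCast (2 ^ (-σ)),
                ← Real.rpow_mul two_pos.le, ← Real.rpow_natCast 2 M, ← Real.rpow_mul two_pos.le,
                mul_comm (-σ), Real.rpow_natCast]
              push_cast
              ring_nf
      linarith
  have h2 := one_le_dyadicSum σ M
  have h3 : ∑ j ∈ Finset.range M, ((2 : ℝ) ^ (1 - σ)) ^ j ≤ dyadicSum σ M := by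
    rw [dyadicSum, Finset.sum_range_succ]
    have : 0 ≤ ((2 : ℝ) ^ (1 - σ)) ^ M := by positivity
    linarith
  linarith

/-- The loss from enlarging the scale by `i` is uniform in `N`. For `σ > 0` the base of the power is
below `2`, so it is beaten by the `2^i` additional radii. -/
lemma dyadicSum_add_le (σ : ℝ) (N i : ℕ) :
    dyadicSum σ (N + i) ≤ (i + 1) * max ((2 : ℝ) ^ (1 - σ)) 1 ^ i * dyadicSum σ N := by
  set r := (2 : ℝ) ^ (1 - σ) with hr
  have hr0 : 0 < r := by positivity
  set Q := max r 1 with hQ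
  have hQ1 : 1 ≤ Q := le_max_right _ _
  have hD := one_le_dyadicSum σ N
  have h1 : dyadicSum σ (N + i) = ∑ j ∈ Finset.range i, r ^ j + r ^ i * dyadicSum σ N := by
    rw [dyadicSum, show N + i + 1 = i + (N + 1) by ring, Finset.sum_range_add, dyadicSum,
      Finset.mul_sum]
    simp only [pow_add, hr]
  have h2 : ∑ j ∈ Finset.range i, r ^ j ≤ i * Q ^ i := by
    calc ∑ j ∈ Finset.range i, r ^ j ≤ ∑ j ∈ Finset.range i, Q ^ i := by
          refine Finset.sum_le_sum fun j hj => ?_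
          exact (pow_le_pow_left₀ hr0.le (le_max_left _ _) j).trans
            (pow_le_pow_right₀ hQ1 (Finset.mem_range.1 hj).le)
      _ = i * Q ^ i := by simp
  have h3 : r ^ i ≤ Q ^ i := pow_le_pow_left₀ hr0.le (le_max_left _ _) i
  have h4 : (i : ℝ) * Q ^ i ≤ i * Q ^ i * dyadicSum σ N :=
    le_mul_of_one_le_right (by positivity) hD
  have h5 : r ^ i * dyadicSum σ N ≤ Q ^ i * dyadicSum σ N := by gcongr
  rw [h1]
  linarith

lemma exists_add_one_mul_pow_le {Q a : ℝ} (hQ : 0 < Q) (hQ2 : Q < 2) (ha : 0 < a) :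
    ∃ i : ℕ, ((i : ℝ) + 1) * Q ^ i ≤ a * 2 ^ i := by
  have hlt : Q / 2 < 1 := by linarith
  have h := (tendsto_self_mul_const_pow_of_lt_one (by positivity : 0 ≤ Q / 2) hlt).add
    (tendsto_pow_atTop_nhds_zero_of_lt_one (by positivity : 0 ≤ Q / 2) hlt)
  rw [add_zero] at h
  obtain ⟨i, hi⟩ := (h.eventually (gt_mem_nhds ha)).exists
  refine ⟨i, ?_⟩
  have h2 : (0 : ℝ) < 2 ^ i := by positivity
  rw [div_pow] at hi
  have h3 : ((i : ℝ) + 1) * Q ^ i = (i * (Q ^ i / 2 ^ i) + Q ^ i / 2 ^ i) * 2 ^ i := by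
    field_simp
  rw [h3]
  gcongr

/-- The measure of the set `{u > θ}` in the ball of radius `R`. -/
def superMeas (θ : ℝ) (u : Eu n → ℝ) (R : ℝ) : ℝ :=
  volume.real (Metric.ball 0 R ∩ {x | θ < u x})

lemma superMeas_mono (θ : ℝ) (u : Eu n → ℝ) {R R' : ℝ} (h : R ≤ R') :
    superMeas θ u R ≤ superMeas θ u R' :=
  measureReal_mono (inter_subset_inter_left _ (Metric.ball_subset_ball h))
    ((measure_mono inter_subset_left).trans_lt measure_ball_lt_top).ne

/-- After exchanging sum and integral, the weights met by each point of the largest ball are bounded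
by `sum_truncated_rpow_le`. -/
lemma sum_weightedMeas_le {σ θ : ℝ} (hσ : 0 < σ) {u : Eu n → ℝ} (hu : Measurable u) (T : ℝ)
    (ℓ : ℕ) : ∑ i ∈ Finset.range ℓ, weightedMeas σ θ u (T + i) ≤
      (∑ k ∈ Finset.range ℓ, (1 + (k : ℝ)) ^ (-σ)) * superMeas θ u (T + ℓ) := by
  set E := Metric.ball (0 : Eu n) (T + ℓ) ∩ {x | θ < u x} with hE
  have hEm : MeasurableSet E :=
    Metric.isOpen_ball.measurableSet.inter (measurableSet_lt measurable_const hu)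
  have hEfin : volume E ≠ ∞ := ((measure_mono inter_subset_left).trans_lt measure_ball_lt_top).ne
  set g : ℕ → Eu n → ℝ := fun i =>
    (Metric.ball (0 : Eu n) (T + i)).indicator fun x => (1 + (T + i) - ‖x‖) ^ (-σ) with hg
  have hset : ∀ i ∈ Finset.range ℓ, E ∩ Metric.ball (0 : Eu n) (T + i) =
      Metric.ball (0 : Eu n) (T + i) ∩ {x | θ < u x} := by
    intro i hi
    have h1 : (i : ℝ) ≤ ℓ := by exact_mod_cast (Finset.mem_range.1 hi).le
    have h2 : Metric.ball (0 : Eu n) (T + i) ⊆ Metric.ball 0 (T + ℓ) :=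
      Metric.ball_subset_ball (by linarith)
    ext x
    constructor
    · rintro ⟨⟨_, h3⟩, h4⟩; exact ⟨h4, h3⟩
    · rintro ⟨h3, h4⟩; exact ⟨⟨h2 h3, h4⟩, h3⟩
  have hgi : ∀ i ∈ Finset.range ℓ, IntegrableOn (g i) E := by
    intro i hi
    rw [integrableOn_indicator_iff Metric.isOpen_ball.measurableSet, inter_comm, hset i hi]
    exact integrableOn_weight hσ hu _
  have hgw : ∀ i ∈ Finset.range ℓ, weightedMeas σ θ u (T + i) = ∫ x in E, g i x := by
    intro i hi
    rw [setIntegral_indicator Metric.isOpen_ball.measurableSet, hset i hi]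
    rfl
  rw [Finset.sum_congr rfl hgw, ← integral_finsetSum _ hgi, mul_comm, superMeas,
    ← smul_eq_mul, ← setIntegral_const]
  refine setIntegral_mono_on (integrable_finsetSum _ hgi) (integrableOn_const hEfin) hEm
    fun x _ => ?_
  refine le_trans (Finset.sum_le_sum fun i _ => ?_) (sum_truncated_rpow_le hσ.le ℓ (T - ‖x‖))
  have h1 : x ∈ Metric.ball (0 : Eu n) (T + i) ↔ 0 < T - ‖x‖ + i := by
    rw [mem_ball_zero_iff]
    constructor <;> intro h <;> linarith
  change (Metric.ball (0 : Eu n) (T + i)).indicator (fun x => (1 + (T + i) - ‖x‖) ^ (-σ)) x ≤ _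
  split_ifs with h2
  · rw [indicator_of_mem (h1.2 h2),
      show 1 + (T + i) - ‖x‖ = 1 + (T - ‖x‖ + i) by ring]
  · rw [indicator_of_notMem (mt h1.1 h2)]

/-- One step of the iteration: enlarging the ball by a bounded multiple of `2 ^ N` multiplies the
measure of `{u > θs}` by at least `2 ^ n`. -/
lemma exists_growth_step {s p m c₁ θs : ℝ} (hn : 0 < n) (hs : 0 < s) (hs1 : s < 1)
    (hp : 1 < p) (hm : 1 < m) (hc₁ : 0 < c₁) (hθs : -1 < θs) :
    ∃ K b κ : ℝ, 0 < K ∧ 0 < b ∧ 0 < κ ∧ ∀ Lam : ℝ, 1 ≤ Lam → ∃ i₀ : ℕ,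
      ∀ (lam θ q : ℝ) (W : ℝ → ℝ), IsDegeneratePotential W m lam Lam θ q c₁ → θs ≤ -1 + q →
      ∀ (Ω : Set (Eu n)) (u : Eu n → ℝ), MeasurableSet Ω → volume Ω ≠ ∞ → Measurable u →
      (∀ x, |u x| ≤ 1) → ∀ ε : ℝ, 0 ≤ ε → EpsMinimizes W s p ε u Ω →
      ∀ (ρ : ℝ) (N : ℕ) (v : ℝ), 0 ≤ ρ → 0 ≤ v → v ≤ b * (2 ^ N) ^ n → v ≤ superMeas θs u ρ →
      ε ≤ κ * (v / 2 ^ N) → Metric.ball 0 (ρ + K + 2 ^ (N + i₀)) ⊆ Ω →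
      2 ^ n * v ≤ superMeas θs u (ρ + K + 2 ^ (N + i₀)) := by
  have hσ : 0 < s * p := by positivity
  obtain ⟨K, c₂, hK, hc₂, hen⟩ := exists_energy_estimate hn hs hs1 hp hm hc₁ hθs
  obtain ⟨b, c, hb, hc, hiso⟩ := exists_isoperimetric (σ := s * p) hn hσ
  refine ⟨K, b, c₂ * c / 2, hK, hb, by positivity, fun Lam hLam => ?_⟩
  obtain ⟨C, hC, hen⟩ := hen Lam hLam
  set Q := max ((2 : ℝ) ^ (1 - s * p)) 1 with hQ
  have hQ0 : 0 < Q := zero_lt_one.trans_le (le_max_right _ _)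
  have hQ2 : Q < 2 := by
    refine max_lt ?_ one_lt_two
    calc (2 : ℝ) ^ (1 - s * p) < 2 ^ (1 : ℝ) :=
          Real.rpow_lt_rpow_of_exponent_lt one_lt_two (by linarith)
      _ = 2 := Real.rpow_one 2
  -- The factor `2 ^ n` is the wanted growth of the volume; `C` is the only source of dependence on
  -- `Lam`.
  obtain ⟨i₀, hi₀⟩ := exists_add_one_mul_pow_le hQ0 hQ2
    (by positivity : 0 < c₂ * c / 2 / (2 * C * 2 ^ n))
  refine ⟨i₀, ?_⟩
  intro lam θ q W hW hθq Ω u hΩ hΩfin hu hu1 ε hε hmin ρ N v hρ hv hvb hvρ hεv hball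
  set D := dyadicSum (s * p) N with hD
  have hD1 : 1 ≤ D := one_le_dyadicSum _ N
  set ℓ : ℕ := 2 ^ (N + i₀) with hℓ
  have hℓ' : (2 : ℝ) ^ (N + i₀) = (ℓ : ℝ) := by rw [hℓ]; push_cast; rfl
  rw [hℓ'] at hball ⊢
  have hX : 0 ≤ c₂ * c / 2 * (v / 2 ^ N) := by positivity
  have hterm : ∀ i ∈ Finset.range ℓ, c₂ * c / 2 * (v / 2 ^ N) * D ≤
      C * weightedMeas (s * p) θs u (ρ + K + i) := by
    intro i hi
    have hi0 : (0 : ℝ) ≤ i := Nat.cast_nonneg i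
    have hiℓ : (i : ℝ) ≤ ℓ := by exact_mod_cast (Finset.mem_range.1 hi).le
    obtain ⟨S, hS, hSfin, hsub, hle⟩ := hen lam θ q W hW hθq Ω u hΩ hΩfin hu hu1 ε hε hmin
      (ρ + K + i) (by linarith) ((Metric.ball_subset_ball (by linarith)).trans hball)
    have hvS : v ≤ volume.real S := by
      refine hvρ.trans (measureReal_mono (Subset.trans ?_ hsub) hSfin)
      exact inter_subset_inter_left _ (Metric.ball_subset_ball (by linarith))
    have h1 := hiso S hS hSfin N v hv hvb hvS
    have h2 : ENNReal.ofReal (c₂ * (c * (v / 2 ^ N) * D)) ≤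
        ENNReal.ofReal (ε + C * weightedMeas (s * p) θs u (ρ + K + i)) := by
      rw [ENNReal.ofReal_mul hc₂.le]
      exact le_trans (by gcongr) hle
    have h3 : 0 ≤ weightedMeas (s * p) θs u (ρ + K + i) := by
      refine setIntegral_nonneg (Metric.isOpen_ball.measurableSet.inter
        (measurableSet_lt measurable_const hu)) fun x hx => Real.rpow_nonneg ?_ _
      linarith [mem_ball_zero_iff.1 hx.1]
    have h4 := (ENNReal.ofReal_le_ofReal_iff (by positivity)).1 h2
    -- Half of the isoperimetric lower bound absorbs `ε`, the other half is kept.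
    have h5 : ε ≤ c₂ * c / 2 * (v / 2 ^ N) * D := hεv.trans (le_mul_of_one_le_right hX hD1)
    have h6 : c₂ * (c * (v / 2 ^ N) * D) = 2 * (c₂ * c / 2 * (v / 2 ^ N) * D) := by ring
    linarith
  have hsum := Finset.sum_le_sum hterm
  rw [Finset.sum_const, Finset.card_range, nsmul_eq_mul, ← Finset.mul_sum] at hsum
  set V := superMeas θs u (ρ + K + ℓ) with hV
  have hV0 : 0 ≤ V := measureReal_nonneg
  have hw : ∑ i ∈ Finset.range ℓ, weightedMeas (s * p) θs u (ρ + K + i) ≤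
      2 * ((i₀ + 1) * Q ^ i₀ * D) * V := by
    refine (sum_weightedMeas_le hσ hu _ ℓ).trans ?_
    have h1 := sum_range_two_pow_rpow_le hσ.le (N + i₀)
    have h2 := dyadicSum_add_le (s * p) N i₀
    exact mul_le_mul_of_nonneg_right (by linarith) hV0
  -- The dyadic sum `D` now appears on both sides and cancels, so no asymptotics of it are needed.
  have hfin : (ℓ : ℝ) * (c₂ * c / 2 * (v / 2 ^ N) * D) ≤
      C * (2 * (c₂ * c / 2 / (2 * C * 2 ^ n) * 2 ^ i₀ * D) * V) :=
    hsum.trans (by gcongr; exact hw.trans (by gcongr))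
  have e1 : (ℓ : ℝ) * (c₂ * c / 2 * (v / 2 ^ N) * D) = (c₂ * c / 2 * 2 ^ i₀ * D) * v := by
    rw [← hℓ', pow_add]
    field_simp
  have e2 : C * (2 * (c₂ * c / 2 / (2 * C * 2 ^ n) * 2 ^ i₀ * D) * V) =
      (c₂ * c / 2 * 2 ^ i₀ * D) * (V / 2 ^ n) := by
    field_simp
  rw [e1, e2] at hfin
  have h7 := le_of_mul_le_mul_left hfin (by positivity)
  rw [le_div_iff₀ (by positivity)] at h7
  linarith

/-- The density estimate for pointwise bounded, Borel measurable `ε`-minimizers. -/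
lemma exists_density_estimate {s p m c₁ θs : ℝ} (hn : 0 < n) (hs : 0 < s) (hs1 : s < 1)
    (hp : 1 < p) (hm : 1 < m) (hc₁ : 0 < c₁) (hθs : -1 < θs) :
    ∃ b κ : ℝ, 0 < b ∧ 0 < κ ∧ ∀ r₀ Lam c₀ : ℝ, 0 < r₀ → 1 ≤ Lam → 0 < c₀ → ∃ ct : ℝ, 0 < ct ∧
      ∀ (lam θ q : ℝ) (W : ℝ → ℝ), IsDegeneratePotential W m lam Lam θ q c₁ → θs ≤ -1 + q →
      ∀ (Ω : Set (Eu n)) (u : Eu n → ℝ), MeasurableSet Ω → volume Ω ≠ ∞ → Measurable u →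
      (∀ x, |u x| ≤ 1) → ∀ ε : ℝ, 0 ≤ ε → ε ≤ κ * min c₀ b → EpsMinimizes W s p ε u Ω →
      c₀ ≤ superMeas θs u r₀ → ∀ r : ℝ, r₀ ≤ r → Metric.ball 0 r ⊆ Ω →
      ct * r ^ n ≤ superMeas θs u r := by
  obtain ⟨K, b, κ, hK, hb, hκ, hstep⟩ := exists_growth_step hn hs hs1 hp hm hc₁ hθs
  refine ⟨b, κ, hb, hκ, fun r₀ Lam c₀ hr₀ hLam hc₀ => ?_⟩
  obtain ⟨i₀, hstep⟩ := hstep Lam hLam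
  set v₀ := min c₀ b with hv₀
  have hv₀0 : 0 < v₀ := lt_min hc₀ hb
  set H := r₀ + K + 2 ^ i₀ with hH
  have hH0 : 0 < H := by positivity
  refine ⟨v₀ / (2 * H) ^ n, by positivity, ?_⟩
  intro lam θ q W hW hθq Ω u hΩ hΩfin hu hu1 ε hε hεδ hmin hV r hr hball
  -- The radii generated by the growth step, whose `j`-th increment is `K + 2^(j + i₀)`; they are at
  -- most `H * 2^j` and start exactly at `r₀`.
  set ρ : ℕ → ℝ := fun j => r₀ + j * K + (2 ^ j - 1) * 2 ^ i₀ with hρ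
  have hρ0 : ρ 0 = r₀ := by simp [hρ]
  have hρs : ∀ j, ρ (j + 1) = ρ j + K + 2 ^ (j + i₀) := fun j => by
    simp only [hρ]; push_cast; ring
  have hρH : ∀ j, ρ j ≤ H * 2 ^ j := fun j => by
    have h1 : (1 : ℝ) ≤ 2 ^ j := one_le_pow₀ one_le_two
    have h2 : (j : ℝ) ≤ 2 ^ j := by exact_mod_cast (Nat.lt_two_pow_self (n := j)).le
    have h3 : r₀ ≤ r₀ * 2 ^ j := le_mul_of_one_le_right hr₀.le h1
    have h4 : (j : ℝ) * K ≤ 2 ^ j * K := by gcongr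
    have h5 : (0 : ℝ) < 2 ^ i₀ := by positivity
    simp only [hρ, hH]
    linarith
  have hρge : ∀ j : ℕ, r₀ + j * K ≤ ρ j := fun j => by
    have h1 : (1 : ℝ) ≤ 2 ^ j := one_le_pow₀ one_le_two
    have h2 : (0 : ℝ) ≤ (2 ^ j - 1) * 2 ^ i₀ := mul_nonneg (by linarith) (by positivity)
    simp only [hρ]
    linarith
  have hρpos : ∀ j, 0 ≤ ρ j := fun j => le_trans (by positivity) (hρge j)
  have hgrow : ∀ j, ρ j ≤ r → (2 ^ j) ^ n * v₀ ≤ superMeas θs u (ρ j) := by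
    intro j
    induction j with
    | zero =>
      intro _
      rw [hρ0, pow_zero, one_pow, one_mul]
      exact (min_le_left _ _).trans hV
    | succ j ih =>
      intro hj
      rw [hρs] at hj ⊢
      have h0 : (0 : ℝ) < 2 ^ (j + i₀) := by positivity
      have hv := ih (by linarith)
      have h1 : (2 ^ j) ^ n * v₀ ≤ b * (2 ^ j) ^ n := by
        rw [mul_comm b]; gcongr; exact min_le_right _ _
      -- The threshold for `ε` does not decrease with `j`, because `n ≥ 1`; smallness at the first
      -- step suffices.
      have h2 : ε ≤ κ * ((2 ^ j) ^ n * v₀ / 2 ^ j) := by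
        refine hεδ.trans ?_
        gcongr
        rw [le_div_iff₀ (by positivity), mul_comm]
        gcongr
        exact le_self_pow₀ (one_le_pow₀ one_le_two) hn.ne'
      have h3 := hstep lam θ q W hW hθq Ω u hΩ hΩfin hu hu1 ε hε hmin (ρ j) j _ (hρpos j)
        (by positivity) h1 hv h2 ((Metric.ball_subset_ball hj).trans hball)
      refine le_trans (le_of_eq ?_) h3
      rw [pow_succ, mul_pow]
      ring
  have hex : ∃ j, r < ρ j := by
    obtain ⟨j, hj⟩ := exists_nat_gt (r / K)
    refine ⟨j, lt_of_lt_of_le ?_ (hρge j)⟩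
    rw [div_lt_iff₀ hK] at hj
    linarith
  classical
  obtain ⟨j, hj⟩ : ∃ j, Nat.find hex = j + 1 := by
    refine Nat.exists_eq_succ_of_ne_zero fun h => ?_
    have := Nat.find_spec hex
    rw [h, hρ0] at this
    linarith
  have hjr : ρ j ≤ r := not_lt.1 (Nat.find_min hex (by omega))
  have hrj : r ≤ 2 * H * 2 ^ j := by
    have h1 := Nat.find_spec hex
    rw [hj] at h1
    have h2 := hρH (j + 1)
    rw [pow_succ] at h2
    linarith
  calc v₀ / (2 * H) ^ n * r ^ n ≤ v₀ / (2 * H) ^ n * (2 * H * 2 ^ j) ^ n := by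
        have : 0 ≤ r := hr₀.le.trans hr
        gcongr
    _ = (2 ^ j) ^ n * v₀ := by rw [mul_pow (2 * H)]; field_simp
    _ ≤ superMeas θs u (ρ j) := hgrow j hjr
    _ ≤ superMeas θs u r := superMeas_mono _ _ hjr

/-! ### Passing to Borel representatives -/

section Congr

variable {W : ℝ → ℝ} {s p ε : ℝ} {u v : Eu n → ℝ} {Ω : Set (Eu n)}

lemma kinetic_congr_ae (h : u =ᵐ[volume] v) (s p : ℝ) (Ω : Set (Eu n)) :
    kinetic s p u Ω = kinetic s p v Ω := by
  have key : ∀ A B : Set (Eu n), ∫⁻ x in A, ∫⁻ y in B, gagliardo s p u x y =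
      ∫⁻ x in A, ∫⁻ y in B, gagliardo s p v x y := fun A B => by
    refine lintegral_congr_ae ((ae_restrict_of_ae h).mono fun x hx => ?_)
    refine lintegral_congr_ae ((ae_restrict_of_ae h).mono fun y hy => ?_)
    simp only [gagliardo, hx, hy]
  rw [kinetic, kinetic, key, key]

lemma energy_congr_ae (h : u =ᵐ[volume] v) (W : ℝ → ℝ) (s p : ℝ) (Ω : Set (Eu n)) :
    energy W s p u Ω = energy W s p v Ω := by
  rw [energy, energy, kinetic_congr_ae h]
  congr 1
  exact lintegral_congr_ae ((ae_restrict_of_ae h).mono fun x hx => by simp only [hx])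

lemma EpsMinimizes.congr_ae (hmin : EpsMinimizes W s p ε u Ω) (h : u =ᵐ[volume] v) :
    EpsMinimizes W s p ε v Ω := by
  obtain ⟨⟨hu, hk, hu1⟩, hE⟩ := hmin
  refine ⟨⟨hu.congr h, kinetic_congr_ae h s p Ω ▸ hk, ?_⟩, fun w hw => ?_⟩
  · filter_upwards [h, hu1] with x hx h1
    rwa [← hx]
  · rw [← energy_congr_ae h]
    refine hE w ⟨hw.1, ?_⟩
    filter_upwards [h, hw.2] with x hx h1 hxΩ
    rw [hx, h1 hxΩ]

/-- A measurable modification clamped to `[-1,1]`; the comparison arguments then hold at every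
point. -/
lemma exists_measurable_representative (hu : AEMeasurable u) (hu1 : ∀ᵐ x, |u x| ≤ 1) :
    ∃ w : Eu n → ℝ, Measurable w ∧ (∀ x, |w x| ≤ 1) ∧ u =ᵐ[volume] w := by
  refine ⟨fun x => max (-1) (min 1 (hu.mk u x)),
    measurable_const.max (measurable_const.min hu.measurable_mk), fun x => ?_, ?_⟩
  · exact abs_le.2 ⟨le_max_left _ _, max_le (by norm_num) (min_le_left _ _)⟩
  · filter_upwards [hu.ae_eq_mk, hu1] with x hx h1
    obtain ⟨h2, h3⟩ := abs_le.1 h1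
    rw [← hx, min_eq_right h3, max_eq_right h2]

lemma superMeas_congr_ae (h : u =ᵐ[volume] v) (θ R : ℝ) : superMeas θ u R = superMeas θ v R := by
  refine measureReal_congr ?_
  filter_upwards [h] with x hx
  refine propext (and_congr Iff.rfl ?_)
  change θ < u x ↔ θ < v x
  rw [hx]

end Congr

/-! ### Reduction of the theorem to the growth of `{u > θs}`. -/

/-- The set `{u > θs}` is cut at `θ₂`. On the lower part `|1 + u|^m ≥ (1 + θs)^m`, and Chebyshev's
inequality gives a constant depending on `m` and `θs` only. -/
lemma superMeas_le_integral_add {m θ₂ θs θt : ℝ} (hm : 0 ≤ m) (hθs : -1 < θs) (hθt : θ₂ ≤ θt)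
    {u : Eu n → ℝ} (hu : AEMeasurable u) (hu1 : ∀ᵐ x, |u x| ≤ 1) (r : ℝ) :
    superMeas θs u r ≤
      (1 + θs) ^ (-m) * (∫ x in Metric.ball 0 r ∩ {x | θs < u x ∧ u x ≤ θt}, |1 + u x| ^ m) +
        volume.real (Metric.ball 0 r ∩ {x | θ₂ < u x}) := by
  set E := Metric.ball (0 : Eu n) r ∩ {x | θs < u x ∧ u x ≤ θt} with hE
  have hEfin : volume E ≠ ∞ := ((measure_mono inter_subset_left).trans_lt measure_ball_lt_top).ne
  have hFfin : volume (Metric.ball (0 : Eu n) r ∩ {x | θ₂ < u x}) ≠ ∞ :=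
    ((measure_mono inter_subset_left).trans_lt measure_ball_lt_top).ne
  have hEm : NullMeasurableSet E := Metric.isOpen_ball.measurableSet.nullMeasurableSet.inter
    ((nullMeasurableSet_lt aemeasurable_const hu).inter (nullMeasurableSet_le hu aemeasurable_const))
  have hs0 : 0 < 1 + θs := by linarith
  have hsub : Metric.ball (0 : Eu n) r ∩ {x | θs < u x} ⊆
      E ∪ Metric.ball (0 : Eu n) r ∩ {x | θ₂ < u x} := by
    rintro x ⟨hx, h1⟩
    have h1 : θs < u x := h1
    rcases le_or_gt (u x) θ₂ with h2 | h2
    · exact Or.inl ⟨hx, h1, h2.trans hθt⟩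
    · exact Or.inr ⟨hx, h2⟩
  have hEle : volume.real E ≤ (1 + θs) ^ (-m) * ∫ x in E, |1 + u x| ^ m := by
    have hint : IntegrableOn (fun x => |1 + u x| ^ m) E := by
      refine Measure.integrableOn_of_bounded (M := 2 ^ m) hEfin
        ((hu.const_add 1).abs.pow_const m).aestronglyMeasurable
        ((ae_restrict_of_ae hu1).mono fun x hx => ?_)
      obtain ⟨h1, h2⟩ := abs_le.1 hx
      rw [Real.norm_of_nonneg (by positivity)]
      exact Real.rpow_le_rpow (abs_nonneg _) (abs_le.2 ⟨by linarith, by linarith⟩) hm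
    rw [← integral_const_mul, ← mul_one (volume.real E), ← smul_eq_mul, ← setIntegral_const]
    refine setIntegral_mono_on₀ (integrableOn_const hEfin) (hint.const_mul _) hEm fun x hx => ?_
    have h1 : θs < u x := hx.2.1
    rw [abs_of_pos (by linarith), Real.rpow_neg hs0.le, inv_mul_eq_div,
      one_le_div (Real.rpow_pos_of_pos hs0 m)]
    exact Real.rpow_le_rpow hs0.le (by linarith) hm
  calc superMeas θs u r
      ≤ volume.real (E ∪ Metric.ball (0 : Eu n) r ∩ {x | θ₂ < u x}) :=
        measureReal_mono hsub (measure_union_ne_top hEfin hFfin)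
    _ ≤ volume.real E + volume.real (Metric.ball (0 : Eu n) r ∩ {x | θ₂ < u x}) :=
        measureReal_union_le _ _
    _ ≤ _ := by gcongr

/-- For unbounded `Ω` the ball of radius `2 r` serves: its closure is compact and lies in `B_{3r}`.
-/
lemma IsEpsMinimizer.exists_epsMinimizes {W : ℝ → ℝ} {s p ε r : ℝ} {u : Eu n → ℝ} {Ω : Set (Eu n)}
    (h : IsEpsMinimizer W s p ε u Ω) (hΩ : IsOpen Ω) (hr : 0 < r)
    (hball : Metric.ball 0 (3 * r) ⊆ Ω) :
    ∃ Ω' : Set (Eu n), MeasurableSet Ω' ∧ volume Ω' ≠ ∞ ∧ Metric.ball 0 r ⊆ Ω' ∧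
      EpsMinimizes W s p ε u Ω' := by
  obtain ⟨_, hbdd, hunbdd⟩ := h
  by_cases hb : Bornology.IsBounded Ω
  · exact ⟨Ω, hΩ.measurableSet, hb.measure_lt_top.ne,
      (Metric.ball_subset_ball (by linarith)).trans hball, hbdd hb⟩
  · have hcl : closure (Metric.ball (0 : Eu n) (2 * r)) ⊆ Metric.closedBall 0 (2 * r) :=
      Metric.closure_ball_subset_closedBall
    refine ⟨Metric.ball 0 (2 * r), Metric.isOpen_ball.measurableSet, measure_ball_lt_top.ne,
      Metric.ball_subset_ball (by linarith), hunbdd hb _ Metric.isOpen_ball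
        ((isCompact_closedBall _ _).of_isClosed_subset isClosed_closure hcl) ?_⟩
    exact (hcl.trans (Metric.closedBall_subset_ball (by linarith))).trans hball

end NonlocalPhase

end

/-- Density estimates for `ε`-minimizers. The order of the quantifiers records the dependence of the
constants: `c = c(m, θ_*)`, `δ = δ(s, n, p, m, c₁, θ_*, c₀)`, `Rs = R^*(s, n, p, m, c₁, θ_*, r₀)`,
`ct = c̃(s, n, p, m, Λ, c₁, θ_*, r₀, c₀)`. -/
theorem mainTheorem1 (m θs : ℝ) (hm : 1 < m) (hθs : -1 < θs) :
    ∃ c : ℝ, 0 < c ∧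
    ∀ (n : ℕ) (s p c₁ : ℝ), 1 ≤ n → 0 < s → s < 1 → 1 < p → p ≤ m → 0 < c₁ →
    ∃ δ : ℝ → ℝ, (∀ c₀ : ℝ, 0 < c₀ → 0 < δ c₀) ∧
    ∀ r₀ : ℝ, 0 < r₀ →
    ∃ Rs : ℝ, r₀ ≤ Rs ∧
    ∀ Lam c₀ : ℝ, 1 ≤ Lam → 0 < c₀ →
    ∃ ct : ℝ, 0 < ct ∧ ct < 1 ∧
    ∀ (lam θ q θ₁ θ₂ : ℝ) (W : ℝ → ℝ),
      NonlocalPhase.IsDegeneratePotential W m lam Lam θ q c₁ →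
      θ₁ ∈ Set.Ioc (-1) θ → θ₂ ∈ Set.Ioc (-1) θ →
      θs = min (min θ₁ θ₂) (-1 + q) →
    ∀ (Ω : Set (EuclideanSpace ℝ (Fin n))) (u : EuclideanSpace ℝ (Fin n) → ℝ),
      IsOpen Ω → u ∈ NonlocalPhase.X s p Ω →
      Metric.ball 0 r₀ ⊆ Ω →
      c₀ < MeasureTheory.volume.real (Metric.ball 0 r₀ ∩ {x | θ₁ < u x}) →
    ∀ ε : ℝ, 0 ≤ ε → ε < δ c₀ → NonlocalPhase.IsEpsMinimizer W s p ε u Ω →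
    ∀ r : ℝ, Rs ≤ r → Metric.ball 0 (3 * r) ⊆ Ω →
      ct * r ^ n <
        c * (∫ x in Metric.ball 0 r ∩ {x | θs < u x ∧ u x ≤ max (max θ₁ θ₂) (-1 + q)},
              |1 + u x| ^ m)
          + MeasureTheory.volume.real (Metric.ball 0 r ∩ {x | θ₂ < u x}) := by
  refine ⟨(1 + θs) ^ (-m), Real.rpow_pos_of_pos (by linarith) _, ?_⟩
  intro n s p c₁ hn hs hs1 hp _ hc₁
  obtain ⟨b, κ, hb, hκ, hdens⟩ :=
    NonlocalPhase.exists_density_estimate (n := n) hn hs hs1 hp hm hc₁ hθs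
  -- No enlargement of the starting radius is needed, so `Rs = r₀`.
  refine ⟨fun c₀ => κ * min c₀ b, fun c₀ hc₀ => mul_pos hκ (lt_min hc₀ hb), fun r₀ hr₀ =>
    ⟨r₀, le_rfl, fun Lam c₀ hLam hc₀ => ?_⟩⟩
  obtain ⟨ct, hct, hdens⟩ := hdens r₀ Lam c₀ hr₀ hLam hc₀
  -- Halving `ct` makes the final inequality strict; the cap `1 / 2` keeps the constant below `1`.
  refine ⟨min (ct / 2) (1 / 2), by positivity, (min_le_right _ _).trans_lt (by norm_num), ?_⟩
  intro lam θ q θ₁ θ₂ W hW _ _ hθ Ω u hΩ hu _ hc₀u ε hε hεδ hmin r hr hball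
  have hr0 : 0 < r := hr₀.trans_le hr
  obtain ⟨Ω', hΩ', hfin, hsub, hmin'⟩ := hmin.exists_epsMinimizes hΩ hr0 hball
  obtain ⟨w, hw, hw1, huw⟩ := NonlocalPhase.exists_measurable_representative hu.1 hu.2.2
  have hθ₁ : θs ≤ θ₁ := hθ.le.trans ((min_le_left _ _).trans (min_le_left _ _))
  have hV₀ : c₀ ≤ NonlocalPhase.superMeas θs w r₀ := by
    rw [← NonlocalPhase.superMeas_congr_ae huw]
    refine hc₀u.le.trans (MeasureTheory.measureReal_mono
      (Set.inter_subset_inter_right _ fun x hx => lt_of_le_of_lt hθ₁ hx) ?_)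
    exact ((MeasureTheory.measure_mono Set.inter_subset_left).trans_lt
      MeasureTheory.measure_ball_lt_top).ne
  have hV := hdens lam θ q W hW (hθ.le.trans (min_le_right _ _)) Ω' w hΩ' hfin hw hw1 ε hε hεδ.le
    (hmin'.congr_ae huw) hV₀ r hr hsub
  rw [← NonlocalPhase.superMeas_congr_ae huw] at hV
  calc min (ct / 2) (1 / 2) * r ^ n ≤ ct / 2 * r ^ n := by gcongr; exact min_le_left _ _
    _ < ct * r ^ n := by gcongr; linarith
    _ ≤ NonlocalPhase.superMeas θs u r := hV
    _ ≤ _ := NonlocalPhase.superMeas_le_integral_add (by linarith) hθs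
        ((le_max_right _ _).trans (le_max_left _ _)) hu.1 hu.2.2 r
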